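/- Let $(M^{4n+3},g)$, $n\ge 0$, be a nonempty closed Riemannian manifold that is 3-Sasakian: the holonomy of the metric cone $(C(M),\bar g)=(M\times(0,\infty),\,r^2g+dr\otimes dr)$ reduces to $Sp(n+1)$, i.e. there are smooth $\bar g$-orthogonal endomorphism fields $I,J,K$ of $TC(M)$, parallel for the Levi-Civita connection of $\bar g$, with $I^2=J^2=K^2=-1$ and $IJ=K$. For $\mathfrak j\in\{I,J,K\}$ put $\alpha_{\mathfrak j}(v)=\bar g(v,\mathfrak j\,\partial_r)$ for $v\in TM$, $M=M\times\{1\}$. For a cooriented contact structure $\xi$ on $M$ let $\mathcal C(M,\xi)$ be the space of cooriented contact structures on $M$ isotopic to $\xi$ (through a smooth isotopy of $M$ starting at the identity), with the $C^\infty$ topology, and let $\mathcal{AC}(M,\xi)$ be the space of pairs $(\eta,j)$ with $\eta=\ker\alpha\in\mathcal C(M,\xi)$ and $j$ an almost complex structure on $\eta$ compatible with $d\alpha|_\eta$, that is, $d\alpha(jX,jY)=d\alpha(X,Y)$ and $d\alpha(X,jX)>0$ for $X\neq0$. Then $\alpha_I,\alpha_J,\alpha_K$ are contact forms, and $$S:\mathbb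 S^2\to\mathcal C(M,\ker\alpha_I),\qquad S(z)=\ker(z_0\alpha_I+z_1\alpha_J+z_2\alpha_K),$$ is a well-defined continuous map (the linear contact sphere of the 3-Sasakian structure). Moreover: 1. The class $[S]$ is an element of infinite order in $\pi_2(\mathcal C(M,\ker\alpha_I),\ker\alpha_I)$. 2. $S$ lifts to a continuous map $\mathbb S^2\to\mathcal{AC}(M,\ker\alpha_I)$. For every $p\in M$, every linear isomorphism $\tau:T_pM\to\mathbb R^{4n+3}$ and every continuous $F:\mathbb S^2\to\mathcal{AC}(M,\ker\alpha_I)$ whose composition with the forgetful map $(\eta,j)\mapsto\eta$ is homotopic to $S$, the evaluation of $F$ at $p$ has degree $2(n+1)$ in the following sense. Write $F(z)=(\eta_z,j_z)$ and let $v_z$ be the positive unit normal vector of $\tau(\eta_{z,p})$. Let $\tilde\jmath_z$ be the complex structure on $\mathbb R^{4n+3}\oplus\mathbb R\partial_t$ that equals $\tau j_z\tau^{-1}$ on $v_z^\perp$ and satisfies $\tilde\jmath_z v_z=\partial_t$, $\tilde\jmath_z\partial_t=-v_z$. Then $z\mapsto\tilde\jmath_z$ is a sphere in the space of complex structures on $\mathbb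 R^{4n+4}$ (each component of which is homotopy equivalent to $SO(4n+4)/U(2n+2)$), and its image under $$\pi_2\big(SO(4n+4)/U(2n+2)\big)\xrightarrow{\ \partial\ }\pi_1(U(2n+2))\xrightarrow[\ \cong\ ]{\det_{\mathbb C}}\mathbb Z$$ is $2(n+1)$. (Here $\partial$ is the boundary map of the fibration $U(2n+2)\to SO(4n+4)\to SO(4n+4)/U(2n+2)$; it is injective with image of index $2$.) -/

import Mathlib

open scoped Manifold ContDiff Topology unitInterval RealInnerProductSpace

set_option linter.unusedSectionVars false

noncomputable section

namespace ContactSphere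

/-! ### Smooth fields on a manifold without boundary, and their `C^∞` topology -/

section Fields

variable {E : Type*} [NormedAddCommGroup E] [InnerProductSpace ℝ E] [FiniteDimensional ℝ E]
variable {M : Type*} [TopologicalSpace M] [ChartedSpace E M] [IsManifold 𝓘(ℝ, E) ∞ M]

variable (E M) in
/-- Smooth `1`-forms on `M`. -/
def OneForm : Type _ :=
  {α : ∀ x : M, TangentSpace 𝓘(ℝ, E) x →L[ℝ] ℝ //
    ContMDiff 𝓘(ℝ, E) (𝓘(ℝ, E).prod 𝓘(ℝ, E →L[ℝ] ℝ)) ∞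
      (fun x ↦ Bundle.TotalSpace.mk' (E →L[ℝ] ℝ) x (α x))}

variable (E M) in
/-- Smooth endomorphism fields of `TM`. -/
def EndField : Type _ :=
  {A : ∀ x : M, TangentSpace 𝓘(ℝ, E) x →L[ℝ] TangentSpace 𝓘(ℝ, E) x //
    ContMDiff 𝓘(ℝ, E) (𝓘(ℝ, E).prod 𝓘(ℝ, E →L[ℝ] E)) ∞
      (fun x ↦ Bundle.TotalSpace.mk' (E →L[ℝ] E) x (A x))}

/-- The expression of a `1`-form in the preferred chart at `x₀`. -/
def OneForm.inChart (α : OneForm E M) (x₀ : M) (y : E) : E →L[ℝ] ℝ :=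
  (α.1 ((extChartAt 𝓘(ℝ, E) x₀).symm y)).comp
    (mfderiv 𝓘(ℝ, E) 𝓘(ℝ, E) (extChartAt 𝓘(ℝ, E) x₀).symm y)

/-- The expression of an endomorphism field in the preferred chart at `x₀`. -/
def EndField.inChart (A : EndField E M) (x₀ : M) (y : E) : E →L[ℝ] E :=
  (mfderiv 𝓘(ℝ, E) 𝓘(ℝ, E) (extChartAt 𝓘(ℝ, E) x₀) ((extChartAt 𝓘(ℝ, E) x₀).symm y)).comp
    ((A.1 ((extChartAt 𝓘(ℝ, E) x₀).symm y)).comp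
      (mfderiv 𝓘(ℝ, E) 𝓘(ℝ, E) (extChartAt 𝓘(ℝ, E) x₀).symm y))

variable (E M) in
/-- The (weak) `C^∞` topology on a space `S` of smooth fields whose members have the expressions
`rep s x₀ : E → F` in the charts: uniform convergence of all derivatives of the chart expressions
on the compact subsets of the chart domains. -/
@[reducible]
def smoothTopology {S F : Type*} [NormedAddCommGroup F] [NormedSpace ℝ F]
    (rep : S → M → E → F) : TopologicalSpace S :=
  ⨅ (x₀ : M) (k : ℕ), TopologicalSpace.induced
    (fun s ↦ UniformOnFun.ofFun {K : Set E | IsCompact K ∧ K ⊆ (extChartAt 𝓘(ℝ, E) x₀).target}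
      (iteratedFDeriv ℝ k (rep s x₀)))
    inferInstance

instance : TopologicalSpace (OneForm E M) := smoothTopology E M OneForm.inChart

instance : TopologicalSpace (EndField E M) := smoothTopology E M EndField.inChart

/-- The exterior derivative `dα` at `x`, computed in the preferred chart at `x` (with respect to
which the tangent space at `x` is `E`): `dα(u, v) = ∂_u (α(v)) - ∂_v (α(u))`
for constant `u`, `v`. -/
def OneForm.d (α : OneForm E M) (x : M) (u v : TangentSpace 𝓘(ℝ, E) x) : ℝ :=
  let D : E →L[ℝ] E →L[ℝ] ℝ := fderiv ℝ (α.inChart x) (extChartAt 𝓘(ℝ, E) x x)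
  D u v - D v u

/-! ### Contact structures -/

/-- Contact forms: `α` vanishes nowhere and `dα` is non-degenerate on `ker α`, i.e. `α ∧ (dα)^k` is
a volume form, where `dim M = 2 k + 1`. -/
def OneForm.IsContact (α : OneForm E M) : Prop :=
  ∀ x : M, α.1 x ≠ 0 ∧ ∀ u : TangentSpace 𝓘(ℝ, E) x, α.1 x u = 0 →
    (∀ v : TangentSpace 𝓘(ℝ, E) x, α.1 x v = 0 → α.d x u v = 0) → u = 0

variable (E M) in
/-- The space of contact forms, with the `C^∞` topology. -/
def ContactForm : Type _ := {α : OneForm E M // α.IsContact}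

instance : TopologicalSpace (ContactForm E M) :=
  inferInstanceAs (TopologicalSpace {α : OneForm E M // α.IsContact})

/-- Two forms define the same cooriented hyperplane field: `β = f α` with `f > 0`. -/
def SameKernel (α β : ContactForm E M) : Prop :=
  ∃ f : M → ℝ, ∀ x, 0 < f x ∧ β.1.1 x = f x • α.1.1 x

theorem SameKernel.refl (α : ContactForm E M) : SameKernel α α :=
  ⟨fun _ ↦ 1, fun _ ↦ ⟨one_pos, (one_smul _ _).symm⟩⟩

theorem SameKernel.symm {α β : ContactForm E M} (h : SameKernel α β) : SameKernel β α := by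
  obtain ⟨f, hf⟩ := h
  refine ⟨fun x ↦ (f x)⁻¹, fun x ↦ ⟨inv_pos.2 (hf x).1, ?_⟩⟩
  rw [(hf x).2, smul_smul, inv_mul_cancel₀ (hf x).1.ne', one_smul]

theorem SameKernel.trans {α β γ : ContactForm E M} (h : SameKernel α β) (h' : SameKernel β γ) :
    SameKernel α γ := by
  obtain ⟨f, hf⟩ := h
  obtain ⟨f', hf'⟩ := h'
  refine ⟨fun x ↦ f' x * f x, fun x ↦ ⟨mul_pos (hf' x).1 (hf x).1, ?_⟩⟩
  rw [(hf' x).2, (hf x).2, smul_smul]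

instance ContactForm.setoid : Setoid (ContactForm E M) where
  r := SameKernel
  iseqv := ⟨SameKernel.refl, SameKernel.symm, SameKernel.trans⟩

variable (E M) in
/-- The space of (cooriented) contact structures `ker α` on `M`, with the quotient of the `C^∞`
topology on contact forms. -/
def ContactStructure : Type _ := Quotient (ContactForm.setoid (E := E) (M := M))

instance : TopologicalSpace (ContactStructure E M) :=
  inferInstanceAs (TopologicalSpace (Quotient (ContactForm.setoid (E := E) (M := M))))

/-- The cooriented contact structure `ker α`. -/
def ContactForm.ker (α : ContactForm E M) : ContactStructure E M := Quotient.mk _ α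

/-- `η` is isotopic to `ξ`: there is a smooth isotopy `φ_t` of `M` with `φ_0 = id` whose
end `φ_1` carries `ξ` to `η`, coorientations included. -/
def Isotopic (ξ η : ContactStructure E M) : Prop :=
  ∃ (α β : ContactForm E M) (φ : ℝ → Diffeomorph 𝓘(ℝ, E) 𝓘(ℝ, E) M M ∞) (f : M → ℝ),
    α.ker = ξ ∧ β.ker = η ∧
    ContMDiff (𝓘(ℝ, ℝ).prod 𝓘(ℝ, E)) 𝓘(ℝ, E) ∞ (fun p : ℝ × M ↦ φ p.1 p.2) ∧
    (∀ x, φ 0 x = x) ∧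
    ∀ x, 0 < f x ∧ ∀ v : TangentSpace 𝓘(ℝ, E) x,
      β.1.1 (φ 1 x) (mfderiv 𝓘(ℝ, E) 𝓘(ℝ, E) (φ 1) x v) = f x * α.1.1 x v

/-- The space `C(M, ξ)` of contact structures isotopic to `ξ`. Being isotopic to `ξ`, they all
induce the same orientation of `M` as `ξ`. -/
def IsotopyClass (ξ : ContactStructure E M) : Type _ := {η : ContactStructure E M // Isotopic ξ η}

instance (ξ : ContactStructure E M) : TopologicalSpace (IsotopyClass ξ) :=
  inferInstanceAs (TopologicalSpace {η : ContactStructure E M // Isotopic ξ η})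

/-! ### Contact structures with a compatible almost complex structure -/

variable (E M) in
/-- A contact form `α` and an endomorphism field `A` of `TM` that restricts to an almost complex
structure on `ker α`, compatible with the symplectic form `dα` on `ker α`. -/
structure CompatiblePair where
  α : ContactForm E M
  A : EndField E M
  map_ker : ∀ x u, α.1.1 x u = 0 → α.1.1 x (A.1 x u) = 0
  sq : ∀ x u, α.1.1 x u = 0 → A.1 x (A.1 x u) = -u
  invariant : ∀ x u v, α.1.1 x u = 0 → α.1.1 x v = 0 →
    α.1.d x (A.1 x u) (A.1 x v) = α.1.d x u v
  pos : ∀ x u, α.1.1 x u = 0 → u ≠ 0 → 0 < α.1.d x u (A.1 x u)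

instance : TopologicalSpace (CompatiblePair E M) :=
  TopologicalSpace.induced (fun c ↦ (c.α, c.A)) inferInstance

/-- Two pairs are identified if they have the same cooriented contact structure `ξ` and
the same `j ∈ End(ξ)`. -/
instance CompatiblePair.setoid : Setoid (CompatiblePair E M) where
  r c c' := SameKernel c.α c'.α ∧ ∀ x u, c.α.1.1 x u = 0 → c.A.1 x u = c'.A.1 x u
  iseqv := by
    refine ⟨fun c ↦ ⟨.refl _, fun _ _ _ ↦ rfl⟩, ?_, ?_⟩
    · rintro c c' ⟨h, h'⟩
      refine ⟨h.symm, fun x u hu ↦ (h' x u ?_).symm⟩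
      obtain ⟨f, hf⟩ := h.symm
      rw [(hf x).2, smul_apply, hu, smul_zero]
    · rintro c c' c'' ⟨h₁, h₁'⟩ ⟨h₂, h₂'⟩
      refine ⟨h₁.trans h₂, fun x u hu ↦ (h₁' x u hu).trans (h₂' x u ?_)⟩
      obtain ⟨f, hf⟩ := h₁
      rw [(hf x).2, smul_apply, hu, smul_zero]

variable (E M) in
/-- The space of pairs `(ξ, j)` of a contact structure and a compatible almost complex structure
`j ∈ End(ξ)`. -/
def CompatibleStructure : Type _ := Quotient (CompatiblePair.setoid (E := E) (M := M))

instance : TopologicalSpace (CompatibleStructure E M) :=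
  inferInstanceAs (TopologicalSpace (Quotient (CompatiblePair.setoid (E := E) (M := M))))

/-- `(ξ, j) ↦ ξ`. -/
def CompatibleStructure.forget : CompatibleStructure E M → ContactStructure E M :=
  Quotient.map CompatiblePair.α fun _ _ h ↦ h.1

theorem CompatibleStructure.continuous_forget :
    Continuous (CompatibleStructure.forget (E := E) (M := M)) := by
  have h : Continuous (fun c : CompatiblePair E M ↦ c.α) :=
    continuous_fst.comp
      (continuous_induced_dom (f := fun c : CompatiblePair E M ↦ (c.α, c.A)))
  exact continuous_coinduced_dom.2 (continuous_quotient_mk'.comp h)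

/-- The space `AC(M, ξ)` of pairs `(η, j)` with `η ∈ C(M, ξ)` and `j` compatible with `η`. -/
def CompatibleOver (ξ : ContactStructure E M) : Type _ :=
  {c : CompatibleStructure E M // Isotopic ξ c.forget}

instance (ξ : ContactStructure E M) : TopologicalSpace (CompatibleOver ξ) :=
  inferInstanceAs (TopologicalSpace {c : CompatibleStructure E M // Isotopic ξ c.forget})

/-- The forgetful map `AC(M, ξ) → C(M, ξ)`. -/
def forget (ξ : ContactStructure E M) : C(CompatibleOver ξ, IsotopyClass ξ) where
  toFun c := ⟨c.1.forget, c.2⟩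
  continuous_toFun := Continuous.subtype_mk
    (CompatibleStructure.continuous_forget.comp continuous_subtype_val) _

end Fields

/-! ### Linear almost contact structures and the evaluation map -/

section Evaluation

variable {E : Type*} [NormedAddCommGroup E] [InnerProductSpace ℝ E] [FiniteDimensional ℝ E]
variable {M : Type*} [TopologicalSpace M] [ChartedSpace E M] [IsManifold 𝓘(ℝ, E) ∞ M]

variable (E) in
/-- Almost contact structures on the Euclidean space `E`: a cooriented hyperplane, given by its unit
normal vector `v`, and a complex structure on it, given by its extension `j` by `0` to the line
spanned by `v`. -/
def LinearAlmostContact : Type _ :=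
  {c : E × (E →L[ℝ] E) // ‖c.1‖ = 1 ∧ c.2 c.1 = 0 ∧ (∀ w, ⟪c.1, c.2 w⟫ = 0) ∧
    ∀ w, ⟪c.1, w⟫ = 0 → c.2 (c.2 w) = -w}

/-- The space of complex structures on a real vector space. -/
def ComplexStr (V : Type*) [NormedAddCommGroup V] [NormedSpace ℝ V] : Type _ :=
  {J : V →L[ℝ] V // ∀ w, J (J w) = -w}

/-- Orthogonal projection along a unit vector `v`. -/
def projPerp (v : E) : E →L[ℝ] E :=
  ContinuousLinearMap.id ℝ E - (innerSL ℝ v).smulRight v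

theorem projPerp_apply (v w : E) : projPerp v w = w - ⟪v, w⟫ • v := rfl

/-- Stabilization `(v, j) ↦ j̃` to `E ⊕ ℝ ∂_t`: `j̃ = j` on the orthogonal space of `v`,
`j̃ v = ∂_t`, `j̃ ∂_t = -v`. -/
def stabilize (c : LinearAlmostContact E) : ComplexStr (E × ℝ) :=
  ⟨(c.1.2.comp (ContinuousLinearMap.fst ℝ E ℝ) -
      (ContinuousLinearMap.snd ℝ E ℝ).smulRight c.1.1).prod
      ((innerSL ℝ c.1.1).comp (ContinuousLinearMap.fst ℝ E ℝ)), by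
    obtain ⟨⟨v, j⟩, hv, hjv, hvj, hj⟩ := c
    rintro ⟨w, s⟩
    dsimp only at *
    have hvnorm : ‖v‖ = 1 := hv
    have hvv : ⟪v, v⟫ = 1 := by rw [real_inner_self_eq_norm_sq, hv]; norm_num
    have h1 : j w = j (w - ⟪v, w⟫ • v) := by simp [hjv]
    have h2 : j (j w) = -(w - ⟪v, w⟫ • v) := by
      rw [h1]; refine hj _ ?_
      rw [inner_sub_right, inner_smul_right, hvv]; ring
    ext
    · simp [hjv, h2]
    · simp [inner_sub_right, inner_smul_right, hvj, hvnorm]⟩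

/-- The unit vector representing a covector up to positive factors. -/
def unitNormal (a : E →L[ℝ] ℝ) : E :=
  ‖(InnerProductSpace.toDual ℝ E).symm a‖⁻¹ • (InnerProductSpace.toDual ℝ E).symm a

theorem unitNormal_smul {r : ℝ} (hr : 0 < r) (a : E →L[ℝ] ℝ) :
    unitNormal (r • a) = unitNormal a := by
  have : (InnerProductSpace.toDual ℝ E).symm (r • a) =
      r • (InnerProductSpace.toDual ℝ E).symm a := by simp
  unfold unitNormal
  rw [this, norm_smul, Real.norm_of_nonneg hr.le, smul_smul, mul_inv]
  congr 1
  field_simp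

theorem norm_unitNormal {a : E →L[ℝ] ℝ} (ha : a ≠ 0) : ‖unitNormal a‖ = 1 := by
  have : (InnerProductSpace.toDual ℝ E).symm a ≠ 0 := by simpa using ha
  rw [unitNormal, norm_smul, norm_inv, norm_norm, inv_mul_cancel₀ (norm_ne_zero_iff.2 this)]

theorem inner_unitNormal_eq_zero {a : E →L[ℝ] ℝ} {w : E} (ha : a ≠ 0) :
    ⟪unitNormal a, w⟫ = 0 ↔ a w = 0 := by
  have : (InnerProductSpace.toDual ℝ E).symm a ≠ 0 := by simpa using ha
  rw [unitNormal, real_inner_smul_left, InnerProductSpace.toDual_symm_apply]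
  simp [ha]

theorem apply_projPerp_unitNormal {a : E →L[ℝ] ℝ} (ha : a ≠ 0) (w : E) :
    a (projPerp (unitNormal a) w) = 0 := by
  rw [← inner_unitNormal_eq_zero ha, projPerp_apply, inner_sub_right, inner_smul_right,
    real_inner_self_eq_norm_sq, norm_unitNormal ha]
  ring

/-- The covector `τ_* α_p`. -/
def pushCovector {p : M} (τ : TangentSpace 𝓘(ℝ, E) p ≃L[ℝ] E) (α : ContactForm E M) : E →L[ℝ] ℝ :=
  (α.1.1 p).comp (τ.symm : E →L[ℝ] TangentSpace 𝓘(ℝ, E) p)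

theorem pushCovector_ne_zero {p : M} (τ : TangentSpace 𝓘(ℝ, E) p ≃L[ℝ] E) (α : ContactForm E M) :
    pushCovector τ α ≠ 0 := by
  intro h
  refine (α.2 p).1 (ContinuousLinearMap.ext fun u ↦ ?_)
  have := congrArg (fun a ↦ a (τ u)) h
  simpa [pushCovector] using this

/-- Evaluation of a pair at `p`, in the framing `τ` of the tangent space at `p`. -/
def evalPair (p : M) (τ : TangentSpace 𝓘(ℝ, E) p ≃L[ℝ] E) (c : CompatiblePair E M) :
    LinearAlmostContact E :=
  ⟨(unitNormal (pushCovector τ c.α),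
    ((τ : TangentSpace 𝓘(ℝ, E) p →L[ℝ] E).comp ((c.A.1 p).comp
      (τ.symm : E →L[ℝ] TangentSpace 𝓘(ℝ, E) p))).comp
      (projPerp (unitNormal (pushCovector τ c.α)))), by
    have ha := pushCovector_ne_zero τ c.α
    have hk : ∀ w, c.α.1.1 p (τ.symm (projPerp (unitNormal (pushCovector τ c.α)) w)) = 0 :=
      fun w ↦ apply_projPerp_unitNormal ha w
    have hp : ∀ w, ⟪unitNormal (pushCovector τ c.α), w⟫ = 0 →
        projPerp (unitNormal (pushCovector τ c.α)) w = w := fun w hw ↦ by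
      rw [projPerp_apply, hw, zero_smul, sub_zero]
    have hperp : ∀ w, ⟪unitNormal (pushCovector τ c.α),
        τ (c.A.1 p (τ.symm (projPerp (unitNormal (pushCovector τ c.α)) w)))⟫ = 0 := fun w ↦ by
      rw [inner_unitNormal_eq_zero ha]
      simpa [pushCovector] using c.map_ker p _ (hk w)
    refine ⟨norm_unitNormal ha, ?_, hperp, fun w hw ↦ ?_⟩
    · have : projPerp (unitNormal (pushCovector τ c.α)) (unitNormal (pushCovector τ c.α)) = 0 := by
        rw [projPerp_apply, real_inner_self_eq_norm_sq, norm_unitNormal ha]; simp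
      simp [this]
    · change τ (c.A.1 p (τ.symm (projPerp _ (τ (c.A.1 p (τ.symm (projPerp _ w))))))) = -w
      rw [hp _ (hperp w), τ.symm_apply_apply, c.sq p _ (hk w), hp w hw]
      simp⟩

/-- The evaluation map `e_{(p,τ)} (ξ, j) = (τ_* ξ_p, τ_* j_p)`. -/
def evalAt (p : M) (τ : TangentSpace 𝓘(ℝ, E) p ≃L[ℝ] E) :
    CompatibleStructure E M → LinearAlmostContact E :=
  Quotient.lift (evalPair p τ) (by
    rintro c c' ⟨⟨f, hf⟩, h⟩
    have hv : unitNormal (pushCovector τ c'.α) = unitNormal (pushCovector τ c.α) := by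
      rw [← unitNormal_smul (hf p).1 (pushCovector τ c.α)]
      congr 1
      ext w
      simp [pushCovector, (hf p).2]
    refine Subtype.ext (Prod.ext hv.symm ?_)
    ext w : 1
    change τ (c.A.1 p (τ.symm (projPerp _ w))) = τ (c'.A.1 p (τ.symm (projPerp _ w)))
    rw [hv, h p]
    exact apply_projPerp_unitNormal (pushCovector_ne_zero τ c.α) w)

end Evaluation

/-! ### Spheres in a topological space and their homotopy classes -/

section Spheres

/-- The standard `2`-sphere in `ℝ³`. -/
abbrev S2 : Type := Metric.sphere (0 : EuclideanSpace ℝ (Fin 3)) 1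

/-- `16 s (1 - s) t (1 - t)`, which vanishes exactly on the boundary of the square. -/
def bubble (t : Fin 2 → I) : ℝ := 16 * (t 0 * (1 - t 0)) * (t 1 * (1 - t 1))

/-- The denominator in `collapse`. -/
def collapseDen (t : Fin 2 → I) : ℝ :=
  (2 * t 0 - 1) ^ 2 + (2 * t 1 - 1) ^ 2 + bubble t ^ 2

theorem collapseDen_pos (t : Fin 2 → I) : 0 < collapseDen t := by
  unfold collapseDen
  by_cases h : (2 * (t 0 : ℝ) - 1) = 0
  · by_cases h' : (2 * (t 1 : ℝ) - 1) = 0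
    · have h0 : (t 0 : ℝ) = 1 / 2 := by linarith
      have h1 : (t 1 : ℝ) = 1 / 2 := by linarith
      rw [bubble, h0, h1]; norm_num
    · positivity
  · positivity

/-- The map of the square onto the sphere that collapses the boundary of the square to the point
`(1, 0, 0)` and is a homeomorphism of the interior onto the complement of that point: inverse
stereographic projection, applied to `(2 s - 1, 2 t - 1) / bubble (s, t) ∈ ℝ²`. -/
def collapseVec (t : Fin 2 → I) : EuclideanSpace ℝ (Fin 3) :=
  !₂[((2 * t 0 - 1) ^ 2 + (2 * t 1 - 1) ^ 2 - bubble t ^ 2) / collapseDen t,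
    2 * bubble t * (2 * t 0 - 1) / collapseDen t,
    2 * bubble t * (2 * t 1 - 1) / collapseDen t]

theorem collapseVec_mem (t : Fin 2 → I) :
    collapseVec t ∈ Metric.sphere (0 : EuclideanSpace ℝ (Fin 3)) 1 := by
  rw [mem_sphere_zero_iff_norm, EuclideanSpace.norm_eq, Real.sqrt_eq_one, Fin.sum_univ_three]
  have h := (collapseDen_pos t).ne'
  simp only [collapseVec, Real.norm_eq_abs, sq_abs]
  simp
  field_simp
  unfold collapseDen
  ring

/-- See `collapseVec`. -/
def collapse : C(Fin 2 → I, S2) where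
  toFun t := ⟨collapseVec t, collapseVec_mem t⟩
  continuous_toFun := by
    refine Continuous.subtype_mk ?_ _
    have hb : Continuous bubble := by unfold bubble; fun_prop
    have hd : Continuous collapseDen := by unfold collapseDen; fun_prop
    refine (PiLp.continuous_toLp 2 _).comp (continuous_pi fun i ↦ ?_)
    fin_cases i
    · exact Continuous.div (by fun_prop) hd fun t ↦ (collapseDen_pos t).ne'
    · exact Continuous.div (by fun_prop) hd fun t ↦ (collapseDen_pos t).ne'
    · exact Continuous.div (by fun_prop) hd fun t ↦ (collapseDen_pos t).ne'

/-- The point `(1, 0, 0)` of the sphere. -/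
def basePoint : S2 := ⟨EuclideanSpace.single 0 1, by simp⟩

theorem collapse_boundary (t : Fin 2 → I) (ht : t ∈ Cube.boundary (Fin 2)) :
    collapse t = basePoint := by
  have hb : bubble t = 0 := by
    obtain ⟨i, hi⟩ := ht
    unfold bubble
    fin_cases i <;> rcases hi with hi | hi <;> simp at hi <;> simp [hi]
  have hd := (collapseDen_pos t).ne'
  refine Subtype.ext ?_
  change collapseVec t = _
  ext i
  fin_cases i
  · simp only [collapseDen, hb] at hd
    simp [collapseVec, basePoint, collapseDen, hb]
    simpa using hd
  · simp [collapseVec, basePoint, hb]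
  · simp [collapseVec, basePoint, hb]

/-- The class in `π_2` of a sphere in `X`. -/
def sphereClass {X : Type*} [TopologicalSpace X] (f : C(S2, X)) : π_ 2 X (f basePoint) :=
  Quotient.mk (GenLoop.Homotopic.setoid (Fin 2) (f basePoint))
    ⟨f.comp collapse, fun t ht ↦ congrArg f (collapse_boundary t ht)⟩

/-- The boundary of the square, traversed counterclockwise for `0 ≤ t ≤ 4`, starting at `(0,0)`. -/
def squareLoop (t : ℝ) : Fin 2 → I :=
  ![Set.projIcc 0 1 zero_le_one (min t (3 - t)), Set.projIcc 0 1 zero_le_one (min (t - 1) (4 - t))]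

/-- The sphere `f` in the space of complex structures on `V` (`dim V = 2 k`) has degree `d`, i.e.
`d` is the image of its class under the boundary map of the fibration
`GL(2k, ℝ) → GL(2k, ℝ) / GL(k, ℂ)` (homotopy equivalent to `SO(2k) → SO(2k) / U(k)`), followed by
the identification of `π_1 (GL(k, ℂ))` (equal to `π_1 (U(k))`) with `ℤ` by the complex determinant.
Here `P` is a lift of `f` over the square, given by a complex frame `ℂᵏ ≃ (V, f)`, and
`P(b₀)⁻¹ P(b)`, for `b` on the boundary of the square, is the boundary loop in `GL(k, ℂ)`; `L` is a
continuous logarithm of its determinant. -/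
def HasDegree {V : Type*} [NormedAddCommGroup V] [NormedSpace ℝ V] (k : ℕ)
    (f : S2 → ComplexStr V) (d : ℤ) : Prop :=
  ∃ (P : (Fin 2 → I) → ((Fin k → ℂ) ≃L[ℝ] V)) (L : ℝ → ℂ),
    Continuous (fun t ↦ (P t : (Fin k → ℂ) →L[ℝ] V)) ∧
    (∀ t z, P t (Complex.I • z) = (f (collapse t)).1 (P t z)) ∧
    ContinuousOn L (Set.Icc 0 4) ∧
    (∀ t ∈ Set.Icc (0 : ℝ) 4, Complex.exp (L t) =
      Matrix.det (Matrix.of fun i j : Fin k ↦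
        (P (squareLoop 0)).symm (P (squareLoop t) (Pi.single j 1)) i)) ∧
    L 4 - L 0 = 2 * Real.pi * Complex.I * d

end Spheres

/-! ### The metric cone and 3-Sasakian structures -/

section Cone

/-- The half-line `r > 0`. -/
abbrev Ray : TopologicalSpace.Opens ℝ := ⟨Set.Ioi 0, isOpen_Ioi⟩

variable {E : Type*} [NormedAddCommGroup E] [InnerProductSpace ℝ E] [FiniteDimensional ℝ E]
variable {M : Type*} [TopologicalSpace M] [ChartedSpace E M] [IsManifold 𝓘(ℝ, E) ∞ M]

/-- Riemannian metrics on `M`. -/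
abbrev RMetric (E M : Type*) [NormedAddCommGroup E] [InnerProductSpace ℝ E]
    [FiniteDimensional ℝ E] [TopologicalSpace M] [ChartedSpace E M] [IsManifold 𝓘(ℝ, E) ∞ M] :=
  Bundle.ContMDiffRiemannianMetric 𝓘(ℝ, E) ∞ E (fun x : M ↦ TangentSpace 𝓘(ℝ, E) x)

/-- The tangent space `T_x M ⊕ ℝ ∂_r` of the cone `M × (0, ∞)` at `c = (x, r)`. -/
abbrev ConeTangent (c : M × Ray) : Type _ := TangentSpace (𝓘(ℝ, E).prod 𝓘(ℝ, ℝ)) c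

/-- The vector field `X` on the cone is differentiable at `c`. -/
def FieldDiffAt (X : ∀ c : M × Ray, TangentSpace (𝓘(ℝ, E).prod 𝓘(ℝ, ℝ)) c) (c : M × Ray) : Prop :=
  MDifferentiableAt (𝓘(ℝ, E).prod 𝓘(ℝ, ℝ)) ((𝓘(ℝ, E).prod 𝓘(ℝ, ℝ)).prod 𝓘(ℝ, E × ℝ))
    (fun c ↦ Bundle.TotalSpace.mk' (E × ℝ) c (X c)) c

/-- The cone metric `r² g + dr ⊗ dr`. -/
def coneInner (g : RMetric E M) (c : M × Ray) (u v : ConeTangent (E := E) c) : ℝ :=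
  (c.2 : ℝ) ^ 2 * g.inner c.1 (u : E × ℝ).1 (v : E × ℝ).1 + (u : E × ℝ).2 * (v : E × ℝ).2

/-- `D` is the Levi-Civita connection of the cone metric. -/
structure IsLeviCivita (g : RMetric E M)
    (D : CovariantDerivative (𝓘(ℝ, E).prod 𝓘(ℝ, ℝ)) (E × ℝ)
      (fun c : M × Ray ↦ TangentSpace (𝓘(ℝ, E).prod 𝓘(ℝ, ℝ)) c)) : Prop where
  torsion : D.torsion = 0
  metric : ∀ (X Y : ∀ c : M × Ray, TangentSpace (𝓘(ℝ, E).prod 𝓘(ℝ, ℝ)) c) (c : M × Ray)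
    (u : ConeTangent (E := E) c),
    FieldDiffAt X c → FieldDiffAt Y c →
    mfderiv (𝓘(ℝ, E).prod 𝓘(ℝ, ℝ)) 𝓘(ℝ, ℝ) (fun c ↦ coneInner g c (X c) (Y c)) c u =
      coneInner g c (D X c u) (Y c) + coneInner g c (X c) (D Y c u)

variable (E M) in
/-- Endomorphism fields of the tangent bundle of the cone. -/
abbrev ConeEnd : Type _ := ∀ c : M × Ray, ConeTangent (E := E) c →L[ℝ] ConeTangent (E := E) c

/-- `A` is a smooth, orthogonal endomorphism field that is parallel for `D`. -/
structure IsParallelIsometry (g : RMetric E M)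
    (D : CovariantDerivative (𝓘(ℝ, E).prod 𝓘(ℝ, ℝ)) (E × ℝ)
      (fun c : M × Ray ↦ TangentSpace (𝓘(ℝ, E).prod 𝓘(ℝ, ℝ)) c)) (A : ConeEnd E M) : Prop where
  smooth : ContMDiff (𝓘(ℝ, E).prod 𝓘(ℝ, ℝ))
    ((𝓘(ℝ, E).prod 𝓘(ℝ, ℝ)).prod 𝓘(ℝ, (E × ℝ) →L[ℝ] (E × ℝ))) ∞
    (fun c ↦ Bundle.TotalSpace.mk' ((E × ℝ) →L[ℝ] (E × ℝ)) c (A c))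
  orthogonal : ∀ c u v, coneInner g c (A c u) (A c v) = coneInner g c u v
  parallel : ∀ (X : ∀ c : M × Ray, TangentSpace (𝓘(ℝ, E).prod 𝓘(ℝ, ℝ)) c) (c : M × Ray)
    (u : ConeTangent (E := E) c),
    FieldDiffAt X c → D (fun c ↦ A c (X c)) c u = A c (D X c u)

/-- A 3-Sasakian structure on `(M, g)`: a reduction of the holonomy of the cone metric to the
symplectic group, i.e. a hyperkähler structure on the metric cone. It is given by three orthogonal
endomorphism fields of the tangent bundle of the cone that satisfy the quaternion relations and are
parallel for the Levi-Civita connection. -/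
structure ThreeSasakian (g : RMetric E M) where
  jI : ConeEnd E M
  jJ : ConeEnd E M
  jK : ConeEnd E M
  jI_sq : ∀ c u, jI c (jI c u) = -u
  jJ_sq : ∀ c u, jJ c (jJ c u) = -u
  jK_sq : ∀ c u, jK c (jK c u) = -u
  jI_jJ : ∀ c u, jI c (jJ c u) = jK c u
  hyperkahler : ∃ D : CovariantDerivative (𝓘(ℝ, E).prod 𝓘(ℝ, ℝ)) (E × ℝ)
      (fun c : M × Ray ↦ TangentSpace (𝓘(ℝ, E).prod 𝓘(ℝ, ℝ)) c),
    IsLeviCivita g D ∧ IsParallelIsometry g D jI ∧ IsParallelIsometry g D jJ ∧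
      IsParallelIsometry g D jK

/-- The point `r = 1`. -/
def rayOne : Ray := ⟨1, Set.mem_Ioi.2 one_pos⟩

/-- The `1`-form `α_A (v) = ḡ(v, A ∂_r)` on `M = M × {1}`. -/
def IsAssociatedForm (g : RMetric E M) (A : ConeEnd E M) (α : OneForm E M) : Prop :=
  ∀ (x : M) (v : TangentSpace 𝓘(ℝ, E) x),
    α.1 x v = coneInner g (x, rayOne) ((v, 0) : E × ℝ) (A (x, rayOne) ((0, 1) : E × ℝ))

/-- `f` is the linear contact sphere spanned by three contact forms:
`f(z) = ker (z₀ α₀ + z₁ α₁ + z₂ α₂)`. -/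
def IsLinearContactSphere {ξ : ContactStructure E M} (f : S2 → IsotopyClass ξ)
    (α₀ α₁ α₂ : ContactForm E M) : Prop :=
  ∀ z : S2, ∃ β : ContactForm E M, β.ker = (f z).1 ∧
    ∀ x, β.1.1 x = z.1 0 • α₀.1.1 x + z.1 1 • α₁.1.1 x + z.1 2 • α₂.1.1 x

end Cone

end ContactSphere

end

open ContactSphere

/-! Write `q_z = z₀ I + z₁ J + z₂ K` and `α_z = z₀ α_I + z₁ α_J + z₂ α_K`. On the cone `∇_u ∂_r = u`
at `r = 1` for `u` tangent to `M`, and `I`, `J`, `K` are parallel; hence `dα_z(u, v) = 2 ḡ(q_z u,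
v)` (`IsParallelIsometry.d_eq`). It follows that `q_z` preserves `ker α_z` and that `dα_z(v, q_z u)
= 2 ḡ(v, u)` for `u` in this kernel: `α_z` is a contact form and `q_z` restricts to a compatible
almost complex structure, which is the lift of `S`. For the isotopy, let `z = cos θ e₀ + sin θ w`
and let `e` be a unit vector orthogonal to `e₀` and `w`. By Cartan's formula the flow of `(θ / 2)
q_e ∂_r` rotates the pair of forms `α_I`, `α_w`, so one of its maps pulls `α_z` back to `α_I`.

The lift, evaluated at a point, is conjugate to the sphere `q_z` in `End(T_p M ⊕ ℝ)` up to a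
homotopy that moves the Reeb vector to the unit normal. The degree of `q_z` comes from the Hopf map:
over the square `q_z = Q I Q⁻¹` for a quaternion `Q` that on the boundary is a complex number
turning once around `0`, so its determinant in complex dimension `2n + 2` has winding number `2n +
2` (`IsQuaternionic.hasDegree`).

The homotopy theory of the forgetful map is avoided. At `p` a contact structure alone determines,
after stabilization, a non-degenerate skew operator, whose polar part is a complex structure
depending continuously on the contact structure (`polarAt`). Every compatible `j` stabilizes to a
complex structure homotopic to this polar part (`exists_polar_homotopy`). Therefore the degree
depends only on the homotopy class of the sphere of contact structures (`HasDegree.of_homotopic`).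
It is also additive under concatenation and invariant under based homotopies, so a sphere of
non-zero degree has infinite order (`not_isOfFinOrder_sphereClass`).

Two tools support this. Homotopies of complex structures are covered by isomorphisms because close
structures are intertwined by `(1 - J J₀) / 2` (`exists_isUnit_intertwining`). Smooth flows on
closed manifolds come from the inverse function theorem in a space of curves (`exists_local_flow`,
`exists_flow`). -/

noncomputable section

namespace ContactSphere

/-! ### Lifting homotopies of complex structures -/

section Transport

variable {V : Type*} [NormedAddCommGroup V] [NormedSpace ℝ V]

/-- The intertwiner `(1 - J J₀) / 2` of two complex structures, invertible if they are close. -/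
def intertwiner (J J₀ : V →L[ℝ] V) : V →L[ℝ] V := (2⁻¹ : ℝ) • (1 - J * J₀)

/-- Both sides equal `(J + J₀) / 2`. -/
theorem mul_intertwiner {J J₀ : V →L[ℝ] V} (hJ : J * J = -1) (hJ₀ : J₀ * J₀ = -1) :
    J * intertwiner J J₀ = intertwiner J J₀ * J₀ := by
  simp only [intertwiner, mul_smul_comm, smul_mul_assoc, mul_sub, sub_mul, mul_one, one_mul]
  rw [← mul_assoc, hJ, mul_assoc, hJ₀]
  simp [add_comm]

theorem intertwiner_self {J : V →L[ℝ] V} (hJ : J * J = -1) : intertwiner J J = 1 := by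
  rw [intertwiner, hJ, sub_neg_eq_add, ← two_smul ℝ (1 : V →L[ℝ] V), smul_smul]
  norm_num

/-- The intertwiner is `1 - (J - J₀) J₀ / 2`, so a Neumann series inverts it. -/
theorem isUnit_intertwiner [CompleteSpace V] {J J₀ : V →L[ℝ] V} (hJ₀ : J₀ * J₀ = -1)
    (h : ‖J - J₀‖ * ‖J₀‖ < 2) : IsUnit (intertwiner J J₀) := by
  have e : intertwiner J J₀ = 1 - (2⁻¹ : ℝ) • ((J - J₀) * J₀) := by
    have h2 : (1 : V →L[ℝ] V) = (2⁻¹ : ℝ) • (1 + 1) := by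
      rw [← two_smul ℝ (1 : V →L[ℝ] V), smul_smul]; norm_num
    rw [sub_mul, hJ₀, intertwiner]
    nth_rewrite 2 [h2]
    rw [← smul_sub]
    congr 1
    abel
  rw [e]
  refine isUnit_one_sub_of_norm_lt_one ?_
  rw [norm_smul]
  have := norm_mul_le (J - J₀) J₀
  norm_num
  linarith

theorem continuous_intertwiner {X : Type*} [TopologicalSpace X] {f g : X → V →L[ℝ] V}
    (hf : Continuous f) (hg : Continuous g) : Continuous fun x ↦ intertwiner (f x) (g x) := by
  unfold intertwiner; fun_prop

/-- Both orders of the two times are covered because the induction over the interval needs its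
relation in both directions between close times. -/
theorem eventually_norm_sub_mul_norm_lt {X Y W : Type*} [TopologicalSpace X] [CompactSpace X]
    [TopologicalSpace Y] [NormedAddCommGroup W] (G : C(Y, C(X, W))) (s : Y) :
    ∀ᶠ s' in 𝓝 s, (∀ x, ‖G s' x - G s x‖ * ‖G s x‖ < 2) ∧ ∀ x, ‖G s x - G s' x‖ * ‖G s' x‖ < 2 := by
  have h1 : ∀ᶠ s' in 𝓝 s, ‖G s' - G s‖ * ‖G s‖ < 2 := by
    have hc : Continuous fun s' ↦ ‖G s' - G s‖ * ‖G s‖ := by fun_prop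
    exact hc.continuousAt.eventually_lt_const (by simp)
  have h2 : ∀ᶠ s' in 𝓝 s, ‖G s - G s'‖ * ‖G s'‖ < 2 := by
    have hc : Continuous fun s' ↦ ‖G s - G s'‖ * ‖G s'‖ := by fun_prop
    exact hc.continuousAt.eventually_lt_const (by simp)
  have h3 : ∀ a b : Y, ‖G b - G a‖ * ‖G a‖ < 2 → ∀ x, ‖G b x - G a x‖ * ‖G a x‖ < 2 := by
    intro a b hab x
    refine lt_of_le_of_lt ?_ hab
    gcongr
    · exact (G b - G a).norm_coe_le_norm x
    · exact (G a).norm_coe_le_norm x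
  filter_upwards [h1, h2] with s' h1 h2
  exact ⟨h3 _ _ h1, h3 _ _ h2⟩

/-- A homotopy of families of complex structures is covered by a family of isomorphisms. -/
theorem exists_isUnit_intertwining [CompleteSpace V] {X : Type*} [TopologicalSpace X]
    [CompactSpace X]
    (H : C(X × I, V →L[ℝ] V)) (hH : ∀ p, H p * H p = -1) :
    ∃ Q : C(X, V →L[ℝ] V), (∀ x, IsUnit (Q x)) ∧ (∀ x, H (x, 1) * Q x = Q x * H (x, 0)) ∧
      ∀ x, (∀ s, H (x, s) = H (x, 0)) → Q x = 1 := by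
  let P : I → I → Prop := fun s s' ↦ ∃ Q : C(X, V →L[ℝ] V), (∀ x, IsUnit (Q x)) ∧
      (∀ x, H (x, s') * Q x = Q x * H (x, s)) ∧ ∀ x, (∀ s, H (x, s) = H (x, 0)) → Q x = 1
  -- `P` is transitive and holds in both directions between close times, so connectedness of the
  -- interval gives `P 0 1` without a subdivision.
  refine PreconnectedSpace.induction₂' P (fun s ↦ ?_) ⟨?_⟩ 0 1
  · let G : C(I, C(X, V →L[ℝ] V)) := (H.comp ContinuousMap.prodSwap).curry
    have hG : ∀ s x, G s x = H (x, s) := fun s x ↦ rfl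
    have key : ∀ a b : I, (∀ x, ‖G b x - G a x‖ * ‖G a x‖ < 2) → P a b := by
      intro a b hab
      refine ⟨⟨fun x ↦ intertwiner (G b x) (G a x),
        continuous_intertwiner (G b).continuous (G a).continuous⟩, fun x ↦ ?_, fun x ↦ ?_,
        fun x hx ↦ ?_⟩
      · exact isUnit_intertwiner (hH _) (hab x)
      · exact mul_intertwiner (hH _) (hH _)
      · change intertwiner (H (x, b)) (H (x, a)) = 1
        rw [hx a, hx b]
        exact intertwiner_self (hH _)
    filter_upwards [eventually_norm_sub_mul_norm_lt G s] with s' h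
    exact ⟨key _ _ h.1, key _ _ h.2⟩
  · rintro a b c ⟨Q, hQ, hQ', hQ''⟩ ⟨R, hR, hR', hR''⟩
    refine ⟨⟨fun x ↦ R x * Q x, by fun_prop⟩, fun x ↦ (hR x).mul (hQ x), fun x ↦ ?_, fun x hx ↦ ?_⟩
    · change H (x, c) * (R x * Q x) = R x * Q x * H (x, a)
      rw [← mul_assoc, hR', mul_assoc, hQ', mul_assoc]
    · change R x * Q x = 1
      rw [hQ'' x hx, hR'' x hx, one_mul]

/-- The isomorphism of `V` given by an invertible operator. -/
def unitEquiv {A : V →L[ℝ] V} (h : IsUnit A) : V ≃L[ℝ] V :=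
  ContinuousLinearEquiv.unitsEquiv ℝ V h.unit

theorem unitEquiv_apply {A : V →L[ℝ] V} (h : IsUnit A) (v : V) : unitEquiv h v = A v := rfl

theorem sq_eq_neg_one_iff {J : V →L[ℝ] V} : J * J = -1 ↔ ∀ w, J (J w) = -w :=
  ⟨fun h w ↦ congrArg (fun A : V →L[ℝ] V ↦ A w) h, fun h ↦ ContinuousLinearMap.ext h⟩

theorem squareLoop_mem_boundary (t : ℝ) : squareLoop t ∈ Cube.boundary (Fin 2) := by
  have h0 : ∀ x : ℝ, x ≤ 0 → Set.projIcc (0 : ℝ) 1 zero_le_one x = 0 := fun x hx ↦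
    Set.projIcc_of_le_left _ hx
  have h1 : ∀ x : ℝ, 1 ≤ x → Set.projIcc (0 : ℝ) 1 zero_le_one x = 1 := fun x hx ↦
    Set.projIcc_of_right_le _ hx
  by_cases t1 : t ≤ 1
  · exact ⟨1, Or.inl (h0 _ ((min_le_left _ _).trans (by linarith)))⟩
  by_cases t2 : t ≤ 2
  · exact ⟨0, Or.inr (h1 _ (le_min (by linarith) (by linarith)))⟩
  by_cases t3 : t ≤ 3
  · exact ⟨1, Or.inr (h1 _ (le_min (by linarith) (by linarith)))⟩
  · exact ⟨0, Or.inl (h0 _ ((min_le_right _ _).trans (by linarith)))⟩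

/-- The degree of a sphere of complex structures is invariant under homotopies. -/
theorem HasDegree.of_homotopy [CompleteSpace V] {k : ℕ} {d : ℤ}
    {f₀ f₁ : S2 → ComplexStr V} (H : C(S2 × I, V →L[ℝ] V)) (hH : ∀ p, H p * H p = -1)
    (h₀ : ∀ z, H (z, 0) = (f₀ z).1) (h₁ : ∀ z, H (z, 1) = (f₁ z).1)
    (h : HasDegree k f₀ d) : HasDegree k f₁ d := by
  obtain ⟨Q, hQ, hQ', -⟩ := exists_isUnit_intertwining H hH
  obtain ⟨P, L, hP, hPf, hL, hLP, hd⟩ := h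
  have hb : ∀ t, collapse (squareLoop t) = basePoint := fun t ↦
    collapse_boundary _ (squareLoop_mem_boundary t)
  -- On the boundary of the square `collapse` is constant, so the factor `Q` cancels in `P(b₀)⁻¹
  -- P(b)` and the same logarithm `L` serves the new frame.
  refine ⟨fun t ↦ (P t).trans (unitEquiv (hQ (collapse t))), L, ?_, fun t z ↦ ?_, hL,
    fun t ht ↦ ?_, hd⟩
  · change Continuous fun t ↦ (Q (collapse t)).comp (P t : (Fin k → ℂ) →L[ℝ] V)
    exact ((Q.continuous.comp collapse.continuous)).clm_comp hP
  · change Q (collapse t) (P t (Complex.I • z)) = (f₁ (collapse t)).1 (Q (collapse t) (P t z))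
    rw [hPf, ← h₀, ← h₁]
    exact (congrArg (fun A : V →L[ℝ] V ↦ A (P t z)) (hQ' (collapse t))).symm
  · rw [hLP t ht]
    congr
    ext i j
    simp only [ContinuousLinearEquiv.symm_trans_apply, ContinuousLinearEquiv.trans_apply,
      unitEquiv_apply]
    have e : (unitEquiv (hQ (collapse (squareLoop 0)))).symm
        (Q (collapse (squareLoop t)) (P (squareLoop t) (Pi.single j 1))) =
        P (squareLoop t) (Pi.single j 1) := by
      rw [ContinuousLinearEquiv.symm_apply_eq, unitEquiv_apply, hb, hb]
    rw [e]

end Transport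

/-! ### The degree of a sphere of complex structures is a homotopy invariant -/

section SideDegree

variable {k : ℕ}

/-- The complex matrix of a map of `ℂᵏ`, read off from the standard basis. -/
def cmat (A : (Fin k → ℂ) →L[ℝ] (Fin k → ℂ)) : Matrix (Fin k) (Fin k) ℂ :=
  Matrix.of fun i j ↦ A (Pi.single j 1) i

theorem map_complex_smul {A : (Fin k → ℂ) →L[ℝ] (Fin k → ℂ)}
    (hA : ∀ z, A (Complex.I • z) = Complex.I • A z) (c : ℂ) (z : Fin k → ℂ) :
    A (c • z) = c • A z := by
  have h : ∀ w : Fin k → ℂ, c • w = c.re • w + c.im • (Complex.I • w) := by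
    intro w
    ext i
    simp only [Pi.smul_apply, Pi.add_apply, smul_eq_mul, Complex.real_smul]
    nth_rewrite 1 [← Complex.re_add_im c]
    ring
  rw [h, h, map_add, map_smul, map_smul, hA]

/-- Only `A` has to commute with `i`: it is moved past the complex coefficients of the columns of
`B`. -/
theorem cmat_comp {A : (Fin k → ℂ) →L[ℝ] (Fin k → ℂ)}
    (hA : ∀ z, A (Complex.I • z) = Complex.I • A z) (B : (Fin k → ℂ) →L[ℝ] (Fin k → ℂ)) :
    cmat (A.comp B) = cmat A * cmat B := by
  ext i j
  have h : B (Pi.single j 1) = ∑ l, B (Pi.single j 1) l • (Pi.single l (1 : ℂ) : Fin k → ℂ) := by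
    ext m
    simp [Finset.sum_apply, Pi.single_apply]
  simp only [cmat, Matrix.of_apply, Matrix.mul_apply, ContinuousLinearMap.comp_apply]
  conv_lhs => rw [h]
  rw [map_sum, Finset.sum_apply]
  refine Finset.sum_congr rfl fun l _ ↦ ?_
  rw [map_complex_smul hA, Pi.smul_apply, smul_eq_mul, mul_comm]

theorem cmat_id : cmat (ContinuousLinearMap.id ℝ (Fin k → ℂ)) = 1 := by
  ext i j
  simp [cmat, Matrix.one_apply, Pi.single_apply]

theorem det_cmat_ne_zero {A B : (Fin k → ℂ) →L[ℝ] (Fin k → ℂ)}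
    (hA : ∀ z, A (Complex.I • z) = Complex.I • A z)
    (h : A.comp B = ContinuousLinearMap.id ℝ _) : (cmat B).det ≠ 0 := by
  have := congrArg Matrix.det (cmat_comp hA B)
  rw [h, cmat_id, Matrix.det_one, Matrix.det_mul] at this
  exact right_ne_zero_of_mul (this ▸ one_ne_zero)

theorem continuous_det_cmat {X : Type*} [TopologicalSpace X]
    {A : X → (Fin k → ℂ) →L[ℝ] (Fin k → ℂ)} (hA : Continuous A) :
    Continuous fun x ↦ (cmat (A x)).det := by
  refine Continuous.matrix_det (continuous_matrix fun i j ↦ ?_)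
  exact (continuous_apply i).comp (hA.clm_apply continuous_const)

/-- Non-vanishing functions on the square have logarithms. -/
theorem exists_continuous_log (h : C(Fin 2 → I, ℂ)) (h0 : ∀ t, h t ≠ 0) :
    ∃ l : C(Fin 2 → I, ℂ), ∀ t, Complex.exp (l t) = h t := by
  -- Contracting the square to its corner `0` makes `h` the end of a homotopy that starts at a
  -- constant; this homotopy lifts through the covering `exp`.
  let H : C(I × (Fin 2 → I), {z : ℂ // z ≠ 0}) :=
    ⟨fun p ↦ ⟨h fun i ↦ p.1 * p.2 i, h0 _⟩, by fun_prop⟩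
  have hH : ∀ a, H (0, a) = ⟨Complex.exp (ContinuousMap.const (Fin 2 → I) (Complex.log (h 0)) a),
      Complex.exp_ne_zero _⟩ := fun a ↦ by
    refine Subtype.ext ?_
    simp only [H, ContinuousMap.coe_mk, ContinuousMap.const_apply, zero_mul]
    rw [Complex.exp_log (h0 _)]
    rfl
  let l := Complex.isCoveringMap_exp.liftHomotopy H (.const _ (Complex.log (h 0))) hH
  refine ⟨⟨fun t ↦ l (1, t), by fun_prop⟩, fun t ↦ ?_⟩
  have := congrFun (Complex.isCoveringMap_exp.liftHomotopy_lifts H _ hH) (1, t)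
  refine (congrArg Subtype.val this).trans ?_
  change h (fun i ↦ 1 * t i) = h t
  simp

variable {V : Type*} [NormedAddCommGroup V] [NormedSpace ℝ V]

/-- The frame `P` at a point of the square, expressed in the frame `P₀`. -/
def inFrame (P₀ : (Fin k → ℂ) ≃L[ℝ] V) (P : V →L[ℝ] V) : (Fin k → ℂ) →L[ℝ] (Fin k → ℂ) :=
  (P₀.symm : V →L[ℝ] (Fin k → ℂ)).comp (P.comp (P₀ : (Fin k → ℂ) →L[ℝ] V))

theorem inFrame_one (P₀ : (Fin k → ℂ) ≃L[ℝ] V) : inFrame P₀ 1 = ContinuousLinearMap.id ℝ _ := by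
  ext : 1
  simp [inFrame]

/-- The family `γ` of complex structures over the square, equal to `J₀` on the boundary, has a lift
that is trivial on three sides, and whose determinant has winding number `d` on the fourth. -/
def SideDegree (P₀ : (Fin k → ℂ) ≃L[ℝ] V) (J₀ : V →L[ℝ] V) (γ : (Fin 2 → I) → V →L[ℝ] V)
    (d : ℤ) : Prop :=
  ∃ (P : C(Fin 2 → I, V →L[ℝ] V)) (l : C(I, ℂ)), (∀ t, IsUnit (P t)) ∧
    (∀ t, γ t * P t = P t * J₀) ∧ (∀ t, t 0 = 0 ∨ t 1 = 0 ∨ t 1 = 1 → P t = 1) ∧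
    (∀ y, Complex.exp (l y) = (cmat (inFrame P₀ (P ![1, y]))).det) ∧
    l 1 - l 0 = 2 * Real.pi * Complex.I * d

variable {P₀ : (Fin k → ℂ) ≃L[ℝ] V} {J₀ : V →L[ℝ] V}

theorem inFrame_smul_I (hP₀ : ∀ z, P₀ (Complex.I • z) = J₀ (P₀ z)) {P : V →L[ℝ] V}
    (hP : P * J₀ = J₀ * P) (z : Fin k → ℂ) :
    inFrame P₀ P (Complex.I • z) = Complex.I • inFrame P₀ P z := by
  simp only [inFrame, ContinuousLinearMap.comp_apply, ContinuousLinearEquiv.coe_coe, hP₀]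
  rw [ContinuousLinearEquiv.symm_apply_eq, hP₀, ContinuousLinearEquiv.apply_symm_apply]
  exact congrArg (fun A : V →L[ℝ] V ↦ A (P₀ z)) hP

theorem det_inFrame_ne_zero (hP₀ : ∀ z, P₀ (Complex.I • z) = J₀ (P₀ z)) {P : V →L[ℝ] V}
    (hP : P * J₀ = J₀ * P) (hu : IsUnit P) : (cmat (inFrame P₀ P)).det ≠ 0 := by
  obtain ⟨u, rfl⟩ := hu
  refine det_cmat_ne_zero (A := inFrame P₀ (↑u⁻¹ : V →L[ℝ] V)) (inFrame_smul_I hP₀ ?_) ?_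
  · exact (Commute.units_inv_left (show Commute (u : V →L[ℝ] V) J₀ from hP)).eq
  · ext z : 1
    simp only [inFrame, ContinuousLinearMap.comp_apply, ContinuousLinearEquiv.coe_coe,
      ContinuousLinearEquiv.apply_symm_apply, ContinuousLinearMap.id_apply]
    have := congrArg (fun A : V →L[ℝ] V ↦ A (P₀ z)) u.inv_mul
    simp only [mul_apply_eq_comp, one_apply_eq_self] at this
    rw [this, ContinuousLinearEquiv.symm_apply_apply]

theorem continuous_inFrame {X : Type*} [TopologicalSpace X] {P : X → V →L[ℝ] V}
    (hP : Continuous P) : Continuous fun x ↦ inFrame P₀ (P x) := by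
  unfold inFrame
  fun_prop

/-- Pushing the first coordinate to `0` contracts the family to `J₀` and is stationary on three
sides; the intertwiners of this homotopy form the lift. At both ends of the fourth side the lift is
`1`, so the logarithm changes by a multiple of `2πi`. -/
theorem SideDegree.exists [CompleteSpace V] (hP₀ : ∀ z, P₀ (Complex.I • z) = J₀ (P₀ z))
    (γ : C(Fin 2 → I, V →L[ℝ] V)) (hγ : ∀ t, γ t * γ t = -1)
    (hb : ∀ t ∈ Cube.boundary (Fin 2), γ t = J₀) : ∃ d, SideDegree P₀ J₀ γ d := by
  let H : C((Fin 2 → I) × I, V →L[ℝ] V) :=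
    ⟨fun p ↦ γ ![p.2 * p.1 0, p.1 1], by
      refine γ.continuous.comp (continuous_pi fun i ↦ ?_)
      fin_cases i <;> simp <;> fun_prop⟩
  have hH : ∀ t s, H (t, s) = γ ![s * t 0, t 1] := fun _ _ ↦ rfl
  have h0 : ∀ t, H (t, 0) = J₀ := fun t ↦ hb _ ⟨0, Or.inl (by simp)⟩
  have h1 : ∀ t, H (t, 1) = γ t := fun t ↦ by
    rw [hH]
    congr 1
    ext i
    fin_cases i <;> simp
  obtain ⟨Q, hQ, hQ', hQ''⟩ := exists_isUnit_intertwining H fun p ↦ hγ _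
  have hside : ∀ t : Fin 2 → I, t 0 = 0 ∨ t 1 = 0 ∨ t 1 = 1 → Q t = 1 := by
    intro t ht
    refine hQ'' t fun s ↦ ?_
    rw [h0]
    rcases ht with ht | ht | ht
    · exact hb _ ⟨0, Or.inl (by simp [ht])⟩
    · exact hb _ ⟨1, Or.inl (by simp [ht])⟩
    · exact hb _ ⟨1, Or.inr (by simp [ht])⟩
  have hcomm : ∀ y : I, Q ![1, y] * J₀ = J₀ * Q ![1, y] := by
    intro y
    have := hQ' ![1, y]
    rw [h0, h1, hb _ ⟨0, Or.inr (by simp)⟩] at this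
    exact this.symm
  have hcont : Continuous fun t : Fin 2 → I ↦ (![1, t 1] : Fin 2 → I) := by
    refine continuous_pi fun i ↦ ?_
    fin_cases i <;> simp <;> fun_prop
  obtain ⟨l, hl⟩ := exists_continuous_log
    ⟨fun t ↦ (cmat (inFrame P₀ (Q ![1, t 1]))).det,
      continuous_det_cmat (continuous_inFrame (Q.continuous.comp hcont))⟩
    fun t ↦ det_inFrame_ne_zero hP₀ (hcomm _) (hQ _)
  have hcont' : Continuous fun y : I ↦ (![1, y] : Fin 2 → I) := by
    refine continuous_pi fun i ↦ ?_
    fin_cases i <;> simp <;> fun_prop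
  have hl' : ∀ y, Complex.exp (l ![1, y]) = (cmat (inFrame P₀ (Q ![1, y]))).det := fun y ↦ hl _
  have e : Complex.exp (l ![1, 1]) = Complex.exp (l ![1, 0]) := by
    rw [hl', hl', hside _ (by simp), hside _ (by simp)]
  obtain ⟨d, hd⟩ := Complex.exp_eq_exp_iff_exists_int.1 e
  refine ⟨d, Q, ⟨fun y ↦ l ![1, y], l.continuous.comp hcont'⟩, hQ, fun t ↦ ?_, hside, hl', ?_⟩
  · rw [← h1, ← h0 t, hQ']
  · simp only [ContinuousMap.coe_mk]
    rw [hd]; ring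

/-- A homotopy that is fixed on the boundary is covered by intertwiners equal to `1` there;
multiplying the lift by them changes nothing on the sides. -/
theorem SideDegree.of_homotopy [CompleteSpace V] {γ γ' : (Fin 2 → I) → V →L[ℝ] V} {d : ℤ}
    (H : C((Fin 2 → I) × I, V →L[ℝ] V)) (hH : ∀ p, H p * H p = -1) (h0 : ∀ t, H (t, 0) = γ t)
    (h1 : ∀ t, H (t, 1) = γ' t) (hb : ∀ t ∈ Cube.boundary (Fin 2), ∀ s, H (t, s) = H (t, 0))
    (h : SideDegree P₀ J₀ γ d) : SideDegree P₀ J₀ γ' d := by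
  obtain ⟨P, l, hP, hγ, hside, hl, hd⟩ := h
  obtain ⟨Q, hQ, hQ', hQ''⟩ := exists_isUnit_intertwining H hH
  have hQb : ∀ t ∈ Cube.boundary (Fin 2), Q t = 1 := fun t ht ↦ hQ'' t (hb t ht)
  refine ⟨⟨fun t ↦ Q t * P t, by fun_prop⟩, l, fun t ↦ (hQ t).mul (hP t), fun t ↦ ?_, fun t ht ↦ ?_,
    fun y ↦ ?_, hd⟩
  · change γ' t * (Q t * P t) = Q t * P t * J₀
    rw [← h1, ← mul_assoc, hQ', mul_assoc, h0, hγ, mul_assoc]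
  · change Q t * P t = 1
    rw [hside t ht, mul_one]
    refine hQb _ ?_
    rcases ht with ht | ht | ht
    exacts [⟨0, Or.inl ht⟩, ⟨1, Or.inl ht⟩, ⟨1, Or.inr ht⟩]
  · rw [hl]
    change _ = (cmat (inFrame P₀ (Q ![1, y] * P ![1, y]))).det
    rw [hQb ![1, y] ⟨0, Or.inr (by simp)⟩, one_mul]

/-- Concatenation of two maps defined on the square, in the second coordinate. -/
def concat {X : Type*} (γ δ : (Fin 2 → I) → X) (t : Fin 2 → I) : X :=
  if (t 1 : ℝ) ≤ 1 / 2 then γ (Function.update t 1 (Set.projIcc 0 1 zero_le_one (2 * t 1)))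
  else δ (Function.update t 1 (Set.projIcc 0 1 zero_le_one (2 * t 1 - 1)))

theorem continuous_concat {X : Type*} [TopologicalSpace X] {γ δ : (Fin 2 → I) → X}
    (hγ : Continuous γ) (hδ : Continuous δ) (h : ∀ t : Fin 2 → I,
      γ (Function.update t 1 1) = δ (Function.update t 1 0)) : Continuous (concat γ δ) := by
  have h1 : Continuous fun t : Fin 2 → I ↦ (t 1 : ℝ) := by fun_prop
  refine Continuous.if_le ?_ ?_ h1 continuous_const ?_
  · exact hγ.comp (continuous_id.update 1 (continuous_projIcc.comp (by fun_prop)))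
  · exact hδ.comp (continuous_id.update 1 (continuous_projIcc.comp (by fun_prop)))
  · intro t ht
    have e1 : Set.projIcc (0 : ℝ) 1 zero_le_one (2 * (t 1 : ℝ)) = 1 :=
      Set.projIcc_of_right_le _ (by rw [ht]; norm_num)
    have e2 : Set.projIcc (0 : ℝ) 1 zero_le_one (2 * (t 1 : ℝ) - 1) = 0 :=
      Set.projIcc_of_le_left _ (by rw [ht]; norm_num)
    rw [e1, e2, h]

/-- The lifts are `1` on the sides `t 1 = 0` and `t 1 = 1`, so they can be glued without correction.
This is the reason for measuring the degree on a single side. -/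
theorem SideDegree.concat {γ δ : (Fin 2 → I) → V →L[ℝ] V} {d e : ℤ} (hγ : SideDegree P₀ J₀ γ d)
    (hδ : SideDegree P₀ J₀ δ e) : SideDegree P₀ J₀ (concat γ δ) (d + e) := by
  obtain ⟨P, l, hP, hPγ, hPside, hPl, hPd⟩ := hγ
  obtain ⟨R, m, hR, hRδ, hRside, hRl, hRd⟩ := hδ
  have hupd : ∀ y z : I, Function.update (![1, y] : Fin 2 → I) 1 z = ![1, z] := by
    intro y z
    ext i
    fin_cases i <;> simp
  -- The second logarithm is shifted to match the first at the midpoint. The shift is a period of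
  -- `exp` (`hexp`), both lifts being `1` at the corners where they meet.
  let L : I → ℂ := fun y ↦ if (y : ℝ) ≤ 1 / 2 then l (Set.projIcc 0 1 zero_le_one (2 * y))
    else m (Set.projIcc 0 1 zero_le_one (2 * y - 1)) + (l 1 - m 0)
  have hL : Continuous L := by
    refine Continuous.if_le ?_ ?_ continuous_subtype_val continuous_const ?_
    · exact l.continuous.comp (continuous_projIcc.comp (by fun_prop))
    · exact (m.continuous.comp (continuous_projIcc.comp (by fun_prop))).add continuous_const
    · intro t ht
      have e1 : Set.projIcc (0 : ℝ) 1 zero_le_one (2 * (t : ℝ)) = 1 :=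
        Set.projIcc_of_right_le _ (by rw [ht]; norm_num)
      have e2 : Set.projIcc (0 : ℝ) 1 zero_le_one (2 * (t : ℝ) - 1) = 0 :=
        Set.projIcc_of_le_left _ (by rw [ht]; norm_num)
      rw [e1, e2]; ring
  have hexp : Complex.exp (l 1 - m 0) = 1 := by
    rw [Complex.exp_sub, hPl, hRl, hPside _ (by simp), hRside _ (by simp)]
    simp [inFrame_one, cmat_id]
  refine ⟨⟨ContactSphere.concat P R, continuous_concat P.continuous R.continuous fun t ↦ ?_⟩,
    ⟨L, hL⟩, fun t ↦ ?_, fun t ↦ ?_, fun t ht ↦ ?_, fun y ↦ ?_, ?_⟩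
  · rw [hPside _ (by simp), hRside _ (by simp)]
  · simp only [ContactSphere.concat, ContinuousMap.coe_mk]
    split_ifs
    exacts [hP _, hR _]
  · simp only [ContactSphere.concat, ContinuousMap.coe_mk]
    split_ifs
    exacts [hPγ _, hRδ _]
  · simp only [ContactSphere.concat, ContinuousMap.coe_mk]
    split_ifs with h
    · refine hPside _ ?_
      rcases ht with ht | ht | ht
      · exact Or.inl (by simp [ht])
      · exact Or.inr (Or.inl (by simp [ht]))
      · rw [ht] at h; norm_num at h
    · refine hRside _ ?_
      rcases ht with ht | ht | ht
      · exact Or.inl (by simp [ht])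
      · rw [ht] at h; norm_num at h
      · refine Or.inr (Or.inr ?_)
        rw [Function.update_self, ht]
        exact Set.projIcc_of_right_le _ (by norm_num)
  · simp only [ContactSphere.concat, ContinuousMap.coe_mk, L, hupd, Matrix.cons_val_one,
      Matrix.cons_val_fin_one]
    split_ifs
    · exact hPl _
    · rw [Complex.exp_add, hexp, mul_one]; exact hRl _
  · have e0 : L 0 = l 0 := by
      simp only [L]
      rw [if_pos (by norm_num)]
      congr 1
      exact Set.projIcc_of_le_left _ (by norm_num)
    have e1 : L 1 = m 1 + (l 1 - m 0) := by
      simp only [L]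
      rw [if_neg (by norm_num)]
      congr 2
      exact Set.projIcc_of_right_le _ (by norm_num)
    simp only [ContinuousMap.coe_mk, e0, e1]
    push_cast
    linear_combination hPd + hRd

/-- The degree in terms of the boundary of the square agrees with the degree in terms of a side. -/
theorem SideDegree.eq_of_boundary [CompleteSpace V] {γ : (Fin 2 → I) → V →L[ℝ] V}
    {d : ℤ} (hP₀ : ∀ z, P₀ (Complex.I • z) = J₀ (P₀ z)) (h : SideDegree P₀ J₀ γ d)
    (hb : ∀ t ∈ Cube.boundary (Fin 2), γ t = J₀) {e : ℤ}
    (R : (Fin 2 → I) → ((Fin k → ℂ) ≃L[ℝ] V)) (L : ℝ → ℂ)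
    (hR : Continuous (fun t ↦ (R t : (Fin k → ℂ) →L[ℝ] V)))
    (hRγ : ∀ t z, R t (Complex.I • z) = γ t (R t z)) (hL : ContinuousOn L (Set.Icc 0 4))
    (hLR : ∀ t ∈ Set.Icc (0 : ℝ) 4, Complex.exp (L t) =
      Matrix.det (Matrix.of fun i j : Fin k ↦
        (R (squareLoop 0)).symm (R (squareLoop t) (Pi.single j 1)) i))
    (hLe : L 4 - L 0 = 2 * Real.pi * Complex.I * e) : d = e := by
  obtain ⟨P, l, hP, hPγ, hPside, hPl, hPd⟩ := h
  -- `A` compares the two lifts. It is complex linear and invertible on the whole square, so its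
  -- determinant has a logarithm there and contributes no winding along the boundary.
  let A : (Fin 2 → I) → (Fin k → ℂ) →L[ℝ] (Fin k → ℂ) := fun t ↦
    (P₀.symm : V →L[ℝ] (Fin k → ℂ)).comp ((Ring.inverse (P t)).comp (R t : (Fin k → ℂ) →L[ℝ] V))
  have hinv : ∀ t, Ring.inverse (P t) * P t = 1 := fun t ↦ Ring.inverse_mul_cancel _ (hP t)
  have hinv' : ∀ t, P t * Ring.inverse (P t) = 1 := fun t ↦ Ring.mul_inverse_cancel _ (hP t)
  have hinvγ : ∀ t, Ring.inverse (P t) * γ t = J₀ * Ring.inverse (P t) := fun t ↦ by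
    calc Ring.inverse (P t) * γ t = Ring.inverse (P t) * (γ t * P t) * Ring.inverse (P t) := by
          rw [mul_assoc, mul_assoc, hinv', mul_one]
      _ = J₀ * Ring.inverse (P t) := by rw [hPγ, ← mul_assoc, hinv, one_mul]
  have happ : ∀ {X Y : V →L[ℝ] V}, X = Y → ∀ v, X v = Y v := fun h v ↦ by rw [h]
  have hA : Continuous A := by
    have : Continuous fun t ↦ Ring.inverse (P t) := continuous_iff_continuousAt.2 fun t ↦ by
      obtain ⟨u, hu⟩ := hP t
      have := NormedRing.inverse_continuousAt u
      rw [hu] at this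
      exact this.comp P.continuous.continuousAt
    fun_prop
  have hA' : ∀ t z, A t (Complex.I • z) = Complex.I • A t z := by
    intro t z
    simp only [A, ContinuousLinearMap.comp_apply, ContinuousLinearEquiv.coe_coe, hRγ]
    rw [ContinuousLinearEquiv.symm_apply_eq, hP₀, ContinuousLinearEquiv.apply_symm_apply]
    exact happ (hinvγ t) _
  let B : (Fin 2 → I) → (Fin k → ℂ) →L[ℝ] (Fin k → ℂ) := fun t ↦
    ((R t).symm : V →L[ℝ] (Fin k → ℂ)).comp ((P t).comp (P₀ : (Fin k → ℂ) →L[ℝ] V))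
  have hB' : ∀ t z, B t (Complex.I • z) = Complex.I • B t z := by
    intro t z
    simp only [B, ContinuousLinearMap.comp_apply, ContinuousLinearEquiv.coe_coe, hP₀]
    rw [ContinuousLinearEquiv.symm_apply_eq, hRγ, ContinuousLinearEquiv.apply_symm_apply]
    exact (happ (hPγ t) _).symm
  have hBA : ∀ t, (B t).comp (A t) = ContinuousLinearMap.id ℝ _ := by
    intro t
    ext z : 1
    simp only [A, B, ContinuousLinearMap.comp_apply, ContinuousLinearEquiv.coe_coe,
      ContinuousLinearEquiv.apply_symm_apply, ContinuousLinearMap.id_apply]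
    rw [ContinuousLinearEquiv.symm_apply_eq]
    exact happ (hinv' t) _
  obtain ⟨m, hm⟩ := exists_continuous_log ⟨fun t ↦ (cmat (A t)).det, continuous_det_cmat hA⟩
    fun t ↦ det_cmat_ne_zero (hB' t) (hBA t)
  have h0 : ∀ x : ℝ, x ≤ 0 → Set.projIcc (0 : ℝ) 1 zero_le_one x = 0 := fun x hx ↦
    Set.projIcc_of_le_left _ hx
  have h1 : ∀ x : ℝ, 1 ≤ x → Set.projIcc (0 : ℝ) 1 zero_le_one x = 1 := fun x hx ↦
    Set.projIcc_of_right_le _ hx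
  -- The fourth side is traversed for `1 ≤ t ≤ 2`, at height `t - 1`. On the other sides the lift is
  -- `1` and the clipped value of `t - 1` is an end of the interval, so one formula covers the whole
  -- boundary.
  have hcP : ∀ t ∈ Set.Icc (0 : ℝ) 4, P (squareLoop t) * J₀ = J₀ * P (squareLoop t) ∧
      Complex.exp (l (Set.projIcc 0 1 zero_le_one (t - 1))) =
        (cmat (inFrame P₀ (P (squareLoop t)))).det := by
    intro t ht
    have triv : P (squareLoop t) = 1 →
        (Set.projIcc (0 : ℝ) 1 zero_le_one (t - 1) = 0 ∨
          Set.projIcc (0 : ℝ) 1 zero_le_one (t - 1) = 1) →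
        P (squareLoop t) * J₀ = J₀ * P (squareLoop t) ∧
        Complex.exp (l (Set.projIcc 0 1 zero_le_one (t - 1))) =
          (cmat (inFrame P₀ (P (squareLoop t)))).det := by
      intro hp hh
      refine ⟨by rw [hp, one_mul, mul_one], ?_⟩
      rcases hh with hh | hh <;> rw [hh, hPl, hp, hPside _ (by simp)]
    have ht0 : squareLoop t 0 = Set.projIcc 0 1 zero_le_one (min t (3 - t)) := rfl
    have ht1 : squareLoop t 1 = Set.projIcc 0 1 zero_le_one (min (t - 1) (4 - t)) := rfl
    by_cases t1 : t ≤ 1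
    · refine triv (hPside _ (Or.inr (Or.inl ?_))) (Or.inl (h0 _ (by linarith)))
      exact ht1.trans (h0 _ ((min_le_left _ _).trans (by linarith)))
    by_cases t2 : t ≤ 2
    · have e : squareLoop t = ![1, Set.projIcc 0 1 zero_le_one (t - 1)] := by
        ext i
        fin_cases i
        · exact congrArg Subtype.val (ht0.trans (h1 _ (le_min (by linarith) (by linarith))))
        · refine congrArg Subtype.val (ht1.trans ?_)
          rw [min_eq_left (by linarith)]; rfl
      rw [e]
      refine ⟨?_, hPl _⟩
      have key : γ ![1, Set.projIcc 0 1 zero_le_one (t - 1)] = J₀ :=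
        hb _ ⟨0, Or.inr (by simp)⟩
      rw [← hPγ, key]
    by_cases t3 : t ≤ 3
    · refine triv (hPside _ (Or.inr (Or.inr ?_))) (Or.inr (h1 _ (by linarith)))
      exact ht1.trans (h1 _ (le_min (by linarith) (by linarith)))
    · refine triv (hPside _ (Or.inl ?_)) (Or.inr (h1 _ (by linarith)))
      exact ht0.trans (h0 _ ((min_le_right _ _).trans (by linarith)))
  have hsq0 : squareLoop 0 = ![0, 0] := by
    ext i
    fin_cases i
    · exact congrArg Subtype.val (h0 _ (min_le_left _ _))
    · exact congrArg Subtype.val (h0 _ ((min_le_left _ _).trans (by norm_num)))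
  have hsq4 : squareLoop 4 = ![0, 0] := by
    ext i
    fin_cases i
    · exact congrArg Subtype.val (h0 _ ((min_le_right _ _).trans (by norm_num)))
    · exact congrArg Subtype.val (h0 _ ((min_le_right _ _).trans (by norm_num)))
  have hsq : Continuous squareLoop := by
    refine continuous_pi fun i ↦ ?_
    fin_cases i
    · exact (continuous_projIcc (h := zero_le_one' ℝ)).comp (by fun_prop)
    · exact (continuous_projIcc (h := zero_le_one' ℝ)).comp (by fun_prop)
  -- On the boundary `R(b₀)⁻¹ R(b)` is the product of `B(b₀)`, the side lift at `b` in the frame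
  -- `P₀`, and `A(b)`.
  have hprod : ∀ t ∈ Set.Icc (0 : ℝ) 4, Complex.exp (L t) = (cmat (B (squareLoop 0))).det *
      (Complex.exp (l (Set.projIcc 0 1 zero_le_one (t - 1))) * Complex.exp (m (squareLoop t))) := by
    intro t ht
    rw [hLR t ht, (hcP t ht).2, hm]
    change _ = (cmat (B (squareLoop 0))).det *
      ((cmat (inFrame P₀ (P (squareLoop t)))).det * (cmat (A (squareLoop t))).det)
    rw [← Matrix.det_mul, ← Matrix.det_mul, ← cmat_comp (inFrame_smul_I hP₀ (hcP t ht).1),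
      ← cmat_comp (hB' _)]
    congr 1
    ext i j
    simp only [cmat, Matrix.of_apply, B, A, inFrame, ContinuousLinearMap.comp_apply,
      ContinuousLinearEquiv.coe_coe, ContinuousLinearEquiv.apply_symm_apply]
    rw [hPside (squareLoop 0) (by simp [hsq0]), one_apply_eq_self]
    have := happ (hinv' (squareLoop t)) (R (squareLoop t) (Pi.single j 1))
    simp only [mul_apply_eq_comp, one_apply_eq_self] at this
    rw [this]
  have hmem : ∀ s : I, (4 * s : ℝ) ∈ Set.Icc (0 : ℝ) 4 := fun s ↦
    ⟨by have := s.2.1; linarith, by have := s.2.2; linarith⟩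
  let M : ℂ := L 0 - (l 0 + m (squareLoop 0))
  have hM : Complex.exp M = (cmat (B (squareLoop 0))).det := by
    have := hprod 0 ⟨le_rfl, by norm_num⟩
    rw [h0 (0 - 1) (by norm_num), ← Complex.exp_add] at this
    simp only [M]
    rw [Complex.exp_sub, this]
    field_simp [Complex.exp_ne_zero]
  -- Both sides lift the same path through `exp` and agree at the start. As `squareLoop` is closed,
  -- `m` takes the same value at both ends, and only the change of `l` remains.
  have hlift := Complex.isCoveringMap_exp.eq_of_comp_eq (A := I)
    (g₁ := fun s ↦ L (4 * s))
    (g₂ := fun s ↦ M + (l (Set.projIcc 0 1 zero_le_one (4 * s - 1)) + m (squareLoop (4 * s))))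
    (hL.comp_continuous (by fun_prop) hmem)
    (continuous_const.add ((l.continuous.comp (continuous_projIcc.comp (by fun_prop))).add
      (m.continuous.comp (hsq.comp (by fun_prop)))))
    (by
      funext s
      refine Subtype.ext ?_
      simp only [Function.comp_apply]
      rw [hprod _ (hmem s), Complex.exp_add, Complex.exp_add, hM]) 0
    (by
      simp only [M, Set.Icc.coe_zero, mul_zero]
      rw [h0 (0 - 1) (by norm_num)]; ring)
  have hfin := congrFun hlift 1
  simp only [Set.Icc.coe_one, mul_one] at hfin
  rw [h1 (4 - 1) (by norm_num), hsq4] at hfin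
  simp only [M] at hfin
  rw [hsq0] at hfin
  have : (2 * Real.pi * Complex.I) * (d : ℂ) = (2 * Real.pi * Complex.I) * (e : ℂ) := by
    rw [← hPd, ← hLe, hfin]; ring
  exact_mod_cast mul_left_cancel₀ Complex.two_pi_I_ne_zero this

/-- A sphere in `X` has infinite order in `π_2` if a map to a space of complex structures sends it
to a sphere of non-zero degree. -/
theorem not_isOfFinOrder_sphereClass [CompleteSpace V] {X : Type*} [TopologicalSpace X]
    (f : C(S2, X)) (Φ : C(X, V →L[ℝ] V)) (hΦ : ∀ x, Φ x * Φ x = -1) {d : ℤ} (hd : d ≠ 0)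
    (h : HasDegree k (fun z ↦ ⟨Φ (f z), sq_eq_neg_one_iff.1 (hΦ _)⟩) d) :
    ¬ IsOfFinOrder (sphereClass f) := by
  obtain ⟨R, L, hR, hRγ, hL, hLR, hLd⟩ := h
  dsimp only at hRγ
  let x := f basePoint
  let J₀ := Φ x
  let P₀ := R (squareLoop 0)
  have hsq0 : collapse (squareLoop 0) = basePoint := by
    refine collapse_boundary _ ⟨0, Or.inl ?_⟩
    exact Set.projIcc_of_le_left (zero_le_one' ℝ) (min_le_left _ _)
  have hP₀ : ∀ z, P₀ (Complex.I • z) = J₀ (P₀ z) := fun z ↦ by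
    rw [hRγ, hsq0]
  let γ : GenLoop (Fin 2) X x :=
    ⟨f.comp collapse, fun t ht ↦ congrArg f (collapse_boundary t ht)⟩
  have hγb : ∀ δ : GenLoop (Fin 2) X x, ∀ t ∈ Cube.boundary (Fin 2), Φ (δ t) = J₀ :=
    fun δ t ht ↦ by rw [GenLoop.boundary δ t ht]
  have hγ : SideDegree P₀ J₀ (fun t ↦ Φ (γ t)) d := by
    obtain ⟨e, he⟩ := SideDegree.exists hP₀ (Φ.comp γ.1) (fun t ↦ hΦ _) (hγb γ)
    have := he.eq_of_boundary hP₀ (hγb γ) R L hR hRγ hL hLR hLd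
    rwa [this] at he
  -- Powers of the class are represented by iterated concatenations, along which the side degree
  -- adds up.
  have hpow : ∀ m : ℕ, ∃ δ : GenLoop (Fin 2) X x,
      (Quotient.mk (GenLoop.Homotopic.setoid (Fin 2) x) δ : π_ 2 X x) = sphereClass f ^ m ∧
        SideDegree P₀ J₀ (fun t ↦ Φ (δ t)) (m * d) := by
    intro m
    induction m with
    | zero =>
      refine ⟨GenLoop.const, by rw [pow_zero]; rfl, 1, 0, fun t ↦ isUnit_one, fun t ↦ ?_,
        fun t _ ↦ rfl, fun y ↦ ?_, by simp⟩
      · simp [J₀]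
      · simp [inFrame_one, cmat_id]
    | succ m ih =>
      obtain ⟨δ, hδ, hδd⟩ := ih
      refine ⟨GenLoop.transAt 1 γ δ, ?_, ?_⟩
      · rw [pow_succ, ← hδ]
        -- The product `[δ] * [γ]` is the class of the concatenation with `γ` in the first half.
        exact (HomotopyGroup.mul_spec (i := (1 : Fin 2)) (p := δ) (q := γ)).symm
      · have e : (fun t ↦ Φ (GenLoop.transAt 1 γ δ t)) =
            concat (fun t ↦ Φ (γ t)) (fun t ↦ Φ (δ t)) := by
          funext t
          unfold concat
          rw [GenLoop.transAt, GenLoop.coe_copy]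
          split_ifs <;> rfl
        rw [e]
        have := hγ.concat hδd
        convert this using 1
        push_cast; ring
  intro hfin
  obtain ⟨m, hm, hm1⟩ := isOfFinOrder_iff_pow_eq_one.1 hfin
  obtain ⟨δ, hδ, hδd⟩ := hpow m
  rw [hm1] at hδ
  have hhom : GenLoop.Homotopic δ GenLoop.const := Quotient.exact hδ
  obtain ⟨H⟩ := hhom
  -- If the power is trivial, the constant family has side degree `m * d`; its constant frame shows
  -- that this number is `0`.
  have hc : SideDegree P₀ J₀ (fun t ↦ Φ ((GenLoop.const : GenLoop (Fin 2) X x) t)) (m * d) := by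
    refine hδd.of_homotopy (Φ.comp (H.toContinuousMap.comp ContinuousMap.prodSwap))
      (fun p ↦ hΦ _) (fun t ↦ ?_) (fun t ↦ ?_) fun t ht s ↦ ?_
    · exact congrArg Φ (H.apply_zero t)
    · exact congrArg Φ (H.apply_one t)
    · exact congrArg Φ ((H.eq_fst s ht).trans (H.eq_fst 0 ht).symm)
  have := hc.eq_of_boundary hP₀ (hγb _) (fun _ ↦ P₀) 0 continuous_const (fun t z ↦ hP₀ z)
    continuousOn_const (e := 0) (fun t _ ↦ by
      have : (Matrix.of fun i j : Fin k ↦ P₀.symm (P₀ (Pi.single j 1)) i) = 1 := by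
        rw [← cmat_id]
        ext i j
        simp [cmat]
      rw [this]; simp) (by simp)
  rcases mul_eq_zero.1 this with h | h
  · exact hm.ne' (by exact_mod_cast h)
  · exact hd h

end SideDegree

/-! ### The degree of the sphere of complex structures of a quaternionic vector space -/

section Model

/-- The restriction of a real number to `[-1, 1]`. -/
def clamp (x : ℝ) : ℝ := max (-1) (min 1 x)

theorem clamp_of_le {x : ℝ} (h : x ≤ -1) : clamp x = -1 :=
  max_eq_left ((min_le_right _ _).trans h)

theorem clamp_of_ge {x : ℝ} (h : 1 ≤ x) : clamp x = 1 := by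
  rw [clamp, min_eq_left h, max_eq_right (by norm_num)]

theorem clamp_of_mem {x : ℝ} (h : -1 ≤ x) (h' : x ≤ 1) : clamp x = x := by
  rw [clamp, min_eq_right h', max_eq_right h]

/-- The change of `log (1 + i y)` from `y = -1` to `y = clamp x`. -/
def logSide (x : ℝ) : ℂ :=
  Complex.log (1 + clamp x * Complex.I) - Complex.log (1 + ((-1 : ℝ) : ℂ) * Complex.I)

theorem one_add_mul_I_mem_slitPlane (y : ℝ) : 1 + (y : ℂ) * Complex.I ∈ Complex.slitPlane :=
  Or.inl (by simp)

theorem one_add_mul_I_ne_zero (y : ℝ) : 1 + (y : ℂ) * Complex.I ≠ 0 :=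
  Complex.slitPlane_ne_zero (one_add_mul_I_mem_slitPlane y)

theorem continuous_logSide : Continuous logSide := by
  unfold logSide clamp
  refine Continuous.sub ?_ continuous_const
  exact Continuous.clog (by fun_prop) fun x ↦ one_add_mul_I_mem_slitPlane _

theorem logSide_of_le {x : ℝ} (h : x ≤ -1) : logSide x = 0 := by
  rw [logSide, clamp_of_le h, sub_self]

/-- Since `1 + i = i (1 - i)` and the arguments add within the principal branch, one side of the
square contributes a quarter turn. -/
theorem logSide_of_ge {x : ℝ} (h : 1 ≤ x) : logSide x = Real.pi / 2 * Complex.I := by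
  rw [logSide, clamp_of_ge h]
  have e : (1 + ((1 : ℝ) : ℂ) * Complex.I) = (1 + ((-1 : ℝ) : ℂ) * Complex.I) * Complex.I := by
    push_cast
    linear_combination Complex.I_mul_I
  have h1 : |(1 + ((-1 : ℝ) : ℂ) * Complex.I).arg| < Real.pi / 2 :=
    Complex.abs_arg_lt_pi_div_two_iff.2 (Or.inl (by simp))
  have h2 := abs_lt.1 h1
  rw [e, (Complex.log_mul_eq_add_log_iff (one_add_mul_I_ne_zero _) Complex.I_ne_zero).2,
    Complex.log_I]
  · ring
  · rw [Complex.arg_I]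
    exact ⟨by linarith [Real.pi_pos], by linarith [Real.pi_pos]⟩

theorem exp_logSide_of_mem {x : ℝ} (h : -1 ≤ x) (h' : x ≤ 1) :
    Complex.exp (logSide x) * (1 - Complex.I) = 1 + x * Complex.I := by
  rw [logSide, clamp_of_mem h h', Complex.exp_sub, Complex.exp_log (one_add_mul_I_ne_zero _),
    Complex.exp_log (one_add_mul_I_ne_zero _)]
  have := one_add_mul_I_ne_zero (-1)
  push_cast at this ⊢
  rw [neg_one_mul, ← sub_eq_add_neg] at *
  field_simp

theorem exp_pi_div_two_mul_I : Complex.exp (Real.pi / 2 * Complex.I) = Complex.I :=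
  Complex.exp_pi_div_two_mul_I

/-- The centered coordinate `(2 s - 1) + i (2 t - 1)` on the square. -/
def squareCoord (t : Fin 2 → I) : ℂ := (2 * (t 0 : ℝ) - 1 : ℝ) + (2 * (t 1 : ℝ) - 1 : ℝ) * Complex.I

/-- The continuous logarithm of the centered coordinate along the boundary of the square. -/
def boundaryLog (t : ℝ) : ℂ :=
  logSide (2 * t - 1) + logSide (2 * t - 3) + logSide (2 * t - 5) + logSide (2 * t - 7)

theorem continuous_boundaryLog : Continuous boundaryLog := by
  have := continuous_logSide
  unfold boundaryLog
  fun_prop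

theorem boundaryLog_four_sub : boundaryLog 4 - boundaryLog 0 = 2 * Real.pi * Complex.I := by
  unfold boundaryLog
  rw [logSide_of_ge (by norm_num), logSide_of_ge (by norm_num), logSide_of_ge (by norm_num),
    logSide_of_ge (by norm_num), logSide_of_le (by norm_num), logSide_of_le (by norm_num),
    logSide_of_le (by norm_num), logSide_of_le (by norm_num)]
  ring

/-- On the four sides in turn the coordinate is `-i`, `1`, `i`, `-1` times `1 + i x`, with `x`
running from `-1` to `1`. The factor `1 + i x` is what `logSide` follows, and passing to the next
side multiplies by `i`. -/
theorem exp_boundaryLog {t : ℝ} (ht : t ∈ Set.Icc (0 : ℝ) 4) :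
    Complex.exp (boundaryLog t) * squareCoord (squareLoop 0) = squareCoord (squareLoop t) := by
  have h0 : ∀ x : ℝ, x ≤ 0 → Set.projIcc (0 : ℝ) 1 zero_le_one x = 0 := fun x hx ↦
    Set.projIcc_of_le_left _ hx
  have h1 : ∀ x : ℝ, 1 ≤ x → Set.projIcc (0 : ℝ) 1 zero_le_one x = 1 := fun x hx ↦
    Set.projIcc_of_right_le _ hx
  have h2 : ∀ x : ℝ, 0 ≤ x → x ≤ 1 → (Set.projIcc (0 : ℝ) 1 zero_le_one x : ℝ) = x :=
    fun x hx hx' ↦ by rw [Set.projIcc_of_mem _ ⟨hx, hx'⟩]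
  have hsq : ∀ t, squareCoord (squareLoop t) =
      (2 * (Set.projIcc (0 : ℝ) 1 zero_le_one (min t (3 - t)) : ℝ) - 1 : ℝ) +
      (2 * (Set.projIcc (0 : ℝ) 1 zero_le_one (min (t - 1) (4 - t)) : ℝ) - 1 : ℝ) * Complex.I :=
    fun t ↦ rfl
  have e0 : squareCoord (squareLoop 0) = -Complex.I * (1 - Complex.I) := by
    rw [hsq, h0 _ (min_le_left _ _), h0 _ ((min_le_left _ _).trans (by norm_num))]
    simp only [Set.Icc.coe_zero]
    push_cast
    linear_combination -Complex.I_mul_I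
  have hp := exp_pi_div_two_mul_I
  rw [e0, hsq, boundaryLog, Complex.exp_add, Complex.exp_add, Complex.exp_add]
  obtain ⟨ht0, ht4⟩ := ht
  by_cases t1 : t ≤ 1
  · rw [min_eq_left (by linarith), min_eq_left (by linarith), h2 _ ht0 t1, h0 _ (by linarith),
      logSide_of_le (by linarith : 2 * t - 3 ≤ -1), logSide_of_le (by linarith : 2 * t - 5 ≤ -1),
      logSide_of_le (by linarith : 2 * t - 7 ≤ -1), Complex.exp_zero]
    have := exp_logSide_of_mem (by linarith : -1 ≤ 2 * t - 1) (by linarith)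
    simp only [Set.Icc.coe_zero]
    push_cast at this ⊢
    linear_combination -Complex.I * this - (2 * (t : ℂ) - 1) * Complex.I_mul_I
  by_cases t2 : t ≤ 2
  · rw [min_eq_left (by linarith : t - 1 ≤ 4 - t), h2 (t - 1) (by linarith) (by linarith),
      h1 _ (le_min (by linarith) (by linarith)),
      logSide_of_ge (by linarith : 1 ≤ 2 * t - 1), logSide_of_le (by linarith : 2 * t - 5 ≤ -1),
      logSide_of_le (by linarith : 2 * t - 7 ≤ -1), Complex.exp_zero, hp]
    have := exp_logSide_of_mem (by linarith : -1 ≤ 2 * t - 3) (by linarith)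
    simp only [Set.Icc.coe_one]
    push_cast at this ⊢
    linear_combination this -
      Complex.exp (logSide (2 * t - 3)) * (1 - Complex.I) * Complex.I_mul_I
  by_cases t3 : t ≤ 3
  · rw [min_eq_right (by linarith), h2 (3 - t) (by linarith) (by linarith),
      h1 _ (le_min (by linarith) (by linarith)),
      logSide_of_ge (by linarith : 1 ≤ 2 * t - 1), logSide_of_ge (by linarith : 1 ≤ 2 * t - 3),
      logSide_of_le (by linarith : 2 * t - 7 ≤ -1), Complex.exp_zero, hp]
    have := exp_logSide_of_mem (by linarith : -1 ≤ 2 * t - 5) (by linarith)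
    simp only [Set.Icc.coe_one]
    push_cast at this ⊢
    linear_combination Complex.I * this + (2 * (t : ℂ) - 5) * Complex.I_mul_I -
      Complex.I * Complex.exp (logSide (2 * t - 5)) * (1 - Complex.I) * Complex.I_mul_I
  · rw [min_eq_right (by linarith), min_eq_right (by linarith), h0 (3 - t) (by linarith),
      h2 (4 - t) (by linarith) (by linarith),
      logSide_of_ge (by linarith : 1 ≤ 2 * t - 1), logSide_of_ge (by linarith : 1 ≤ 2 * t - 3),
      logSide_of_ge (by linarith : 1 ≤ 2 * t - 5), hp]
    have := exp_logSide_of_mem (by linarith : -1 ≤ 2 * t - 7) (by linarith)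
    simp only [Set.Icc.coe_zero]
    push_cast at this ⊢
    linear_combination -this - (Complex.I * Complex.I - 1) *
      Complex.exp (logSide (2 * t - 7)) * (1 - Complex.I) * Complex.I_mul_I

variable {V : Type*} [NormedAddCommGroup V] [NormedSpace ℝ V]

/-- A complex structure on a real vector space of dimension `2 k` is isomorphic to the standard
one. -/
theorem exists_frame [FiniteDimensional ℝ V] {k : ℕ} (hk : Module.finrank ℝ V = 2 * k)
    {J : V →L[ℝ] V} (hJ : J * J = -1) :
    ∃ P₀ : (Fin k → ℂ) ≃L[ℝ] V, ∀ z, P₀ (Complex.I • z) = J (P₀ z) := by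
  let φ : ℂ →ₐ[ℝ] (V →L[ℝ] V) := Complex.liftAux J hJ
  let _ : Module ℂ V := Module.compHom V
    ((ContinuousLinearMap.toLinearMapRingHom : (V →L[ℝ] V) →+* V →ₗ[ℝ] V).comp φ.toRingHom)
  have hsmul : ∀ (c : ℂ) (v : V), c • v = φ c v := fun _ _ ↦ rfl
  have : IsScalarTower ℝ ℂ V := ⟨fun r c v ↦ by rw [hsmul, hsmul, map_smul]; rfl⟩
  have : FiniteDimensional ℂ V := FiniteDimensional.right ℝ ℂ V
  have hk' : Module.finrank ℂ V = k := by
    have := Module.finrank_mul_finrank ℝ ℂ V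
    rw [Complex.finrank_real_complex, hk] at this
    omega
  let b := Module.finBasisOfFinrankEq ℂ V hk'
  let e : (Fin k → ℂ) ≃ₗ[ℝ] V := (b.equivFun.restrictScalars ℝ).symm
  refine ⟨e.toContinuousLinearEquiv, fun z ↦ ?_⟩
  change b.equivFun.symm (Complex.I • z) = J (b.equivFun.symm z)
  rw [map_smul, hsmul, Complex.liftAux_apply_I]

/-- The sphere `z₀ I + z₁ J + z₂ K`. -/
def quatSphere (jI jJ jK : V →L[ℝ] V) (z : EuclideanSpace ℝ (Fin 3)) : V →L[ℝ] V :=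
  z 0 • jI + z 1 • jJ + z 2 • jK

/-- The quaternion relations. -/
structure IsQuaternionic (jI jJ jK : V →L[ℝ] V) : Prop where
  jI_sq : jI * jI = -1
  jJ_sq : jJ * jJ = -1
  jK_sq : jK * jK = -1
  jI_jJ : jI * jJ = jK

namespace IsQuaternionic

variable {jI jJ jK : V →L[ℝ] V}

theorem jI_jK (h : IsQuaternionic jI jJ jK) : jI * jK = -jJ := by rw [← h.jI_jJ, ← mul_assoc, h.jI_sq, neg_one_mul]

theorem jK_jJ (h : IsQuaternionic jI jJ jK) : jK * jJ = -jI := by rw [← h.jI_jJ, mul_assoc, h.jJ_sq, mul_neg_one]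

/-- Evaluate `K I K K` in two ways. -/
theorem jK_jI (h : IsQuaternionic jI jJ jK) : jK * jI = jJ := by
  have h1 : jK * (jI * jK) * jK = -(jK * jI) := by
    rw [mul_assoc, mul_assoc, h.jK_sq, ← mul_assoc, mul_neg_one]
  have h2 : jK * (jI * jK) * jK = -jJ := by
    rw [h.jI_jK, mul_neg, h.jK_jJ, neg_neg, h.jI_jK]
  exact neg_injective (h1.symm.trans h2)

theorem jJ_jK (h : IsQuaternionic jI jJ jK) : jJ * jK = jI := by
  rw [← h.jK_jI, mul_assoc, h.jI_jK, mul_neg, h.jK_jJ, neg_neg]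

theorem jJ_jI (h : IsQuaternionic jI jJ jK) : jJ * jI = -jK := by
  rw [← h.jJ_jK, ← mul_assoc, h.jJ_sq, neg_one_mul]

theorem quatSphere_mul_self (h : IsQuaternionic jI jJ jK) (z : S2) :
    quatSphere jI jJ jK z * quatSphere jI jJ jK z = -1 := by
  have hz : z.1 0 ^ 2 + z.1 1 ^ 2 + z.1 2 ^ 2 = 1 := by
    have := z.2
    rw [mem_sphere_zero_iff_norm, EuclideanSpace.norm_eq, Real.sqrt_eq_one,
      Fin.sum_univ_three] at this
    simpa using this
  simp only [quatSphere, add_mul, mul_add, smul_mul_smul_comm, h.jI_sq, h.jJ_sq, h.jK_sq, h.jI_jJ,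
    h.jJ_jI, h.jI_jK, h.jK_jI, h.jJ_jK, h.jK_jJ]
  trans (z.1 0 ^ 2 + z.1 1 ^ 2 + z.1 2 ^ 2) • (-1 : V →L[ℝ] V)
  · module
  · rw [hz, one_smul]

/-- The degree of the sphere of complex structures of a quaternionic vector space. -/
theorem hasDegree [FiniteDimensional ℝ V] (h : IsQuaternionic jI jJ jK) {k : ℕ}
    (hk : Module.finrank ℝ V = 2 * k) :
    HasDegree k (fun z ↦ (⟨quatSphere jI jJ jK z, sq_eq_neg_one_iff.1 (h.quatSphere_mul_self z)⟩ :
      ComplexStr V)) k := by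
  obtain ⟨P₀, hP₀⟩ := exists_frame hk h.jI_sq
  -- This lifts the Hopf map: conjugating `I` by the quaternion `(2s - 1) + (2t - 1) I + bubble K`
  -- gives the point `collapse` of the sphere. Its squared norm is `collapseDen`, so it is
  -- invertible on the whole square.
  let Q : (Fin 2 → I) → V →L[ℝ] V := fun t ↦
    (2 * (t 0 : ℝ) - 1) • 1 + (2 * (t 1 : ℝ) - 1) • jI + bubble t • jK
  have hQc : Continuous Q := by
    have hb : Continuous bubble := by unfold bubble; fun_prop
    fun_prop
  have hQinv : ∀ t, IsUnit (Q t) := by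
    intro t
    let R : V →L[ℝ] V :=
      (2 * (t 0 : ℝ) - 1) • 1 - (2 * (t 1 : ℝ) - 1) • jI - bubble t • jK
    have h1 : Q t * R = collapseDen t • 1 := by
      simp only [Q, R, add_mul, mul_sub, smul_mul_smul_comm, h.jI_sq, h.jK_sq, h.jI_jK, h.jK_jI,
        mul_one, one_mul, collapseDen]
      module
    have h2 : R * Q t = collapseDen t • 1 := by
      simp only [Q, R, sub_mul, mul_add, smul_mul_smul_comm, h.jI_sq, h.jK_sq, h.jI_jK, h.jK_jI,
        mul_one, one_mul, collapseDen]
      module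
    have hd := (collapseDen_pos t).ne'
    refine ⟨⟨Q t, (collapseDen t)⁻¹ • R, ?_, ?_⟩, rfl⟩
    · rw [mul_smul_comm, h1, smul_smul, inv_mul_cancel₀ hd, one_smul]
    · rw [smul_mul_assoc, h2, smul_smul, inv_mul_cancel₀ hd, one_smul]
  have hQ : ∀ t, quatSphere jI jJ jK (collapse t) * Q t = Q t * jI := by
    intro t
    have hd := (collapseDen_pos t).ne'
    have hs : collapseDen t • quatSphere jI jJ jK (collapse t) =
        ((2 * (t 0 : ℝ) - 1) ^ 2 + (2 * (t 1 : ℝ) - 1) ^ 2 - bubble t ^ 2) • jI +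
        (2 * bubble t * (2 * (t 0 : ℝ) - 1)) • jJ + (2 * bubble t * (2 * (t 1 : ℝ) - 1)) • jK := by
      change collapseDen t • ((((2 * (t 0 : ℝ) - 1) ^ 2 + (2 * (t 1 : ℝ) - 1) ^ 2 - bubble t ^ 2)
        / collapseDen t) • jI + ((2 * bubble t * (2 * (t 0 : ℝ) - 1)) / collapseDen t) • jJ +
        ((2 * bubble t * (2 * (t 1 : ℝ) - 1)) / collapseDen t) • jK) = _
      simp only [smul_add, smul_smul, mul_div_cancel₀ _ hd]
    have : collapseDen t • (quatSphere jI jJ jK (collapse t) * Q t) =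
        collapseDen t • (Q t * jI) := by
      rw [← smul_mul_assoc, hs]
      simp only [Q, add_mul, mul_add, smul_mul_assoc, mul_smul_comm, h.jI_sq, h.jK_sq,
        h.jJ_jI, h.jI_jK, h.jK_jI, h.jJ_jK, mul_one, one_mul, collapseDen]
      module
    exact smul_right_injective _ hd this
  let P : (Fin 2 → I) → ((Fin k → ℂ) ≃L[ℝ] V) := fun t ↦ P₀.trans (unitEquiv (hQinv t))
  have hPapp : ∀ t z, P t z = Q t (P₀ z) := fun _ _ ↦ rfl
  -- On the boundary `bubble` vanishes, and `Q` becomes multiplication by the complex number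
  -- `squareCoord`, which turns once around `0`. Its determinant on `ℂᵏ` is the `k`-th power.
  have hbd : ∀ t z, t ∈ Cube.boundary (Fin 2) → P t z = P₀ (squareCoord t • z) := by
    intro t z ht
    have hb : bubble t = 0 := by
      obtain ⟨i, hi⟩ := ht
      unfold bubble
      fin_cases i <;> rcases hi with hi | hi <;> simp at hi <;> simp [hi]
    have : squareCoord t • z = (2 * (t 0 : ℝ) - 1) • z + (2 * (t 1 : ℝ) - 1) • (Complex.I • z) := by
      ext i
      simp only [squareCoord, Pi.smul_apply, Pi.add_apply, smul_eq_mul, Complex.real_smul]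
      ring
    rw [hPapp, this, map_add, map_smul, map_smul, hP₀]
    simp [Q, hb]
  have hsb := squareLoop_mem_boundary
  refine ⟨P, fun t ↦ k * boundaryLog t, ?_, fun t z ↦ ?_, ?_, fun t ht ↦ ?_, ?_⟩
  · change Continuous fun t ↦ (Q t).comp (P₀ : (Fin k → ℂ) →L[ℝ] V)
    fun_prop
  · rw [hPapp, hPapp, hP₀]
    exact (congrArg (fun A : V →L[ℝ] V ↦ A (P₀ z)) (hQ t)).symm
  · have := continuous_boundaryLog
    exact Continuous.continuousOn (by fun_prop)
  · have : (Matrix.of fun i j : Fin k ↦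
        (P (squareLoop 0)).symm (P (squareLoop t) (Pi.single j 1)) i) =
        Complex.exp (boundaryLog t) • (1 : Matrix (Fin k) (Fin k) ℂ) := by
      ext i j
      have e : (P (squareLoop 0)).symm (P (squareLoop t) (Pi.single j 1)) =
          Complex.exp (boundaryLog t) • Pi.single j 1 := by
        rw [ContinuousLinearEquiv.symm_apply_eq, hbd _ _ (hsb _), hbd _ _ (hsb _), smul_smul,
          mul_comm, exp_boundaryLog ht]
      rw [Matrix.of_apply, e]
      simp [Matrix.one_apply, Pi.single_apply]
    rw [this, Matrix.det_smul, Matrix.det_one, mul_one, Fintype.card_fin, ← Complex.exp_nat_mul]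
  · dsimp only
    rw [← mul_sub, boundaryLog_four_sub]
    push_cast
    ring

end IsQuaternionic

end Model

/-! ### Polar decomposition of non-degenerate skew operators -/

section Polar

/-- The spectral theorem for an inner product `G` unrelated to any given norm: `G` is installed as
an auxiliary inner product structure. -/
theorem exists_eigenbasis {V : Type*} [AddCommGroup V] [Module ℝ V] [FiniteDimensional ℝ V]
    (G : LinearMap.BilinForm ℝ V) (hs : ∀ x y, G x y = G y x) (hp : ∀ x, x ≠ 0 → 0 < G x x)
    (C : V →ₗ[ℝ] V) (hC : ∀ x y, G (C x) y = G x (C y)) :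
    ∃ (b : Module.Basis (Fin (Module.finrank ℝ V)) ℝ V) (μ : Fin (Module.finrank ℝ V) → ℝ),
      ∀ i, C (b i) = μ i • b i := by
  let core : InnerProductSpace.Core ℝ V :=
    { inner := fun x y ↦ G x y
      conj_inner_symm := fun x y ↦ hs y x
      re_inner_nonneg := fun x ↦ by
        rcases eq_or_ne x 0 with rfl | h
        · simp
        · exact (hp x h).le
      add_left := fun x y z ↦ by simp
      smul_left := fun x y r ↦ by simp
      definite := fun x hx ↦ by
        by_contra h
        exact (hp x h).ne' hx }
  let _ : NormedAddCommGroup V := core.toNormedAddCommGroup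
  let _ : InnerProductSpace ℝ V := InnerProductSpace.ofCore core.toCore
  have hsym : C.IsSymmetric := hC
  refine ⟨(hsym.eigenvectorBasis rfl).toBasis, hsym.eigenvalues rfl, fun i ↦ ?_⟩
  simp

/-- The function is the branch of `arctan (c tan θ)` that stays smooth across `θ = π / 2`: the angle
`θ` plus the arctangent of the tangent of the difference of the two angles. -/
theorem hasDerivAt_angle {c : ℝ} (hc : 0 < c) (θ : ℝ) :
    HasDerivAt (fun θ ↦ θ + Real.arctan ((c - 1) * (Real.sin θ * Real.cos θ) /
      (Real.cos θ ^ 2 + c * Real.sin θ ^ 2))) (c / (Real.cos θ ^ 2 + c ^ 2 * Real.sin θ ^ 2)) θ := by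
  have hsc := Real.sin_sq_add_cos_sq θ
  have hd : 0 < Real.cos θ ^ 2 + c * Real.sin θ ^ 2 := by
    rcases eq_or_ne (Real.sin θ) 0 with h | h
    · rw [h] at hsc ⊢; nlinarith
    · positivity
  have hd2 : 0 < Real.cos θ ^ 2 + c ^ 2 * Real.sin θ ^ 2 := by
    rcases eq_or_ne (Real.sin θ) 0 with h | h
    · rw [h] at hsc ⊢; nlinarith
    · positivity
  have h1 := Real.hasDerivAt_sin θ
  have h2 := Real.hasDerivAt_cos θ
  have h3 := (((h1.mul h2).const_mul (c - 1)).div ((h2.pow 2).add ((h1.pow 2).const_mul c)) hd.ne')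
  have h4 := (hasDerivAt_id θ).add h3.arctan
  refine h4.congr_deriv ?_
  simp only [Pi.mul_apply, Pi.add_apply, Pi.pow_apply, Pi.div_apply]
  have e : (Real.cos θ ^ 2 + c * Real.sin θ ^ 2) ^ 2 + ((c - 1) * (Real.sin θ * Real.cos θ)) ^ 2 =
      Real.cos θ ^ 2 + c ^ 2 * Real.sin θ ^ 2 := by
    have : Real.cos θ ^ 2 = 1 - Real.sin θ ^ 2 := by linarith
    rw [mul_pow, mul_pow, this]; ring
  have hne : 1 + ((c - 1) * (Real.sin θ * Real.cos θ) / (Real.cos θ ^ 2 + c * Real.sin θ ^ 2)) ^ 2 =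
      (Real.cos θ ^ 2 + c ^ 2 * Real.sin θ ^ 2) / (Real.cos θ ^ 2 + c * Real.sin θ ^ 2) ^ 2 := by
    rw [← e]; field_simp
  rw [hne]
  have hd' := hd.ne'
  have hd2' := hd2.ne'
  have hcos : Real.cos θ ^ 2 = 1 - Real.sin θ ^ 2 := by linarith
  have hcos4 : Real.cos θ ^ 4 = (1 - Real.sin θ ^ 2) ^ 2 := by rw [← hcos]; ring
  field_simp
  ring_nf
  rw [hcos4, hcos]
  ring

/-- A primitive is the angle of `hasDerivAt_angle` with `c = m⁻¹`, up to the factor `m⁻¹`; its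
arctangent term vanishes at both ends. -/
theorem integral_inv_sin_sq_add {m : ℝ} (hm : 0 < m) :
    ∫ θ in (0 : ℝ)..(Real.pi / 2), (Real.sin θ ^ 2 + Real.cos θ ^ 2 * m ^ 2)⁻¹ =
      Real.pi / 2 * m⁻¹ := by
  have hpos : ∀ θ : ℝ, 0 < Real.sin θ ^ 2 + Real.cos θ ^ 2 * m ^ 2 := fun θ ↦ by
    have hsc := Real.sin_sq_add_cos_sq θ
    rcases eq_or_ne (Real.cos θ) 0 with h | h
    · rw [h] at hsc ⊢; nlinarith
    · positivity
  have hder : ∀ θ ∈ Set.uIcc (0 : ℝ) (Real.pi / 2), HasDerivAt (fun θ ↦ m⁻¹ * (θ + Real.arctan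
      ((m⁻¹ - 1) * (Real.sin θ * Real.cos θ) / (Real.cos θ ^ 2 + m⁻¹ * Real.sin θ ^ 2))))
      (Real.sin θ ^ 2 + Real.cos θ ^ 2 * m ^ 2)⁻¹ θ := by
    intro θ _
    refine ((hasDerivAt_angle (inv_pos.2 hm) θ).const_mul m⁻¹).congr_deriv ?_
    have h1 := (hpos θ).ne'
    have h2 : Real.cos θ ^ 2 + m⁻¹ ^ 2 * Real.sin θ ^ 2 ≠ 0 := by
      have : Real.cos θ ^ 2 + m⁻¹ ^ 2 * Real.sin θ ^ 2 =
          m⁻¹ ^ 2 * (Real.sin θ ^ 2 + Real.cos θ ^ 2 * m ^ 2) := by field_simp; ring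
      rw [this]
      exact mul_ne_zero (by positivity) h1
    have h3 : m⁻¹ ^ 2 * (Real.sin θ ^ 2 + Real.cos θ ^ 2 * m ^ 2) =
      Real.cos θ ^ 2 + m⁻¹ ^ 2 * Real.sin θ ^ 2 := by field_simp; ring
    rw [← h3]
    field_simp
  rw [intervalIntegral.integral_eq_sub_of_hasDerivAt hder]
  · simp
    ring
  · refine Continuous.intervalIntegrable ?_ _ _
    exact Continuous.inv₀ (by fun_prop) fun θ ↦ (hpos θ).ne'

variable {V : Type*} [NormedAddCommGroup V] [NormedSpace ℝ V] [FiniteDimensional ℝ V]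

/-- `sin² θ - cos² θ B²`. -/
def polarAux (B : V →L[ℝ] V) (θ : ℝ) : V →L[ℝ] V :=
  Real.sin θ ^ 2 • 1 - Real.cos θ ^ 2 • (B * B)

/-- The complex structure `B (-B²)^(-1/2)` in the polar decomposition of `B`. -/
def polar (B : V →L[ℝ] V) : V →L[ℝ] V :=
  B * ((2 / Real.pi) • ∫ θ in (0 : ℝ)..(Real.pi / 2), Ring.inverse (polarAux B θ))

/-- `B` is non-degenerate, and skew for some inner product. -/
def IsSkewable (B : V →L[ℝ] V) : Prop :=
  ∃ G : LinearMap.BilinForm ℝ V, (∀ x y, G x y = G y x) ∧ (∀ x, x ≠ 0 → 0 < G x x) ∧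
    (∀ x y, G (B x) y = -G x (B y)) ∧ ∀ x, B x = 0 → x = 0

theorem isUnit_of_injective {A : V →L[ℝ] V} (h : ∀ x, A x = 0 → x = 0) : IsUnit A := by
  have hinj : Function.Injective (A : V →ₗ[ℝ] V) := by
    rw [injective_iff_map_eq_zero]; exact h
  let e : V ≃L[ℝ] V := (LinearEquiv.ofInjectiveEndo (A : V →ₗ[ℝ] V) hinj).toContinuousLinearEquiv
  exact ⟨(ContinuousLinearEquiv.unitsEquiv ℝ V).symm e, by ext; rfl⟩

/-- The operator is positive for `G`, because `-G(B² x, x) = G(B x, B x)`. -/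
theorem IsSkewable.isUnit_polarAux {B : V →L[ℝ] V} (hB : IsSkewable B) (θ : ℝ) :
    IsUnit (polarAux B θ) := by
  obtain ⟨G, hs, hp, hG, hinj⟩ := hB
  refine isUnit_of_injective fun x hx ↦ ?_
  by_contra hx0
  have h1 : G (polarAux B θ x) x = Real.sin θ ^ 2 * G x x + Real.cos θ ^ 2 * G (B x) (B x) := by
    simp only [polarAux, sub_apply, smul_apply,
      one_apply_eq_self, mul_apply_eq_comp, map_sub, map_smul, LinearMap.sub_apply,
      LinearMap.smul_apply, smul_eq_mul, hG (B x) x]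
    ring
  rw [hx, map_zero, LinearMap.zero_apply] at h1
  have h2 := hp x hx0
  have h3 := hp (B x) fun h ↦ hx0 (hinj x h)
  have hsc := Real.sin_sq_add_cos_sq θ
  have h4 : 0 ≤ Real.sin θ ^ 2 * G x x := by positivity
  have h5 : 0 ≤ Real.cos θ ^ 2 * G (B x) (B x) := by positivity
  have h6 : Real.sin θ ^ 2 = 0 := by
    have : Real.sin θ ^ 2 * G x x = 0 := by linarith
    exact (mul_eq_zero.1 this).resolve_right h2.ne'
  have h7 : Real.cos θ ^ 2 = 0 := by
    have : Real.cos θ ^ 2 * G (B x) (B x) = 0 := by linarith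
    exact (mul_eq_zero.1 this).resolve_right h3.ne'
  linarith

theorem continuous_ringInverse {X : Type*} [TopologicalSpace X] {f : X → V →L[ℝ] V}
    (hf : Continuous f) (h : ∀ x, IsUnit (f x)) : Continuous fun x ↦ Ring.inverse (f x) := by
  have := FiniteDimensional.complete ℝ V
  refine continuous_iff_continuousAt.2 fun x ↦ ?_
  obtain ⟨u, hu⟩ := h x
  have := NormedRing.inverse_continuousAt u
  rw [hu] at this
  exact this.comp hf.continuousAt

theorem continuous_polarAux {X : Type*} [TopologicalSpace X] {f : X → V →L[ℝ] V} {θ : X → ℝ}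
    (hf : Continuous f) (hθ : Continuous θ) : Continuous fun x ↦ polarAux (f x) (θ x) := by
  unfold polarAux
  fun_prop

/-- This is what the integral formula for `(-B²)^(-1/2)` is for: the integrand is visibly continuous
in `B`, so continuity of a functional calculus is not needed. -/
theorem continuous_polar {X : Type*} [TopologicalSpace X] {f : X → V →L[ℝ] V}
    (hf : Continuous f) (h : ∀ x, IsSkewable (f x)) : Continuous fun x ↦ polar (f x) := by
  have := FiniteDimensional.complete ℝ V
  have key : Continuous fun B : {B : V →L[ℝ] V // IsSkewable B} ↦ polar B.1 := by
    unfold polar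
    refine continuous_subtype_val.mul (Continuous.fun_const_smul ?_ _)
    refine intervalIntegral.continuous_parametric_intervalIntegral_of_continuous' ?_ _ _
    exact continuous_ringInverse (continuous_polarAux (by fun_prop) (by fun_prop))
      fun p ↦ p.1.2.isUnit_polarAux _
  exact key.comp (hf.subtype_mk h)

/-- On an eigenvector of `-B²` with eigenvalue `m²` the operator integral reduces to the scalar one,
so the operator acts as `(-B²)^(-1/2)`. -/
theorem IsSkewable.integral_apply {B : V →L[ℝ] V} (hB : IsSkewable B) {m : ℝ} (hm : 0 < m) {x : V}
    (hx : B (B x) = -(m ^ 2 • x)) :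
    ((2 / Real.pi) • ∫ θ in (0 : ℝ)..(Real.pi / 2), Ring.inverse (polarAux B θ)) x =
      m⁻¹ • x := by
  have := FiniteDimensional.complete ℝ V
  have hc : Continuous fun θ ↦ Ring.inverse (polarAux B θ) :=
    continuous_ringInverse (continuous_polarAux continuous_const continuous_id) hB.isUnit_polarAux
  have h1 : ∀ θ, Ring.inverse (polarAux B θ) x = (Real.sin θ ^ 2 + Real.cos θ ^ 2 * m ^ 2)⁻¹ • x := by
    intro θ
    have hsc := Real.sin_sq_add_cos_sq θ
    have hpos : 0 < Real.sin θ ^ 2 + Real.cos θ ^ 2 * m ^ 2 := by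
      rcases eq_or_ne (Real.cos θ) 0 with h | h
      · rw [h] at hsc ⊢; nlinarith
      · positivity
    have e : polarAux B θ x = (Real.sin θ ^ 2 + Real.cos θ ^ 2 * m ^ 2) • x := by
      simp only [polarAux, sub_apply, smul_apply,
        one_apply_eq_self, mul_apply_eq_comp, hx]
      module
    have e' := congrArg (fun y ↦ (Ring.inverse (polarAux B θ) : V →L[ℝ] V) y) e
    have e2 := congrArg (fun A : V →L[ℝ] V ↦ A x)
      (Ring.inverse_mul_cancel _ (hB.isUnit_polarAux θ))
    simp only [mul_apply_eq_comp, one_apply_eq_self] at e2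
    simp only [e2, map_smul] at e'
    nth_rewrite 2 [e']
    rw [smul_smul, inv_mul_cancel₀ hpos.ne', one_smul]
  rw [smul_apply, ContinuousLinearMap.intervalIntegral_apply
    (hc.intervalIntegrable _ _)]
  simp only [h1]
  rw [intervalIntegral.integral_smul_const, integral_inv_sin_sq_add hm, smul_smul]
  congr 1
  have := Real.pi_ne_zero
  field_simp

/-- In an eigenbasis of `-B²`, the vectors `x` and `B x` belong to the same eigenvalue `μ`, so the
square acts on `x` as `μ⁻¹ B² = -1`. -/
theorem IsSkewable.polar_mul_self {B : V →L[ℝ] V} (hB : IsSkewable B) : polar B * polar B = -1 := by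
  have hB' := hB
  obtain ⟨G, hs, hp, hG, hinj⟩ := hB'
  obtain ⟨b, μ, hb⟩ := exists_eigenbasis G hs hp (-(B * B : V →L[ℝ] V) : V →L[ℝ] V).toLinearMap
    (fun x y ↦ by
      simp only [ContinuousLinearMap.coe_coe, neg_apply, mul_apply_eq_comp,
        map_neg, LinearMap.neg_apply, hG, neg_neg])
  have hμ : ∀ i, 0 < μ i := by
    intro i
    have h1 : G ((-(B * B : V →L[ℝ] V) : V →L[ℝ] V) (b i)) (b i) = G (B (b i)) (B (b i)) := by
      simp only [neg_apply, mul_apply_eq_comp, map_neg, LinearMap.neg_apply, hG,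
        neg_neg]
    have h2 : (-(B * B : V →L[ℝ] V) : V →L[ℝ] V) (b i) = μ i • b i := hb i
    rw [h2, map_smul, LinearMap.smul_apply, smul_eq_mul] at h1
    have h3 := hp (B (b i)) fun h ↦ b.ne_zero i (hinj _ h)
    have h4 := hp (b i) (b.ne_zero i)
    rw [← h1] at h3
    exact pos_of_mul_pos_left h3 h4.le
  have h2 : ∀ i, B (B (b i)) = -(Real.sqrt (μ i) ^ 2 • b i) := by
    intro i
    rw [Real.sq_sqrt (hμ i).le, ← hb i]
    simp
  have key : ((polar B * polar B : V →L[ℝ] V) : V →ₗ[ℝ] V) = ((-1 : V →L[ℝ] V) : V →ₗ[ℝ] V) := by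
    refine b.ext fun i ↦ ?_
    have hm := Real.sqrt_pos.2 (hμ i)
    have e1 := hB.integral_apply hm (h2 i)
    have e2 := hB.integral_apply (x := B (b i)) hm (by rw [h2 i, map_neg, map_smul])
    simp only [ContinuousLinearMap.coe_coe, polar, mul_apply_eq_comp]
    rw [e1, map_smul, map_smul, e2, map_smul, map_smul, h2 i]
    simp only [neg_apply, one_apply_eq_self, smul_neg, smul_smul]
    rw [← mul_assoc]
    have : (√(μ i))⁻¹ * (√(μ i))⁻¹ * √(μ i) ^ 2 = 1 := by field_simp
    rw [this, one_smul]
  exact ContinuousLinearMap.coe_injective key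

theorem polar_eq_self {J : V →L[ℝ] V} (hJ : J * J = -1) : polar J = J := by
  have h : ∀ θ, Ring.inverse (polarAux J θ) = 1 := fun θ ↦ by
    have : polarAux J θ = 1 := by
      rw [polarAux, hJ, smul_neg, sub_neg_eq_add, ← add_smul, Real.sin_sq_add_cos_sq, one_smul]
    rw [this, Ring.inverse_one]
  have := FiniteDimensional.complete ℝ V
  rw [polar]
  simp only [h]
  rw [intervalIntegral.integral_const, smul_smul]
  have : 2 / Real.pi * (Real.pi / 2 - 0) = 1 := by have := Real.pi_ne_zero; field_simp; simp
  rw [this, one_smul, mul_one]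

/-- `J` is a complex structure compatible with the symplectic form `G (B ·, ·)`. -/
structure IsCompatible (G : LinearMap.BilinForm ℝ V) (B J : V →L[ℝ] V) : Prop where
  skew : ∀ x y, G (B x) y = -G x (B y)
  sq : J * J = -1
  symm : ∀ x y, G (B x) (J y) = G (B y) (J x)
  pos : ∀ x, x ≠ 0 → 0 < G (B x) (J x)

/-- The complex structure in the polar decomposition is homotopic to any compatible one. -/
theorem exists_polar_homotopy {G : LinearMap.BilinForm ℝ V} (hs : ∀ x y, G x y = G y x)
    (hp : ∀ x, x ≠ 0 → 0 < G x x) {X : Type*} [TopologicalSpace X] {B J : X → V →L[ℝ] V}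
    (hB : Continuous B) (hJ : Continuous J) (h : ∀ x, IsCompatible G (B x) (J x)) :
    ∃ H : C(X × I, V →L[ℝ] V), (∀ p, H p * H p = -1) ∧ (∀ x, H (x, 0) = polar (B x)) ∧
      ∀ x, H (x, 1) = J x := by
  -- `G (T ·, ·)` interpolates linearly between `G` and the inner product `G (B ·, J ·)`, so it
  -- remains an inner product and `T` remains invertible. The operator `β = T⁻¹ B` is skew for it
  -- and runs from `B` to `J`; the homotopy is `polar β`. The inner product varies here, which is
  -- why `IsSkewable` leaves it free.
  let T : X × I → V →L[ℝ] V := fun p ↦ (1 - (p.2 : ℝ)) • 1 - (p.2 : ℝ) • (B p.1 * J p.1)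
  have hT : Continuous T := by fun_prop
  have hTG : ∀ p x y, G (T p x) y = (1 - (p.2 : ℝ)) * G x y + p.2 * G (B p.1 x) (J p.1 y) := by
    intro p x y
    simp only [T, sub_apply, smul_apply,
      one_apply_eq_self, mul_apply_eq_comp, map_sub, map_smul, LinearMap.sub_apply,
      LinearMap.smul_apply, smul_eq_mul]
    rw [(h p.1).skew, hs (J p.1 x), (h p.1).symm x y]
    ring
  have hTpos : ∀ p x, x ≠ 0 → 0 < G (T p x) x := by
    intro p x hx
    rw [hTG]
    have h1 := hp x hx
    have h2 := (h p.1).pos x hx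
    obtain ⟨h3, h4⟩ := p.2.2
    rcases eq_or_lt_of_le h3 with h0 | h0
    · rw [← h0]; linarith
    · have : 0 < (p.2 : ℝ) * G (B p.1 x) (J p.1 x) := mul_pos h0 h2
      have : 0 ≤ (1 - (p.2 : ℝ)) * G x x := mul_nonneg (by linarith) h1.le
      linarith
  have hTu : ∀ p, IsUnit (T p) := fun p ↦ isUnit_of_injective fun x hx ↦ by
    by_contra h0
    have := hTpos p x h0
    rw [hx] at this
    simp at this
  have hTinv : ∀ p x, T p (Ring.inverse (T p) x) = x := fun p x ↦
    congrArg (fun A : V →L[ℝ] V ↦ A x) (Ring.mul_inverse_cancel _ (hTu p))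
  have hBinj : ∀ x v, B x v = 0 → v = 0 := fun x v hv ↦ by
    by_contra h0
    have := (h x).pos v h0
    rw [hv] at this
    simp at this
  let β : X × I → V →L[ℝ] V := fun p ↦ Ring.inverse (T p) * B p.1
  have hβ : Continuous β := by
    have := continuous_ringInverse hT hTu
    fun_prop
  have hTβ : ∀ p v, T p (β p v) = B p.1 v := fun p v ↦ hTinv p _
  have hβs : ∀ p, IsSkewable (β p) := by
    intro p
    refine ⟨G.comp (T p : V →ₗ[ℝ] V) LinearMap.id, fun x y ↦ ?_, fun x hx ↦ hTpos p x hx,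
      fun x y ↦ ?_, fun x hx ↦ ?_⟩
    · change G (T p x) y = G (T p y) x
      rw [hTG, hTG, hs x y, (h p.1).symm]
    · have hsym : ∀ x y, G (T p x) y = G (T p y) x := fun x y ↦ by
        rw [hTG, hTG, hs x y, (h p.1).symm]
      change G (T p (β p x)) y = -G (T p x) (β p y)
      rw [hTβ, hsym x (β p y), hTβ, (h p.1).skew, hs]
    · have := hTβ p x
      rw [hx, map_zero] at this
      exact hBinj _ _ this.symm
  refine ⟨⟨fun p ↦ polar (β p), continuous_polar hβ hβs⟩, fun p ↦ (hβs p).polar_mul_self,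
    fun x ↦ ?_, fun x ↦ ?_⟩
  · change polar (Ring.inverse (T (x, 0)) * B x) = _
    have : T (x, 0) = 1 := by simp [T]
    rw [this, Ring.inverse_one, one_mul]
  · change polar (β (x, 1)) = _
    have : β (x, 1) = J x := by
      have hT1 : T (x, 1) = -(B x * J x) := by simp [T]
      have h1 : T (x, 1) * J x = B x := by
        rw [hT1, neg_mul, mul_assoc, (h x).sq, mul_neg, mul_one, neg_neg]
      change Ring.inverse (T (x, 1)) * B x = J x
      rw [← h1, ← mul_assoc, Ring.inverse_mul_cancel _ (hTu _), one_mul]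
    rw [this, polar_eq_self (h x).sq]

end Polar

/-! ### Smooth dependence of solutions of ordinary differential equations on initial values -/

section Nemytskii

universe u

variable {K : Type*} [TopologicalSpace K] [CompactSpace K]

/-- Pointwise application of a family of operators. -/
def pointwiseApply (K : Type*) [TopologicalSpace K] [CompactSpace K] {W E F : Type*}
    [NormedAddCommGroup W] [NormedSpace ℝ W]
    [NormedAddCommGroup E] [NormedSpace ℝ E] [NormedAddCommGroup F] [NormedSpace ℝ F]
    (B : W →L[ℝ] E →L[ℝ] F) : C(K, W) →L[ℝ] C(K, E) →L[ℝ] C(K, F) :=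
  LinearMap.mkContinuous₂
    (LinearMap.mk₂ ℝ (fun (A : C(K, W)) (h : C(K, E)) ↦
      (⟨fun k ↦ B (A k) (h k), by fun_prop⟩ : C(K, F)))
      (fun A B h ↦ by ext; simp) (fun c A h ↦ by ext; simp) (fun A g h ↦ by ext; simp)
      (fun c A h ↦ by ext; simp)) ‖B‖ fun A h ↦ by
    refine (ContinuousMap.norm_le _ (by positivity)).2 fun k ↦ ?_
    refine (B.le_opNorm₂ (A k) (h k)).trans ?_
    gcongr
    · exact A.norm_coe_le_norm k
    · exact h.norm_coe_le_norm k

/-- By continuity of `γ ↦ v' ∘ γ` in the supremum norm, the derivative of `v` varies little on the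
segments from `γ k` to `γ k + h k`, uniformly in `k`. The mean value inequality then bounds the
remainder uniformly. -/
theorem hasFDerivAt_postcomp {W E F : Type*} [NormedAddCommGroup W] [NormedSpace ℝ W]
    [NormedAddCommGroup E] [NormedSpace ℝ E]
    [NormedAddCommGroup F] [NormedSpace ℝ F] (B : W →L[ℝ] E →L[ℝ] F) (v : C(E, F)) (v' : C(E, W))
    (hv : ∀ x, HasFDerivAt v (B (v' x)) x) (γ : C(K, E)) :
    HasFDerivAt (fun γ : C(K, E) ↦ v.comp γ) (pointwiseApply K B (v'.comp γ)) γ := by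
  rw [hasFDerivAt_iff_isLittleO_nhds_zero, Asymptotics.isLittleO_iff]
  intro ε hε
  have hc : Continuous fun γ : C(K, E) ↦ v'.comp γ := ContinuousMap.continuous_postcomp v'
  obtain ⟨η, hη, hηε⟩ : ∃ η > 0, ‖B‖ * η ≤ ε := by
    refine ⟨ε / (‖B‖ + 1), by positivity, ?_⟩
    rw [mul_div_assoc', div_le_iff₀ (by positivity)]
    nlinarith [norm_nonneg B]
  obtain ⟨δ, hδ, hδ'⟩ := Metric.continuousAt_iff.1 (hc.continuousAt (x := γ)) η hη
  filter_upwards [Metric.ball_mem_nhds (0 : C(K, E)) hδ] with h hh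
  have hh' : ‖h‖ < δ := by simpa using hh
  refine (ContinuousMap.norm_le _ (by positivity)).2 fun k ↦ ?_
  have key :=
    (convex_segment (𝕜 := ℝ) (γ k) (γ k + h k)).norm_image_sub_le_of_norm_hasFDerivWithin_le'
    (f := v) (f' := fun x ↦ B (v' x)) (φ := B (v' (γ k))) (C := ε)
    (fun x _ ↦ (hv x).hasFDerivWithinAt) (fun x hx ↦ by
      obtain ⟨s, ⟨hs0, hs1⟩, rfl⟩ := (segment_eq_image' ℝ (γ k) (γ k + h k)) ▸ hx
      have h1 : dist (γ + s • h) γ < δ := by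
        rw [dist_eq_norm, add_sub_cancel_left, norm_smul, Real.norm_of_nonneg hs0]
        exact lt_of_le_of_lt (mul_le_of_le_one_left (norm_nonneg _) hs1) hh'
      have h3 := (ContinuousMap.dist_apply_le_dist k).trans (hδ' h1).le
      rw [dist_eq_norm] at h3
      rw [← map_sub]
      refine (B.le_opNorm _).trans (le_trans ?_ hηε)
      gcongr
      simpa using h3)
    (left_mem_segment ℝ _ _) (right_mem_segment ℝ _ _)
  simp only [add_sub_cancel_left] at key
  refine le_trans ?_ (key.trans (mul_le_mul_of_nonneg_left (h.norm_coe_le_norm k) hε.le))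
  exact le_of_eq rfl

/-- The derivative of composition with `v` is composition with `v'` followed by a bounded linear
operation, so one order of smoothness is gained. -/
theorem contDiff_postcomp_succ (n : ℕ) {W E F : Type*} [NormedAddCommGroup W] [NormedSpace ℝ W]
    [NormedAddCommGroup E] [NormedSpace ℝ E]
    [NormedAddCommGroup F] [NormedSpace ℝ F] (B : W →L[ℝ] E →L[ℝ] F) (v : C(E, F)) (v' : C(E, W))
    (hv : ∀ x, HasFDerivAt v (B (v' x)) x) (h : ContDiff ℝ n (fun γ : C(K, E) ↦ v'.comp γ)) :
    ContDiff ℝ (n + 1 : ℕ) (fun γ : C(K, E) ↦ v.comp γ) := by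
  have h3 : ContDiff ℝ ((n : WithTop ℕ∞) + 1) (fun γ : C(K, E) ↦ v.comp γ) := by
    rw [contDiff_succ_iff_hasFDerivAt (n := n)]
    exact ⟨fun γ ↦ pointwiseApply K B (v'.comp γ), (pointwiseApply K B).contDiff.comp h,
      fun γ ↦ hasFDerivAt_postcomp B v v' hv γ⟩
  exact_mod_cast h3

theorem contDiff_postcomp_nat (n : ℕ) {E : Type u} [NormedAddCommGroup E] [NormedSpace ℝ E]
    {F : Type u} [NormedAddCommGroup F] [NormedSpace ℝ F] (v : C(E, F)) (hv : ContDiff ℝ n v) :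
    ContDiff ℝ n (fun γ : C(K, E) ↦ v.comp γ) := by
  induction n generalizing F with
  | zero =>
    exact contDiff_zero.2 (ContinuousMap.continuous_postcomp v)
  | succ n ih =>
    have h1 : ContDiff ℝ n (fderiv ℝ v) := by
      have : ContDiff ℝ ((n : WithTop ℕ∞) + 1) v := by exact_mod_cast hv
      exact this.fderiv_right le_rfl
    exact contDiff_postcomp_succ n (ContinuousLinearMap.id ℝ (E →L[ℝ] F)) v
      ⟨fderiv ℝ v, h1.continuous⟩ (fun x ↦ ((hv.differentiable (by simp)) x).hasFDerivAt)
      (ih (F := E →L[ℝ] F) ⟨fderiv ℝ v, h1.continuous⟩ h1)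

/-- Composition with a smooth map is a smooth map of spaces of continuous functions. -/
theorem contDiff_postcomp {E : Type u} [NormedAddCommGroup E] [NormedSpace ℝ E]
    {F : Type u} [NormedAddCommGroup F] [NormedSpace ℝ F] (v : C(E, F)) (hv : ContDiff ℝ ∞ v) :
    ContDiff ℝ ∞ (fun γ : C(K, E) ↦ v.comp γ) :=
  contDiff_infty.2 fun n ↦ contDiff_postcomp_nat n v (contDiff_infty.1 hv n)

end Nemytskii

/-! ### Local flows by the inverse function theorem in a space of curves -/

section LocalFlow

variable {E : Type*} [NormedAddCommGroup E] [NormedSpace ℝ E] [CompleteSpace E]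

/-- The interval `[-1, 1]`. -/
abbrev Sym : Type := Set.Icc (-1 : ℝ) 1

/-- The origin of `[-1, 1]`. -/
def symZero : Sym := ⟨0, by norm_num, by norm_num⟩

/-- Restriction to `[-1, 1]`. -/
abbrev projSym (s : ℝ) : Sym := Set.projIcc (-1 : ℝ) 1 (by norm_num) s

/-- The primitive vanishing at `0` of a function on `[-1, 1]`. -/
def primitive (E : Type*) [NormedAddCommGroup E] [NormedSpace ℝ E] : C(Sym, E) →L[ℝ] C(Sym, E) :=
  LinearMap.mkContinuous
    { toFun := fun γ ↦ ⟨fun s ↦ ∫ r in (0 : ℝ)..s, γ (projSym r),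
        (intervalIntegral.continuous_primitive (fun a b ↦ Continuous.intervalIntegrable
          (γ.continuous.comp continuous_projIcc) a b) 0).comp continuous_subtype_val⟩
      map_add' := fun γ δ ↦ by
        ext s
        exact intervalIntegral.integral_add
          ((γ.continuous.comp continuous_projIcc).intervalIntegrable _ _)
          ((δ.continuous.comp continuous_projIcc).intervalIntegrable _ _)
      map_smul' := fun c γ ↦ by
        ext s
        exact intervalIntegral.integral_smul c _ } 1 fun γ ↦ by
    rw [one_mul]
    refine (ContinuousMap.norm_le _ (by positivity)).2 fun s ↦ ?_
    refine (intervalIntegral.norm_integral_le_of_norm_le_const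
      fun x _ ↦ γ.norm_coe_le_norm (projSym x)).trans ?_
    rw [sub_zero]
    exact mul_le_of_le_one_right (norm_nonneg _) (abs_le.2 s.2)

/-- A smooth vector field has a smooth local flow. For `(t, x)` close to `(0, x₀)` the curve `Γ (t, x)`
is the integral curve starting at `x`, with time rescaled by `t`. -/
theorem exists_local_flow {v : E → E} (hv : ContDiff ℝ ∞ v) (x₀ : E) {U : Set E} (hU : U ∈ 𝓝 x₀) :
    ∃ Γ : ℝ × E → C(Sym, E), ContDiffAt ℝ ∞ Γ (0, x₀) ∧ Γ (0, x₀) = .const _ x₀ ∧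
      ∀ᶠ q in 𝓝 ((0 : ℝ), x₀), (∀ s, Γ q s ∈ U) ∧ Γ q symZero = q.2 ∧
        ∀ s ∈ Set.Ioo (-1 : ℝ) 1, HasDerivAt (fun s ↦ Γ q (projSym s))
          (q.1 • v (Γ q (projSym s))) s := by
  let vc : C(E, E) := ⟨v, hv.continuous⟩
  let N : C(Sym, E) → C(Sym, E) := fun γ ↦ vc.comp γ
  have hN : ContDiff ℝ ∞ N := contDiff_postcomp vc hv
  let cst : E →L[ℝ] C(Sym, E) := ContinuousLinearMap.const ℝ Sym
  have hcst : ∀ x s, cst x s = x := fun _ _ ↦ rfl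
  -- The second component vanishes exactly for solutions of `γ(s) = x + t ∫₀ˢ v(γ)`. Moving the time
  -- into the factor `t` keeps the interval fixed, and at `t = 0` the derivative of `G` is
  -- triangular with identities on the diagonal, so it is invertible whatever the size of `v`.
  let G : (ℝ × E) × C(Sym, E) → (ℝ × E) × C(Sym, E) := fun p ↦
    (p.1, p.2 - cst p.1.2 - p.1.1 • primitive E (N p.2))
  have hG : ContDiff ℝ ∞ G := by
    refine contDiff_fst.prodMk ((contDiff_snd.sub (cst.contDiff.comp
      (contDiff_snd.comp contDiff_fst))).sub ?_)
    exact (contDiff_fst.comp contDiff_fst).smul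
      ((primitive E).contDiff.comp (hN.comp contDiff_snd))
  let a : (ℝ × E) × C(Sym, E) := ((0, x₀), cst x₀)
  have hGa : G a = ((0, x₀), 0) := by
    simp [G, a]
  let A : (ℝ × E) →L[ℝ] C(Sym, E) := -(cst.comp (ContinuousLinearMap.snd ℝ ℝ E)) -
    (ContinuousLinearMap.fst ℝ ℝ E).smulRight (primitive E (N (cst x₀)))
  let e : ((ℝ × E) × C(Sym, E)) ≃L[ℝ] ((ℝ × E) × C(Sym, E)) :=
    (ContinuousLinearEquiv.refl ℝ (ℝ × E)).skewProd (ContinuousLinearEquiv.refl ℝ C(Sym, E)) A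
  have hGd : HasFDerivAt G (e : ((ℝ × E) × C(Sym, E)) →L[ℝ] ((ℝ × E) × C(Sym, E))) a := by
    have h1 : HasFDerivAt (fun p : (ℝ × E) × C(Sym, E) ↦ p.1) (ContinuousLinearMap.fst ℝ _ _) a :=
      hasFDerivAt_fst
    have h2 : HasFDerivAt (fun p : (ℝ × E) × C(Sym, E) ↦ p.2) (ContinuousLinearMap.snd ℝ _ _) a :=
      hasFDerivAt_snd
    have h3 : HasFDerivAt (fun p : (ℝ × E) × C(Sym, E) ↦ p.1.1)
      ((ContinuousLinearMap.fst ℝ _ _).comp (ContinuousLinearMap.fst ℝ _ _)) a := h1.fst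
    have h4 : HasFDerivAt (fun p : (ℝ × E) × C(Sym, E) ↦ cst p.1.2)
      (cst.comp ((ContinuousLinearMap.snd ℝ _ _).comp (ContinuousLinearMap.fst ℝ _ _))) a :=
      cst.hasFDerivAt.comp a h1.snd
    have hd : DifferentiableAt ℝ (fun p : (ℝ × E) × C(Sym, E) ↦ primitive E (N p.2)) a :=
      ((primitive E).contDiff.comp (hN.comp contDiff_snd)).contDiffAt.differentiableAt (by simp)
    have h5 := h1.prodMk ((h2.sub h4).sub (h3.smul hd.hasFDerivAt))
    refine h5.congr_fderiv (ContinuousLinearMap.ext fun ⟨⟨t, x⟩, γ⟩ ↦ Prod.ext rfl ?_)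
    change γ - cst x - ((0 : ℝ) • _ + t • primitive E (N (cst x₀))) =
      γ + (-cst x - t • primitive E (N (cst x₀)))
    rw [zero_smul]
    abel
  let g := hG.contDiffAt.localInverse hGd (by simp : (∞ : WithTop ℕ∞) ≠ 0)
  have hg : ContDiffAt ℝ ∞ g (G a) := hG.contDiffAt.to_localInverse hGd (by simp)
  have hga : g (G a) = a := hG.contDiffAt.localInverse_apply_image hGd (by simp)
  have hGg : ∀ᶠ y in 𝓝 (G a), G (g y) = y :=
    (hG.contDiffAt.hasStrictFDerivAt' hGd (by simp)).eventually_right_inverse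
  rw [hGa] at hg hga hGg
  have hι : ContDiff ℝ ∞ fun q : ℝ × E ↦ (q, (0 : C(Sym, E))) := contDiff_id.prodMk contDiff_const
  have hΓ : ContDiffAt ℝ ∞ (fun q : ℝ × E ↦ (g (q, 0)).2) (0, x₀) :=
    (ContDiffAt.comp (g := g) ((0 : ℝ), x₀) hg hι.contDiffAt).snd
  have hΓ0 : (g ((0, x₀), 0)).2 = .const _ x₀ := by rw [hga]; rfl
  refine ⟨fun q ↦ (g (q, 0)).2, hΓ, hΓ0, ?_⟩
  obtain ⟨r, hr, hrU⟩ := Metric.mem_nhds_iff.1 hU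
  have h1 : ∀ᶠ q in 𝓝 ((0 : ℝ), x₀), dist (g (q, 0)).2 (.const _ x₀) < r := by
    have := hΓ.continuousAt
    rw [Metric.continuousAt_iff'] at this
    rw [← hΓ0]
    exact this r hr
  have h2 : ∀ᶠ q in 𝓝 ((0 : ℝ), x₀), G (g (q, 0)) = (q, 0) :=
    (hι.continuous.continuousAt (x := ((0 : ℝ), x₀))).eventually hGg
  filter_upwards [h1, h2] with q h1 h2
  have hq1 : (g (q, 0)).1 = q := congrArg Prod.fst h2
  have hq2 : (g (q, 0)).2 - cst (g (q, 0)).1.2 -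
    (g (q, 0)).1.1 • primitive E (N (g (q, 0)).2) = 0 := congrArg Prod.snd h2
  rw [hq1] at hq2
  have heq : ∀ s : Sym, (g (q, 0)).2 s =
      q.2 + q.1 • ∫ r in (0 : ℝ)..s, v ((g (q, 0)).2 (projSym r)) := by
    intro s
    have := congrArg (fun γ : C(Sym, E) ↦ γ s) hq2
    have h3 : (g (q, 0)).2 s - q.2 -
      q.1 • (∫ r in (0 : ℝ)..s, v ((g (q, 0)).2 (projSym r))) = 0 := this
    rw [← sub_eq_zero, ← h3]
    abel
  refine ⟨fun s ↦ hrU (Metric.mem_ball.2 ((ContinuousMap.dist_apply_le_dist s).trans_lt h1)),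
    ?_, fun s hs ↦ ?_⟩
  · rw [heq]
    simp [symZero]
  · have hc : Continuous fun r ↦ v ((g (q, 0)).2 (projSym r)) :=
      hv.continuous.comp ((g (q, 0)).2.continuous.comp continuous_projIcc)
    have hd : HasDerivAt (fun s ↦ q.2 + q.1 • ∫ r in (0 : ℝ)..s, v ((g (q, 0)).2 (projSym r)))
        (q.1 • v ((g (q, 0)).2 (projSym s))) s :=
      ((intervalIntegral.integral_hasDerivAt_right (hc.intervalIntegrable _ _)
        (hc.stronglyMeasurableAtFilter _ _) hc.continuousAt).const_smul q.1).const_add q.2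
    refine hd.congr_of_eventuallyEq ?_
    filter_upwards [Ioo_mem_nhds hs.1 hs.2] with s' hs'
    have e : (projSym s' : ℝ) = s' :=
      congrArg Subtype.val (Set.projIcc_of_mem (by norm_num) (Set.Ioo_subset_Icc_self hs'))
    rw [heq, e]

end LocalFlow

/-! ### Tangent maps of charts and smoothness of chart expressions -/

section Charts

variable {E : Type*} [NormedAddCommGroup E] [InnerProductSpace ℝ E] [FiniteDimensional ℝ E]
variable {M : Type*} [TopologicalSpace M] [ChartedSpace E M] [IsManifold 𝓘(ℝ, E) ∞ M]

theorem contMDiffOn_chart_symm (x₀ : M) :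
    ContMDiffOn 𝓘(ℝ, E) 𝓘(ℝ, E) ∞ (extChartAt 𝓘(ℝ, E) x₀).symm (extChartAt 𝓘(ℝ, E) x₀).target :=
  contMDiffOn_extChartAt_symm x₀

theorem contMDiffOn_chart (x₀ : M) :
    ContMDiffOn 𝓘(ℝ, E) 𝓘(ℝ, E) ∞ (extChartAt 𝓘(ℝ, E) x₀) (extChartAt 𝓘(ℝ, E) x₀).source := by
  rw [extChartAt_source]
  exact contMDiffOn_extChartAt

theorem mdifferentiableAt_extChartAt_symm (x₀ : M) {y : E}
    (hy : y ∈ (extChartAt 𝓘(ℝ, E) x₀).target) :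
    MDifferentiableAt 𝓘(ℝ, E) 𝓘(ℝ, E) (extChartAt 𝓘(ℝ, E) x₀).symm y := by
  have : IsManifold 𝓘(ℝ, E) 1 M := .of_le (n := ∞) (by decide)
  have h := mdifferentiableWithinAt_extChartAt_symm hy
  rwa [modelWithCornersSelf_coe, Set.range_id, mdifferentiableWithinAt_univ] at h

theorem mfderiv_extChartAt_mfderiv_symm (x₀ : M) {y : E}
    (hy : y ∈ (extChartAt 𝓘(ℝ, E) x₀).target) (u : E) :
    mfderiv 𝓘(ℝ, E) 𝓘(ℝ, E) (extChartAt 𝓘(ℝ, E) x₀) ((extChartAt 𝓘(ℝ, E) x₀).symm y)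
      (mfderiv 𝓘(ℝ, E) 𝓘(ℝ, E) (extChartAt 𝓘(ℝ, E) x₀).symm y u) = u := by
  have : IsManifold 𝓘(ℝ, E) 1 M := .of_le (n := ∞) (by decide)
  have h := mfderiv_extChartAt_comp_mfderivWithin_extChartAt_symm hy
  rw [modelWithCornersSelf_coe, Set.range_id, mfderivWithin_univ] at h
  exact DFunLike.congr_fun h u

theorem mfderiv_symm_mfderiv_extChartAt (x₀ : M) {y : E}
    (hy : y ∈ (extChartAt 𝓘(ℝ, E) x₀).target)
    (u : TangentSpace 𝓘(ℝ, E) ((extChartAt 𝓘(ℝ, E) x₀).symm y)) :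
    mfderiv 𝓘(ℝ, E) 𝓘(ℝ, E) (extChartAt 𝓘(ℝ, E) x₀).symm y
      (mfderiv 𝓘(ℝ, E) 𝓘(ℝ, E) (extChartAt 𝓘(ℝ, E) x₀) ((extChartAt 𝓘(ℝ, E) x₀).symm y) u) =
      u := by
  have : IsManifold 𝓘(ℝ, E) 1 M := .of_le (n := ∞) (by decide)
  have h := mfderivWithin_extChartAt_symm_comp_mfderiv_extChartAt hy
  rw [modelWithCornersSelf_coe, Set.range_id, mfderivWithin_univ] at h
  exact DFunLike.congr_fun h u

theorem mfderiv_extChartAt_symm_self (x₀ : M) (u : E) :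
    mfderiv 𝓘(ℝ, E) 𝓘(ℝ, E) (extChartAt 𝓘(ℝ, E) x₀).symm (extChartAt 𝓘(ℝ, E) x₀ x₀) u = u := by
  have : IsManifold 𝓘(ℝ, E) 1 M := .of_le (n := ∞) (by decide)
  have h : mfderivWithin 𝓘(ℝ, E) 𝓘(ℝ, E) (extChartAt 𝓘(ℝ, E) x₀).symm (Set.range 𝓘(ℝ, E))
      (extChartAt 𝓘(ℝ, E) x₀ x₀) = .id ℝ _ := mfderivWithin_range_extChartAt_symm
  rw [modelWithCornersSelf_coe, Set.range_id, mfderivWithin_univ] at h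
  exact DFunLike.congr_fun h u

theorem contMDiffOn_mfderiv_extChartAt_symm (x₀ : M) (u : E) :
    ContMDiffOn 𝓘(ℝ, E) (𝓘(ℝ, E).prod 𝓘(ℝ, E)) ∞
      (fun y ↦ Bundle.TotalSpace.mk' E ((extChartAt 𝓘(ℝ, E) x₀).symm y)
        (mfderiv 𝓘(ℝ, E) 𝓘(ℝ, E) (extChartAt 𝓘(ℝ, E) x₀).symm y u :
          TangentSpace 𝓘(ℝ, E) ((extChartAt 𝓘(ℝ, E) x₀).symm y)))
      (extChartAt 𝓘(ℝ, E) x₀).target := by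
  have ho : IsOpen (extChartAt 𝓘(ℝ, E) x₀).target := isOpen_extChartAt_target x₀
  have h := (contMDiffOn_chart_symm x₀).contMDiffOn_tangentMapWithin
    (m := ∞) (by simp) ho.uniqueMDiffOn
  have hs : ContMDiff 𝓘(ℝ, E) (𝓘(ℝ, E).prod 𝓘(ℝ, E)) ∞
      (fun y : E ↦ (⟨y, u⟩ : TangentBundle 𝓘(ℝ, E) E)) :=
    contMDiff_vectorSpace_iff_contDiff.2 contDiff_const
  refine (h.comp hs.contMDiffOn fun y hy ↦ hy).congr fun y hy ↦ ?_
  simp only [Function.comp, tangentMapWithin]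
  rw [mfderivWithin_of_isOpen ho hy]

theorem contMDiffOn_mfderiv_extChartAt (x₀ : M) :
    ContMDiffOn (𝓘(ℝ, E).prod 𝓘(ℝ, E)) 𝓘(ℝ, E) ∞
      (fun p : TangentBundle 𝓘(ℝ, E) M ↦
        (mfderiv 𝓘(ℝ, E) 𝓘(ℝ, E) (extChartAt 𝓘(ℝ, E) x₀) p.1 p.2 : E))
      (Bundle.TotalSpace.proj ⁻¹' (extChartAt 𝓘(ℝ, E) x₀).source) := by
  have ho : IsOpen (extChartAt 𝓘(ℝ, E) x₀).source := isOpen_extChartAt_source x₀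
  have h := contMDiffOn_chart (E := E) x₀
  have h := h.contMDiffOn_tangentMapWithin (m := ∞) (by simp) ho.uniqueMDiffOn
  have h2 := contMDiff_snd_tangentBundle_modelSpace E 𝓘(ℝ, E) (n := ∞)
  refine (h2.comp_contMDiffOn h).congr fun p hp ↦ ?_
  simp only [Function.comp, tangentMapWithin]
  rw [mfderivWithin_of_isOpen ho hp]

/-- The expression of a vector field in the preferred chart at `x₀`. -/
def fieldInChart (V : ∀ x : M, TangentSpace 𝓘(ℝ, E) x) (x₀ : M) (y : E) : E :=
  mfderiv 𝓘(ℝ, E) 𝓘(ℝ, E) (extChartAt 𝓘(ℝ, E) x₀) ((extChartAt 𝓘(ℝ, E) x₀).symm y)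
    (V ((extChartAt 𝓘(ℝ, E) x₀).symm y))

theorem contDiffOn_fieldInChart {V : ∀ x : M, TangentSpace 𝓘(ℝ, E) x}
    (hV : ContMDiff 𝓘(ℝ, E) (𝓘(ℝ, E).prod 𝓘(ℝ, E)) ∞ (fun x ↦ Bundle.TotalSpace.mk' E x (V x)))
    (x₀ : M) : ContDiffOn ℝ ∞ (fieldInChart V x₀) (extChartAt 𝓘(ℝ, E) x₀).target := by
  rw [← contMDiffOn_iff_contDiffOn]
  have h := hV.comp_contMDiffOn (contMDiffOn_chart_symm x₀)
  exact (contMDiffOn_mfderiv_extChartAt x₀).comp h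
    fun y hy ↦ (extChartAt 𝓘(ℝ, E) x₀).map_target hy

theorem OneForm.contDiffOn_inChart (α : OneForm E M) (x₀ : M) :
    ContDiffOn ℝ ∞ (α.inChart x₀) (extChartAt 𝓘(ℝ, E) x₀).target := by
  refine contDiffOn_clm_apply.2 fun u ↦ ?_
  rw [← contMDiffOn_iff_contDiffOn]
  have h := α.2.comp_contMDiffOn (contMDiffOn_chart_symm x₀)
  have h' := ContMDiffOn.clm_bundle_apply (E₂ := Bundle.Trivial M ℝ) (F₂ := ℝ)
    (b := (extChartAt 𝓘(ℝ, E) x₀).symm)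
    (ϕ := fun y ↦ α.1 ((extChartAt 𝓘(ℝ, E) x₀).symm y)) h
    (contMDiffOn_mfderiv_extChartAt_symm x₀ u)
  intro y hy
  exact (Bundle.contMDiffWithinAt_totalSpace.1 (h' y hy)).2

theorem EndField.contDiffOn_inChart (A : EndField E M) (x₀ : M) :
    ContDiffOn ℝ ∞ (A.inChart x₀) (extChartAt 𝓘(ℝ, E) x₀).target := by
  refine contDiffOn_clm_apply.2 fun u ↦ ?_
  rw [← contMDiffOn_iff_contDiffOn]
  have h := A.2.comp_contMDiffOn (contMDiffOn_chart_symm x₀)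
  have h' : ContMDiffOn 𝓘(ℝ, E) (𝓘(ℝ, E).prod 𝓘(ℝ, E)) ∞
      (fun y ↦ (⟨(extChartAt 𝓘(ℝ, E) x₀).symm y, A.1 ((extChartAt 𝓘(ℝ, E) x₀).symm y)
        (mfderiv 𝓘(ℝ, E) 𝓘(ℝ, E) (extChartAt 𝓘(ℝ, E) x₀).symm y u)⟩ : TangentBundle 𝓘(ℝ, E) M))
      (extChartAt 𝓘(ℝ, E) x₀).target :=
    ContMDiffOn.clm_bundle_apply (F₁ := E) (F₂ := E)
      (E₁ := fun x : M ↦ TangentSpace 𝓘(ℝ, E) x) (E₂ := fun x : M ↦ TangentSpace 𝓘(ℝ, E) x)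
      (b := (extChartAt 𝓘(ℝ, E) x₀).symm)
      (ϕ := fun y ↦ A.1 ((extChartAt 𝓘(ℝ, E) x₀).symm y)) h
      (contMDiffOn_mfderiv_extChartAt_symm x₀ u)
  have h'' := (contMDiffOn_mfderiv_extChartAt x₀).comp h'
    fun y hy ↦ (extChartAt 𝓘(ℝ, E) x₀).map_target hy
  refine h''.congr fun y hy ↦ ?_
  rfl

end Charts

/-! ### Global flows on closed manifolds -/

section Flow

variable {E : Type*} [NormedAddCommGroup E] [InnerProductSpace ℝ E] [FiniteDimensional ℝ E]
variable {M : Type*} [TopologicalSpace M] [ChartedSpace E M] [IsManifold 𝓘(ℝ, E) ∞ M]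

/-- A smooth function on an open set agrees near a given point with a smooth function on the whole
space. -/
theorem exists_contDiff_eventuallyEq {w : E → E} {s : Set E} (hs : IsOpen s)
    (hw : ContDiffOn ℝ ∞ w s) {y₀ : E} (hy₀ : y₀ ∈ s) :
    ∃ v : E → E, ContDiff ℝ ∞ v ∧ v =ᶠ[𝓝 y₀] w := by
  obtain ⟨r, hr, hrs⟩ := Metric.isOpen_iff.1 hs y₀ hy₀
  let f : ContDiffBump y₀ := ⟨r / 4, r / 2, by positivity, by linarith⟩
  refine ⟨fun y ↦ f y • w y, contDiff_iff_contDiffAt.2 fun y ↦ ?_, ?_⟩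
  · by_cases hy : y ∈ s
    · exact f.contDiffAt.smul (hw.contDiffAt (hs.mem_nhds hy))
    · have hy' : y ∉ tsupport f := by
        rw [f.tsupport_eq]
        intro h
        exact hy (hrs (Metric.closedBall_subset_ball (by change r / 2 < r; linarith) h))
      have : (fun y ↦ f y • w y) =ᶠ[𝓝 y] fun _ ↦ 0 := by
        filter_upwards [(isClosed_tsupport f).isOpen_compl.mem_nhds hy'] with z hz
        rw [image_eq_zero_of_notMem_tsupport hz, zero_smul]
      exact contDiffAt_const.congr_of_eventuallyEq this
  · filter_upwards [f.eventuallyEq_one] with y hy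
    rw [hy, Pi.one_apply, one_smul]

/-- Smooth local solutions of `γ' = t V(γ)`, `γ(0) = x`, with parameters `t` and `x`. -/
theorem exists_local_solution {V : ∀ x : M, TangentSpace 𝓘(ℝ, E) x}
    (hV : ContMDiff 𝓘(ℝ, E) (𝓘(ℝ, E).prod 𝓘(ℝ, E)) ∞ (fun x ↦ Bundle.TotalSpace.mk' E x (V x)))
    (x₀ : M) : ∃ Γ : ℝ × M → ℝ → M,
      ContMDiffAt (𝓘(ℝ, ℝ).prod 𝓘(ℝ, E)) 𝓘(ℝ, E) ∞ (fun q ↦ Γ q (1 / 2)) (0, x₀) ∧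
      ∀ᶠ q in 𝓝 ((0 : ℝ), x₀), Γ q 0 = q.2 ∧
        IsMIntegralCurveOn (Γ q) (fun x ↦ q.1 • V x) (Set.Ioo (-1) 1) := by
  set y₀ := extChartAt 𝓘(ℝ, E) x₀ x₀ with hy₀
  have ht : IsOpen (extChartAt 𝓘(ℝ, E) x₀).target := isOpen_extChartAt_target x₀
  have hyt : y₀ ∈ (extChartAt 𝓘(ℝ, E) x₀).target := mem_extChartAt_target x₀
  -- The chart expression of `V` is smooth only on the chart target; it is replaced by a field on
  -- all of `E` that agrees with it near `y₀`, and the solutions are kept in the region of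
  -- agreement.
  obtain ⟨v, hv, hvw⟩ := exists_contDiff_eventuallyEq ht (contDiffOn_fieldInChart hV x₀) hyt
  obtain ⟨Γ, hΓ, hΓ0, hΓq⟩ := exists_local_flow hv y₀
    (U := {y | v y = fieldInChart V x₀ y} ∩ (extChartAt 𝓘(ℝ, E) x₀).target)
    (Filter.inter_mem hvw (ht.mem_nhds hyt))
  have hch : ContMDiffAt (𝓘(ℝ, ℝ).prod 𝓘(ℝ, E)) (𝓘(ℝ, ℝ).prod 𝓘(ℝ, E)) ∞
      (fun q : ℝ × M ↦ (q.1, extChartAt 𝓘(ℝ, E) x₀ q.2)) (0, x₀) :=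
    contMDiffAt_fst.prodMk ((contMDiffAt_extChartAt (x := x₀)).comp _ contMDiffAt_snd)
  refine ⟨fun q s ↦ (extChartAt 𝓘(ℝ, E) x₀).symm
    (Γ (q.1, extChartAt 𝓘(ℝ, E) x₀ q.2) (projSym s)), ?_, ?_⟩
  · have he : ContDiffAt ℝ ∞ (fun q ↦ Γ q (projSym (1 / 2))) (0, y₀) :=
      (ContinuousMap.evalCLM ℝ (projSym (1 / 2)) : C(Sym, E) →L[ℝ] E).contDiff.contDiffAt.comp
        (0, y₀) hΓ
    have h1 : ContMDiffAt (𝓘(ℝ, ℝ).prod 𝓘(ℝ, E)) 𝓘(ℝ, E) ∞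
        (fun q : ℝ × M ↦ Γ (q.1, extChartAt 𝓘(ℝ, E) x₀ q.2) (projSym (1 / 2))) (0, x₀) := by
      have he' : ContMDiffAt (𝓘(ℝ, ℝ).prod 𝓘(ℝ, E)) 𝓘(ℝ, E) ∞
        (fun q : ℝ × E ↦ Γ q (projSym (1 / 2))) (0, y₀) := by
        have := he.contMDiffAt
        rw [modelWithCornersSelf_prod, ← chartedSpaceSelf_prod] at this
        exact this
      exact ContMDiffAt.comp (x := ((0 : ℝ), x₀)) (g := fun q : ℝ × E ↦ Γ q (projSym (1 / 2))) he' hch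
    have h2 := (contMDiffOn_chart_symm (E := E) x₀).contMDiffAt (ht.mem_nhds hyt)
    refine ContMDiffAt.comp (x := ((0 : ℝ), x₀)) ?_ h1
    change ContMDiffAt _ _ _ _ (Γ (0, y₀) (projSym (1 / 2)))
    rw [hΓ0]
    exact h2
  · have hc : Filter.Tendsto (fun q : ℝ × M ↦ (q.1, extChartAt 𝓘(ℝ, E) x₀ q.2))
      (𝓝 (0, x₀)) (𝓝 (0, y₀)) := hch.continuousAt
    have hs : ∀ᶠ q in 𝓝 ((0 : ℝ), x₀), q.2 ∈ (extChartAt 𝓘(ℝ, E) x₀).source :=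
      continuousAt_snd.eventually ((isOpen_extChartAt_source x₀).mem_nhds
        (mem_extChartAt_source x₀))
    filter_upwards [hc.eventually hΓq, hs] with q ⟨hq1, hq2, hq3⟩ hqs
    have h0 : projSym 0 = symZero := by
      refine Subtype.ext ?_
      exact congrArg Subtype.val (Set.projIcc_of_mem (by norm_num)
        (show (0 : ℝ) ∈ Set.Icc (-1 : ℝ) 1 by constructor <;> norm_num))
    refine ⟨?_, fun s hs ↦ ?_⟩
    · rw [h0, hq2]
      exact (extChartAt 𝓘(ℝ, E) x₀).left_inv hqs
    · refine HasMFDerivAt.hasMFDerivWithinAt ?_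
      have hmem := hq1 (projSym s)
      have h1 := (mdifferentiableAt_extChartAt_symm x₀ hmem.2).hasMFDerivAt
      have h2 := (hasMFDerivAt_iff_hasFDerivAt.2 (hq3 s hs).hasFDerivAt)
      refine (HasMFDerivAt.comp s h1 h2).congr_mfderiv ?_
      have key : ∀ y, v y = fieldInChart V x₀ y → y ∈ (extChartAt 𝓘(ℝ, E) x₀).target →
          mfderiv 𝓘(ℝ, E) 𝓘(ℝ, E) (extChartAt 𝓘(ℝ, E) x₀).symm y ((1 : ℝ) • q.1 • v y : E) =
            q.1 • V ((extChartAt 𝓘(ℝ, E) x₀).symm y) := by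
        intro y hy hyt
        rw [one_smul, hy]
        refine (map_smul _ _ _).trans ?_
        rw [fieldInChart, mfderiv_symm_mfderiv_extChartAt x₀ hyt]
      refine ContinuousLinearMap.ext_ring ?_
      refine (key _ hmem.1 hmem.2).trans ?_
      exact (one_smul ℝ _).symm

variable [T2Space M] [CompactSpace M]

theorem eventually_forall_of_compact {P : ℝ → M → Prop}
    (h : ∀ x₀ : M, ∀ᶠ q : ℝ × M in 𝓝 (0, x₀), P q.1 q.2) : ∀ᶠ t in 𝓝 (0 : ℝ), ∀ x, P t x := by
  have := isCompact_univ.eventually_forall_of_forall_eventually (X := ℝ) (Y := M)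
    (x₀ := 0) (K := Set.univ) (P := P) fun x _ ↦ h x
  filter_upwards [this] with t ht x using ht x trivial

theorem exists_pos_forall_of_compact {P : ℝ → M → Prop}
    (h : ∀ x₀ : M, ∀ᶠ q : ℝ × M in 𝓝 (0, x₀), P q.1 q.2) :
    ∃ ε > 0, ∀ t, |t| < ε → ∀ x, P t x := by
  obtain ⟨ε, hε, h⟩ := Metric.eventually_nhds_iff.1 (eventually_forall_of_compact h)
  exact ⟨ε, hε, fun t ht ↦ h (by rwa [Real.dist_eq, sub_zero])⟩

/-- Smooth vector fields on closed manifolds have complete, smooth flows. -/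
theorem exists_flow {V : ∀ x : M, TangentSpace 𝓘(ℝ, E) x}
    (hV : ContMDiff 𝓘(ℝ, E) (𝓘(ℝ, E).prod 𝓘(ℝ, E)) ∞ (fun x ↦ Bundle.TotalSpace.mk' E x (V x))) :
    ∃ φ : ℝ → Diffeomorph 𝓘(ℝ, E) 𝓘(ℝ, E) M M ∞,
      ContMDiff (𝓘(ℝ, ℝ).prod 𝓘(ℝ, E)) 𝓘(ℝ, E) ∞ (fun p : ℝ × M ↦ φ p.1 p.2) ∧
      (∀ x, φ 0 x = x) ∧ (∀ s t x, φ (s + t) x = φ s (φ t x)) ∧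
      ∀ x, IsMIntegralCurve (fun t ↦ φ t x) V := by
  have : IsManifold 𝓘(ℝ, E) 1 M := .of_le (n := ∞) (by decide)
  have hsm : ∀ c : ℝ, ContMDiff 𝓘(ℝ, E) (𝓘(ℝ, E).prod 𝓘(ℝ, E)) 1
      (fun x ↦ (⟨x, c • V x⟩ : TangentBundle 𝓘(ℝ, E) M)) := fun c ↦
    fun x ↦ ContMDiffAt.const_smul_section (a := c) (hV.of_le (by decide) x)
  have hV1 : ContMDiff 𝓘(ℝ, E) (𝓘(ℝ, E).prod 𝓘(ℝ, E)) 1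
      (fun x ↦ (⟨x, V x⟩ : TangentBundle 𝓘(ℝ, E) M)) := hV.of_le (by decide)
  -- uniform existence time
  obtain ⟨ε, hε, hloc⟩ := exists_pos_forall_of_compact (M := M) (P := fun t x ↦
      ∃ γ : ℝ → M, γ 0 = x ∧ IsMIntegralCurveOn γ (fun x ↦ t • V x) (Set.Ioo (-1) 1)) fun x₀ ↦ by
    obtain ⟨Γ, -, h⟩ := exists_local_solution hV x₀
    filter_upwards [h] with q hq using ⟨Γ q, hq⟩
  have hex : ∀ x : M, ∃ γ : ℝ → M, γ 0 = x ∧ IsMIntegralCurve γ V := by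
    refine exists_isMIntegralCurve_of_isMIntegralCurveOn hV1 (half_pos hε) fun x ↦ ?_
    obtain ⟨γ, h0, hγ⟩ := hloc (ε / 2) (by rw [abs_of_pos (half_pos hε)]; linarith) x
    refine ⟨γ ∘ (· * (2 / ε)), by simp [h0], ?_⟩
    have := hγ.comp_mul (2 / ε)
    have h2 : (fun x ↦ (2 / ε) • (ε / 2) • V x) = V := by
      funext x
      rw [smul_smul, div_mul_div_cancel₀ hε.ne', div_self two_ne_zero, one_smul]
    have h3 : {t | t * (2 / ε) ∈ Set.Ioo (-1 : ℝ) 1} = Set.Ioo (-(ε / 2)) (ε / 2) := by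
      ext t
      have : t * (2 / ε) = t / (ε / 2) := by field_simp
      simp only [Set.mem_ofPred_eq, Set.mem_Ioo, this, lt_div_iff₀ (half_pos hε),
        div_lt_iff₀ (half_pos hε), neg_mul, one_mul]
    rw [h3] at this
    convert! this using 1
    exact h2.symm
  choose φ hφ0 hφ using fun x ↦ hex x
  have hadd : ∀ s t x, φ x (s + t) = φ (φ x t) s := by
    intro s t x
    have h1 : IsMIntegralCurve (φ x ∘ (· + t)) V := (hφ x).comp_add t
    have := isMIntegralCurve_Ioo_eq_of_contMDiff_boundaryless (t₀ := 0) hV1 h1 (hφ (φ x t))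
      (by simp [hφ0])
    exact congrFun this s
  -- smoothness for small times
  have hnear : ∀ x₀ : M, ContMDiffAt (𝓘(ℝ, ℝ).prod 𝓘(ℝ, E)) 𝓘(ℝ, E) ∞
      (fun p : ℝ × M ↦ φ p.2 p.1) (0, x₀) := by
    intro x₀
    obtain ⟨Γ, hΓ, hq⟩ := exists_local_solution hV x₀
    -- The local solution is evaluated at the rescaled time `1 / 2`, inside the open interval `(-1,
    -- 1)` on which uniqueness applies; doubling the parameter compensates for this.
    have hdbl : ContMDiff (𝓘(ℝ, ℝ).prod 𝓘(ℝ, E)) (𝓘(ℝ, ℝ).prod 𝓘(ℝ, E)) ∞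
        (fun p : ℝ × M ↦ (2 * p.1, p.2)) :=
      (contMDiff_const.mul contMDiff_fst).prodMk contMDiff_snd
    have hd0 : (fun p : ℝ × M ↦ (2 * p.1, p.2)) (0, x₀) = (0, x₀) := by simp
    have h1 : ContMDiffAt (𝓘(ℝ, ℝ).prod 𝓘(ℝ, E)) 𝓘(ℝ, E) ∞
        (fun p : ℝ × M ↦ Γ (2 * p.1, p.2) (1 / 2)) (0, x₀) :=
      ContMDiffAt.comp_of_eq (x := ((0 : ℝ), x₀)) hΓ hdbl.contMDiffAt hd0
    refine h1.congr_of_eventuallyEq ?_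
    have ht : Filter.Tendsto (fun p : ℝ × M ↦ (2 * p.1, p.2)) (𝓝 (0, x₀)) (𝓝 (0, x₀)) := by
      have := hdbl.continuous.continuousAt (x := ((0 : ℝ), x₀))
      simpa [ContinuousAt] using this
    filter_upwards [ht.eventually hq] with p ⟨hp0, hp⟩
    have h2 : IsMIntegralCurveOn (φ p.2 ∘ (· * (2 * p.1))) (fun x ↦ (2 * p.1) • V x)
        (Set.Ioo (-1) 1) := ((hφ p.2).comp_mul (2 * p.1)).isMIntegralCurveOn _
    have h3 := isMIntegralCurveOn_Ioo_eqOn_of_contMDiff_boundaryless (t₀ := 0) (by norm_num)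
      (hsm (2 * p.1)) h2 hp (by simp [hφ0, hp0])
    have h4 := h3 (show (1 / 2 : ℝ) ∈ Set.Ioo (-1 : ℝ) 1 by constructor <;> norm_num)
    rw [← h4]
    simp only [Function.comp]
    congr 1
    ring
  -- smoothness for all times
  have hm : ∀ m : ℕ, ContMDiff (𝓘(ℝ, ℝ).prod 𝓘(ℝ, E)) 𝓘(ℝ, E) m
      (fun p : ℝ × M ↦ φ p.2 p.1) := by
    intro m
    -- A finite order is needed: smoothness of order `m` at a point spreads to a neighbourhood,
    -- which may depend on `m`. By compactness `δ` is uniform in `x`.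
    obtain ⟨δ, hδ, hsmall⟩ := exists_pos_forall_of_compact (M := M) (P := fun t x ↦
      ContMDiffAt (𝓘(ℝ, ℝ).prod 𝓘(ℝ, E)) 𝓘(ℝ, E) m (fun p : ℝ × M ↦ φ p.2 p.1) (t, x)) fun x₀ ↦
        (contMDiffAt_iff_contMDiffAt_nhds (by simp)).1
          ((hnear x₀).of_le (m := (m : WithTop ℕ∞)) (by exact_mod_cast le_top))
    -- By the group law the flow near time `k b` is the flow near time `(k - 1) b` composed with the
    -- map at the small time `b`.
    have hstep : ∀ (b : ℝ), |b| < δ → ∀ k : ℕ, ∀ x,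
        ContMDiffAt (𝓘(ℝ, ℝ).prod 𝓘(ℝ, E)) 𝓘(ℝ, E) m (fun p : ℝ × M ↦ φ p.2 p.1) (k * b, x) := by
      intro b hb k
      induction k with
      | zero => intro x; exact hsmall _ (by simpa using hδ) x
      | succ k ih =>
        intro x
        have hb' : ContMDiff 𝓘(ℝ, E) (𝓘(ℝ, ℝ).prod 𝓘(ℝ, E)) m (fun x : M ↦ (b, x)) :=
          contMDiff_const.prodMk contMDiff_id
        have hfb : ContMDiffAt 𝓘(ℝ, E) 𝓘(ℝ, E) m (fun x : M ↦ φ x b) x :=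
          ContMDiffAt.comp (x := x) (g := fun p : ℝ × M ↦ φ p.2 p.1) (hsmall b hb x) hb'.contMDiffAt
        have hpair : ContMDiffAt (𝓘(ℝ, ℝ).prod 𝓘(ℝ, E)) (𝓘(ℝ, ℝ).prod 𝓘(ℝ, E)) m
            (fun p : ℝ × M ↦ (p.1 - b, φ p.2 b)) (((k + 1 : ℕ) : ℝ) * b, x) :=
          (contMDiffAt_fst.sub contMDiffAt_const).prodMk
            (ContMDiffAt.comp (x := ((((k + 1 : ℕ) : ℝ) * b, x))) (g := fun x : M ↦ φ x b)
              hfb contMDiffAt_snd)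
        have hE : (fun p : ℝ × M ↦ φ p.2 p.1) = fun p : ℝ × M ↦ φ (φ p.2 b) (p.1 - b) := by
          funext p
          rw [← hadd, sub_add_cancel]
        rw [hE]
        refine ContMDiffAt.comp_of_eq (x := ((((k + 1 : ℕ) : ℝ) * b, x)))
          (g := fun p : ℝ × M ↦ φ p.2 p.1) (ih (φ x b)) hpair ?_
        refine Prod.ext ?_ rfl
        push_cast
        ring
    rintro ⟨t, x⟩
    obtain ⟨k, hk⟩ := exists_nat_gt (|t| / δ)
    have hk0 : (0 : ℝ) < k := (by positivity : 0 ≤ |t| / δ).trans_lt hk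
    have := hstep (t / k) (by
      rw [abs_div, abs_of_pos hk0, div_lt_iff₀ hk0]
      rwa [div_lt_iff₀ hδ, mul_comm] at hk) k x
    rwa [mul_div_cancel₀ _ hk0.ne'] at this
  have hsmooth : ContMDiff (𝓘(ℝ, ℝ).prod 𝓘(ℝ, E)) 𝓘(ℝ, E) ∞
      (fun p : ℝ × M ↦ φ p.2 p.1) := contMDiff_infty.2 hm
  have hslice : ∀ t, ContMDiff 𝓘(ℝ, E) 𝓘(ℝ, E) ∞ (fun x : M ↦ φ x t) := fun t ↦
    hsmooth.comp (contMDiff_const.prodMk contMDiff_id :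
      ContMDiff 𝓘(ℝ, E) (𝓘(ℝ, ℝ).prod 𝓘(ℝ, E)) ∞ (fun x : M ↦ (t, x)))
  refine ⟨fun t ↦
    { toFun := fun x ↦ φ x t
      invFun := fun x ↦ φ x (-t)
      left_inv := fun x ↦ by simp only [← hadd, neg_add_cancel, hφ0]
      right_inv := fun x ↦ by simp only [← hadd, add_neg_cancel, hφ0]
      contMDiff_toFun := hslice t
      contMDiff_invFun := hslice (-t) }, hsmooth, hφ0, fun s t x ↦ hadd s t x, hφ⟩

end Flow

/-! ### Coordinate frames of a manifold -/

section Frame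

variable {F : Type*} [NormedAddCommGroup F] [NormedSpace ℝ F]
variable {H : Type*} [TopologicalSpace H] (J : ModelWithCorners ℝ F H)
variable {N : Type*} [TopologicalSpace N] [ChartedSpace H N] [IsManifold J ∞ N]

/-- The coordinate fields of the preferred chart at `c₀`. -/
def coordField (c₀ : N) (U : F) (c : N) : TangentSpace J c :=
  (trivializationAt F (TangentSpace J) c₀).symmL ℝ c U

theorem contMDiffAt_coordField (c₀ : N) (U : F) :
    ContMDiffAt J (J.prod 𝓘(ℝ, F)) ∞
      (fun c ↦ Bundle.TotalSpace.mk' F c (coordField J c₀ U c)) c₀ := by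
  have h := (trivializationAt F (TangentSpace J : N → Type _) c₀).contMDiffAt_symmL
    (IB := J) (n := ∞) (x := c₀) (FiberBundle.mem_baseSet_trivializationAt' c₀)
  have hU : ContMDiffAt J (J.prod 𝓘(ℝ, F)) ∞
      (fun c ↦ Bundle.TotalSpace.mk' F (E := Bundle.Trivial N F) c U) c₀ := by
    refine (Bundle.contMDiffAt_section (E := Bundle.Trivial N F) (F := F) (IB := J) c₀).2 ?_
    exact contMDiffAt_const
  exact ContMDiffAt.clm_bundle_apply (b := id) h hU

theorem coordField_self (c₀ : N) (U : F) : coordField J c₀ U c₀ = U := by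
  have : IsManifold J 1 N := .of_le (n := ∞) (by decide)
  rw [coordField, TangentBundle.symmL_trivializationAt_eq_core (mem_chart_source H c₀)]
  exact (tangentBundleCore J N).coordChange_self _ _ (mem_chart_source H c₀) U

/-- An endomorphism field is smooth if its values on the coordinate fields are. -/
theorem contMDiffAt_endField [FiniteDimensional ℝ F]
    (A : ∀ c : N, TangentSpace J c →L[ℝ] TangentSpace J c) (c₀ : N)
    (h : ∀ U : F, ContMDiffAt J (J.prod 𝓘(ℝ, F)) ∞
      (fun c ↦ Bundle.TotalSpace.mk' F c (A c (coordField J c₀ U c))) c₀) :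
    ContMDiffAt J (J.prod 𝓘(ℝ, F →L[ℝ] F)) ∞
      (fun c ↦ Bundle.TotalSpace.mk' (F →L[ℝ] F) c (A c)) c₀ := by
  rw [contMDiffAt_hom_bundle]
  refine ⟨contMDiffAt_id, ?_⟩
  have hs : ∀ U : F, ContMDiffAt J 𝓘(ℝ, F) ∞ (fun c ↦
      ContinuousLinearMap.inCoordinates F (TangentSpace J) F (TangentSpace J) c₀ c c₀ c (A c) U)
      c₀ := by
    intro U
    have h1 := (Bundle.contMDiffAt_section c₀).1 (h U)
    refine h1.congr_of_eventuallyEq ?_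
    filter_upwards [(trivializationAt F (TangentSpace J) c₀).open_baseSet.mem_nhds
      (FiberBundle.mem_baseSet_trivializationAt' c₀)] with c hc
    change (trivializationAt F (TangentSpace J) c₀).continuousLinearMapAt ℝ c _ = _
    rw [Bundle.Trivialization.continuousLinearMapAt_apply,
      Bundle.Trivialization.coe_linearMapAt_of_mem _ hc]
    rfl
  let b := Module.finBasis ℝ F
  have : ∀ B : F →L[ℝ] F, B = ∑ i, (LinearMap.toContinuousLinearMap (b.coord i)).smulRight
      (B (b i)) := by
    intro B
    ext w
    conv_lhs => rw [← b.sum_repr w, map_sum]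
    simp
  refine ContMDiffAt.congr_of_eventuallyEq (f := fun c ↦ ∑ i,
    ContinuousLinearMap.smulRightL ℝ F F (LinearMap.toContinuousLinearMap (b.coord i))
      (ContinuousLinearMap.inCoordinates F (TangentSpace J) F (TangentSpace J) c₀ c c₀ c (A c)
        (b i))) ?_ (.of_forall fun c ↦ this _)
  refine contMDiffAt_finsetSum fun i _ ↦ ?_
  exact ContMDiffAt.comp (x := c₀)
    (ContinuousLinearMap.contMDiff _).contMDiffAt (hs (b i))

theorem coordField_eq_mfderiv [J.Boundaryless] (c₀ : N) (U : F) {c : N}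
    (hc : c ∈ (chartAt H c₀).source) :
    coordField J c₀ U c = mfderiv 𝓘(ℝ, F) J (extChartAt J c₀).symm (extChartAt J c₀ c) U := by
  have : IsManifold J 1 N := .of_le (n := ∞) (by decide)
  rw [coordField, TangentBundle.symmL_trivializationAt hc, ModelWithCorners.range_eq_univ,
    mfderivWithin_univ]
  rfl

/-- In the chart at `c₀` the coordinate fields are constant. -/
theorem mlieBracket_coordField [J.Boundaryless] (c₀ : N) (U W : F) :
    VectorField.mlieBracket J (coordField J c₀ U) (coordField J c₀ W) c₀ = 0 := by
  have : IsManifold J 1 N := .of_le (n := ∞) (by decide)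
  have key : ∀ U : F, VectorField.mpullbackWithin 𝓘(ℝ, F) J (extChartAt J c₀).symm
      (coordField J c₀ U) (Set.range J) =ᶠ[𝓝 (extChartAt J c₀ c₀)] fun _ ↦ U := by
    intro U
    filter_upwards [(isOpen_extChartAt_target c₀).mem_nhds (mem_extChartAt_target c₀)] with y hy
    have hs : (extChartAt J c₀).symm y ∈ (chartAt H c₀).source := by
      rw [← extChartAt_source J]
      exact (extChartAt J c₀).map_target hy
    rw [VectorField.mpullbackWithin_apply, coordField_eq_mfderiv J c₀ U hs,
      (extChartAt J c₀).right_inv hy, ModelWithCorners.range_eq_univ, mfderivWithin_univ]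
    have hi := isInvertible_mfderivWithin_extChartAt_symm hy
    rw [ModelWithCorners.range_eq_univ, mfderivWithin_univ] at hi
    exact hi.inverse_apply_self U
  rw [← VectorField.mlieBracketWithin_univ, VectorField.mlieBracketWithin_apply]
  have hL : VectorField.lieBracketWithin ℝ
      (VectorField.mpullbackWithin 𝓘(ℝ, F) J (extChartAt J c₀).symm (coordField J c₀ U)
        (Set.range J))
      (VectorField.mpullbackWithin 𝓘(ℝ, F) J (extChartAt J c₀).symm (coordField J c₀ W)
        (Set.range J)) ((extChartAt J c₀).symm ⁻¹' Set.univ ∩ Set.range J)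
      (extChartAt J c₀ c₀) = 0 := by
    rw [((key U).filter_mono nhdsWithin_le_nhds).lieBracketWithin_vectorField_eq
      (key U).self_of_nhds ((key W).filter_mono nhdsWithin_le_nhds) (key W).self_of_nhds]
    simp [VectorField.lieBracketWithin]
  exact (congrArg _ hL).trans (map_zero _)

end Frame

/-! ### Coordinate frames of the cone -/

section ConeFrame

variable {E : Type*} [NormedAddCommGroup E] [InnerProductSpace ℝ E] [FiniteDimensional ℝ E]
variable {M : Type*} [TopologicalSpace M] [ChartedSpace E M] [IsManifold 𝓘(ℝ, E) ∞ M]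

/-- The coordinate frame of the chart at `x₀`, as a map to the model space. -/
def coordMap (x₀ x : M) : E →L[ℝ] E :=
  (trivializationAt E (TangentSpace 𝓘(ℝ, E)) x₀).symmL ℝ x

theorem coordMap_self (x₀ : M) (u : E) : coordMap x₀ x₀ u = u := coordField_self 𝓘(ℝ, E) x₀ u

theorem extChartAt_ray (r₀ r : Ray) : extChartAt 𝓘(ℝ, ℝ) r₀ r = r := by
  rfl

theorem chartAt_ray_source (r₀ : Ray) : (chartAt ℝ r₀).source = Set.univ := by
  rw [TopologicalSpace.Opens.chartAt_eq, OpenPartialHomeomorph.subtypeRestr_source]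
  exact Set.eq_univ_of_forall fun _ ↦ trivial

theorem coe_mem_extChartAt_ray_target (r₀ r : Ray) :
    (r : ℝ) ∈ (extChartAt 𝓘(ℝ, ℝ) r₀).target := by
  rw [← extChartAt_ray r₀ r]
  exact (extChartAt 𝓘(ℝ, ℝ) r₀).map_source (by rw [extChartAt_source, chartAt_ray_source]; trivial)

theorem mfderiv_extChartAt_ray (r₀ r : Ray) (s : TangentSpace 𝓘(ℝ, ℝ) r) :
    mfderiv 𝓘(ℝ, ℝ) 𝓘(ℝ, ℝ) (extChartAt 𝓘(ℝ, ℝ) r₀) r s = s := by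
  change mfderiv 𝓘(ℝ, ℝ) 𝓘(ℝ, ℝ) (extChartAt 𝓘(ℝ, ℝ) r) r s = s
  rw [mfderiv_extChartAt_self]
  rfl

theorem mfderiv_extChartAt_ray_symm (r₀ r : Ray) (s : ℝ) :
    mfderiv 𝓘(ℝ, ℝ) 𝓘(ℝ, ℝ) (extChartAt 𝓘(ℝ, ℝ) r₀).symm (r : ℝ) s = s := by
  have h := mfderiv_extChartAt_mfderiv_symm r₀ (coe_mem_extChartAt_ray_target r₀ r) s
  rwa [mfderiv_extChartAt_ray] at h

/-- The charts of the ray are its inclusion into `ℝ`, so the radial component of the frame is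
constant. -/
theorem coordField_cone (c₀ c : M × Ray) (U : E × ℝ)
    (hc : c.1 ∈ (chartAt E c₀.1).source) :
    coordField (𝓘(ℝ, E).prod 𝓘(ℝ, ℝ)) c₀ U c =
      ((coordMap c₀.1 c.1 U.1, U.2) : E × ℝ) := by
  have hcm : coordMap c₀.1 c.1 U.1 = coordField 𝓘(ℝ, E) c₀.1 U.1 c.1 := rfl
  have hc' : c ∈ (chartAt (ModelProd E ℝ) c₀).source := by
    rw [prodChartedSpace_chartAt, OpenPartialHomeomorph.prod_source]
    exact ⟨hc, by rw [chartAt_ray_source]; trivial⟩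
  rw [hcm, coordField_eq_mfderiv _ c₀ U hc', coordField_eq_mfderiv _ c₀.1 U.1 hc]
  have h1 := mdifferentiableAt_extChartAt_symm c₀.1
    ((extChartAt 𝓘(ℝ, E) c₀.1).map_source (by rwa [extChartAt_source]))
  have h2 := mdifferentiableAt_extChartAt_symm c₀.2 (coe_mem_extChartAt_ray_target c₀.2 c.2)
  have h := mfderiv_prodMap (p := (extChartAt 𝓘(ℝ, E) c₀.1 c.1, (c.2 : ℝ))) h1 h2
  rw [extChartAt_prod]
  rw [modelWithCornersSelf_prod, ← chartedSpaceSelf_prod]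
  refine (DFunLike.congr_fun h U).trans ?_
  exact Prod.ext rfl (mfderiv_extChartAt_ray_symm c₀.2 c.2 U.2)

end ConeFrame

/-! ### The cone metric and its Levi-Civita connection -/

section Cone

variable {E : Type*} [NormedAddCommGroup E] [InnerProductSpace ℝ E] [FiniteDimensional ℝ E]
variable {M : Type*} [TopologicalSpace M] [ChartedSpace E M] [IsManifold 𝓘(ℝ, E) ∞ M]

theorem contMDiff_tangent_fst :
    ContMDiff ((𝓘(ℝ, E).prod 𝓘(ℝ, ℝ)).prod 𝓘(ℝ, E × ℝ)) (𝓘(ℝ, E).prod 𝓘(ℝ, E)) ∞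
      (fun p : TangentBundle (𝓘(ℝ, E).prod 𝓘(ℝ, ℝ)) (M × Ray) ↦
        (⟨p.1.1, (p.2 : E × ℝ).1⟩ : TangentBundle 𝓘(ℝ, E) M)) := by
  have h : ContMDiff (𝓘(ℝ, E).prod 𝓘(ℝ, ℝ)) 𝓘(ℝ, E) ∞ (Prod.fst : M × Ray → M) := contMDiff_fst
  have h' := h.contMDiff_tangentMap (m := ∞) (by simp)
  refine h'.congr fun p ↦ ?_
  rw [tangentMap_prodFst]

theorem contMDiff_tangent_snd :
    ContMDiff ((𝓘(ℝ, E).prod 𝓘(ℝ, ℝ)).prod 𝓘(ℝ, E × ℝ)) 𝓘(ℝ, ℝ) ∞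
      (fun p : TangentBundle (𝓘(ℝ, E).prod 𝓘(ℝ, ℝ)) (M × Ray) ↦ (p.2 : E × ℝ).2) := by
  have h : ContMDiff (𝓘(ℝ, E).prod 𝓘(ℝ, ℝ)) 𝓘(ℝ, ℝ) ∞ (Prod.snd : M × Ray → Ray) := contMDiff_snd
  have h' := h.contMDiff_tangentMap (m := ∞) (by simp)
  have h2 := contMDiffOn_mfderiv_extChartAt (E := ℝ) rayOne
  rw [extChartAt_source, chartAt_ray_source, Set.preimage_univ] at h2
  have h3 : ContMDiff (𝓘(ℝ, ℝ).prod 𝓘(ℝ, ℝ)) 𝓘(ℝ, ℝ) ∞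
      (fun p : TangentBundle 𝓘(ℝ, ℝ) Ray ↦ (p.2 : ℝ)) :=
    (contMDiffOn_univ.1 h2).congr fun p ↦ (mfderiv_extChartAt_ray _ _ _).symm
  refine (h3.comp h').congr fun p ↦ ?_
  change _ = (tangentMap (𝓘(ℝ, E).prod 𝓘(ℝ, ℝ)) 𝓘(ℝ, ℝ) Prod.snd p).2
  rw [tangentMap_prodSnd]

theorem mdifferentiableAt_coneInner (g : RMetric E M)
    {X Y : ∀ c : M × Ray, TangentSpace (𝓘(ℝ, E).prod 𝓘(ℝ, ℝ)) c} {c : M × Ray}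
    (hX : FieldDiffAt X c) (hY : FieldDiffAt Y c) :
    MDifferentiableAt (𝓘(ℝ, E).prod 𝓘(ℝ, ℝ)) 𝓘(ℝ, ℝ) (fun c ↦ coneInner g c (X c) (Y c)) c := by
  have hfst : ∀ {X : ∀ c : M × Ray, TangentSpace (𝓘(ℝ, E).prod 𝓘(ℝ, ℝ)) c}, FieldDiffAt X c →
      MDifferentiableAt (𝓘(ℝ, E).prod 𝓘(ℝ, ℝ)) (𝓘(ℝ, E).prod 𝓘(ℝ, E))
        (fun c ↦ (⟨c.1, (X c : E × ℝ).1⟩ : TangentBundle 𝓘(ℝ, E) M)) c := fun hX ↦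
    MDifferentiableAt.comp c
      ((contMDiff_tangent_fst (E := E) (M := M)).mdifferentiable (by simp) _) hX
  have hsnd : ∀ {X : ∀ c : M × Ray, TangentSpace (𝓘(ℝ, E).prod 𝓘(ℝ, ℝ)) c}, FieldDiffAt X c →
      MDifferentiableAt (𝓘(ℝ, E).prod 𝓘(ℝ, ℝ)) 𝓘(ℝ, ℝ) (fun c ↦ (X c : E × ℝ).2) c := fun hX ↦
    MDifferentiableAt.comp c (g := fun p : TangentBundle (𝓘(ℝ, E).prod 𝓘(ℝ, ℝ)) (M × Ray) ↦
      (p.2 : E × ℝ).2) ((contMDiff_tangent_snd (E := E) (M := M)).mdifferentiable (by simp) _) hX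
  have hr : MDifferentiableAt (𝓘(ℝ, E).prod 𝓘(ℝ, ℝ)) 𝓘(ℝ, ℝ) (fun c : M × Ray ↦ (c.2 : ℝ)) c :=
    MDifferentiableAt.comp c (contMDiff_subtype_val.mdifferentiable (n := ∞) (by simp) _)
      mdifferentiableAt_snd
  have hg : MDifferentiableAt (𝓘(ℝ, E).prod 𝓘(ℝ, ℝ)) (𝓘(ℝ, E).prod 𝓘(ℝ, E →L[ℝ] E →L[ℝ] ℝ))
      (fun c : M × Ray ↦ Bundle.TotalSpace.mk' (E →L[ℝ] E →L[ℝ] ℝ)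
        (E := fun x : M ↦ TangentSpace 𝓘(ℝ, E) x →L[ℝ] TangentSpace 𝓘(ℝ, E) x →L[ℝ] ℝ)
        c.1 (g.inner c.1)) c :=
    MDifferentiableAt.comp c (g.contMDiff.mdifferentiable (by simp) _) mdifferentiableAt_fst
  have hi : MDifferentiableAt (𝓘(ℝ, E).prod 𝓘(ℝ, ℝ)) 𝓘(ℝ, ℝ)
      (fun c ↦ g.inner c.1 (X c : E × ℝ).1 (Y c : E × ℝ).1) c := by
    have := MDifferentiableAt.clm_bundle_apply₂ (F₁ := E) (F₂ := E) (F₃ := ℝ)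
      (E₁ := fun x : M ↦ TangentSpace 𝓘(ℝ, E) x) (E₂ := fun x : M ↦ TangentSpace 𝓘(ℝ, E) x)
      (E₃ := Bundle.Trivial M ℝ) (b := fun c : M × Ray ↦ c.1) hg (hfst hX) (hfst hY)
    exact ((mdifferentiableAt_totalSpace _ _).1 this).2
  exact ((hr.pow 2).mul hi).add ((hsnd hX).mul (hsnd hY))

/-- The radial field `∂_r`. -/
def radial (c : M × Ray) : ConeTangent (E := E) c := ((0, 1) : E × ℝ)

theorem coordField_radial_eventuallyEq (c₀ : M × Ray) :
    ∀ᶠ c in 𝓝 c₀, coordField (𝓘(ℝ, E).prod 𝓘(ℝ, ℝ)) c₀ (0, 1) c = radial (E := E) c := by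
  have : ∀ᶠ c : M × Ray in 𝓝 c₀, c.1 ∈ (chartAt E c₀.1).source :=
    continuousAt_fst.eventually ((chartAt E c₀.1).open_source.mem_nhds (mem_chart_source E c₀.1))
  filter_upwards [this] with c hc
  rw [coordField_cone c₀ c _ hc]
  exact Prod.ext (map_zero _) rfl

theorem contMDiff_radial :
    ContMDiff (𝓘(ℝ, E).prod 𝓘(ℝ, ℝ)) ((𝓘(ℝ, E).prod 𝓘(ℝ, ℝ)).prod 𝓘(ℝ, E × ℝ)) ∞
      (fun c : M × Ray ↦ (⟨c, radial c⟩ : TangentBundle (𝓘(ℝ, E).prod 𝓘(ℝ, ℝ)) (M × Ray))) := by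
  intro c₀
  refine (contMDiffAt_coordField (𝓘(ℝ, E).prod 𝓘(ℝ, ℝ)) c₀ (0, 1)).congr_of_eventuallyEq ?_
  filter_upwards [coordField_radial_eventuallyEq (E := E) c₀] with c hc
  rw [hc]

theorem fieldDiffAt_coordField (c₀ : M × Ray) (U : E × ℝ) :
    FieldDiffAt (coordField (𝓘(ℝ, E).prod 𝓘(ℝ, ℝ)) c₀ U) c₀ :=
  (contMDiffAt_coordField (𝓘(ℝ, E).prod 𝓘(ℝ, ℝ)) c₀ U).mdifferentiableAt (by simp)

/-- The metric at `x`, as a bilinear form on the model space. -/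
def metricAt (g : RMetric E M) (x : M) : E →L[ℝ] E →L[ℝ] ℝ := g.inner x

theorem metricAt_symm (g : RMetric E M) (x : M) (u v : E) :
    metricAt g x u v = metricAt g x v u := g.symm x u v

theorem metricAt_pos (g : RMetric E M) (x : M) {u : E} (hu : u ≠ 0) : 0 < metricAt g x u u :=
  g.pos x u hu

/-- The cone metric as a bilinear form. -/
def coneForm (g : RMetric E M) (c : M × Ray) : LinearMap.BilinForm ℝ (E × ℝ) :=
  LinearMap.mk₂ ℝ (fun u v ↦ (c.2 : ℝ) ^ 2 * metricAt g c.1 u.1 v.1 + u.2 * v.2)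
    (fun u u' v ↦ by simp; ring) (fun a u v ↦ by simp; ring)
    (fun u v v' ↦ by simp; ring) (fun a u v ↦ by simp; ring)

theorem coneForm_apply (g : RMetric E M) (c : M × Ray) (u v : E × ℝ) :
    coneForm g c u v = (c.2 : ℝ) ^ 2 * metricAt g c.1 u.1 v.1 + u.2 * v.2 := rfl

theorem coneForm_symm (g : RMetric E M) (c : M × Ray) (u v : E × ℝ) :
    coneForm g c u v = coneForm g c v u := by
  rw [coneForm_apply, coneForm_apply, metricAt_symm, mul_comm u.2]

theorem coneForm_pos (g : RMetric E M) (c : M × Ray) {u : E × ℝ} (hu : u ≠ 0) :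
    0 < coneForm g c u u := by
  have hr : (0 : ℝ) < c.2 := c.2.2
  rw [coneForm_apply]
  by_cases h : u.1 = 0
  · have h2 : u.2 ≠ 0 := fun h2 ↦ hu (Prod.ext h h2)
    rw [h, map_zero, mul_zero, zero_add]
    exact mul_self_pos.2 h2
  · have := metricAt_pos g c.1 h
    have h2 := mul_self_nonneg u.2
    positivity

theorem ext_coneForm (g : RMetric E M) (c : M × Ray) {u v : E × ℝ}
    (h : ∀ w, coneForm g c u w = coneForm g c v w) : u = v := by
  by_contra hne
  have := coneForm_pos g c (sub_ne_zero.2 hne)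
  rw [map_sub (coneForm g c), LinearMap.sub_apply, h, sub_self] at this
  exact this.false

variable {g : RMetric E M} {D : CovariantDerivative (𝓘(ℝ, E).prod 𝓘(ℝ, ℝ)) (E × ℝ)
      (fun c : M × Ray ↦ TangentSpace (𝓘(ℝ, E).prod 𝓘(ℝ, ℝ)) c)}

/-- The covariant derivative at `c₀` of the coordinate field `U` in the direction `W`. -/
def covCoord (D : CovariantDerivative (𝓘(ℝ, E).prod 𝓘(ℝ, ℝ)) (E × ℝ)
      (fun c : M × Ray ↦ TangentSpace (𝓘(ℝ, E).prod 𝓘(ℝ, ℝ)) c)) (c₀ : M × Ray) (U W : E × ℝ) :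
    E × ℝ :=
  D (coordField (𝓘(ℝ, E).prod 𝓘(ℝ, ℝ)) c₀ U) c₀ W

/-- Torsion and the bracket of two coordinate fields vanish: this is the symmetry of the Christoffel
symbols. -/
theorem IsLeviCivita.covCoord_comm (hD : IsLeviCivita g D) (c₀ : M × Ray) (U W : E × ℝ) :
    covCoord D c₀ U W = covCoord D c₀ W U := by
  have h := (CovariantDerivative.torsion_eq_zero_iff D).1 hD.torsion
    (fieldDiffAt_coordField c₀ U) (fieldDiffAt_coordField c₀ W)
  rw [mlieBracket_coordField, coordField_self, coordField_self] at h
  exact (sub_eq_zero.1 h).symm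

theorem IsLeviCivita.metric_coordField (hD : IsLeviCivita g D) (c₀ : M × Ray) (U W Z : E × ℝ) :
    mfderiv (𝓘(ℝ, E).prod 𝓘(ℝ, ℝ)) 𝓘(ℝ, ℝ) (fun c ↦ coneInner g c
      (coordField (𝓘(ℝ, E).prod 𝓘(ℝ, ℝ)) c₀ U c) (coordField (𝓘(ℝ, E).prod 𝓘(ℝ, ℝ)) c₀ W c))
      c₀ Z = coneForm g c₀ (covCoord D c₀ U Z) W + coneForm g c₀ U (covCoord D c₀ W Z) := by
  have h := hD.metric _ _ c₀ Z (fieldDiffAt_coordField c₀ U) (fieldDiffAt_coordField c₀ W)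
  rw [coordField_self, coordField_self] at h
  exact h

theorem eventually_coneInner_coordField (c₀ : M × Ray) (U W : E × ℝ) :
    ∀ᶠ c in 𝓝 c₀, coneInner g c (coordField (𝓘(ℝ, E).prod 𝓘(ℝ, ℝ)) c₀ U c)
      (coordField (𝓘(ℝ, E).prod 𝓘(ℝ, ℝ)) c₀ W c) =
      (c.2 : ℝ) ^ 2 * metricAt g c.1 (coordMap c₀.1 c.1 U.1) (coordMap c₀.1 c.1 W.1) + U.2 * W.2 := by
  have : ∀ᶠ c : M × Ray in 𝓝 c₀, c.1 ∈ (chartAt E c₀.1).source :=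
    continuousAt_fst.eventually ((chartAt E c₀.1).open_source.mem_nhds (mem_chart_source E c₀.1))
  filter_upwards [this] with c hc
  rw [coordField_cone c₀ c U hc, coordField_cone c₀ c W hc]
  rfl

/-- The curve `r ↦ (x₀, r)` in the cone. -/
def radialCurve (x₀ : M) (r : ℝ) : M × Ray := (x₀, (extChartAt 𝓘(ℝ, ℝ) rayOne).symm r)

theorem radialCurve_one (x₀ : M) : radialCurve x₀ 1 = (x₀, rayOne) :=
  Prod.ext rfl ((extChartAt 𝓘(ℝ, ℝ) rayOne).left_inv (mem_extChartAt_source rayOne))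

theorem hasMFDerivAt_radialCurve (x₀ : M) :
    HasMFDerivAt 𝓘(ℝ, ℝ) (𝓘(ℝ, E).prod 𝓘(ℝ, ℝ)) (radialCurve x₀) 1
      ((0 : ℝ →L[ℝ] E).prod (mfderiv 𝓘(ℝ, ℝ) 𝓘(ℝ, ℝ) (extChartAt 𝓘(ℝ, ℝ) rayOne).symm (1 : ℝ))) :=
  (hasMFDerivAt_const x₀ (1 : ℝ)).prodMk
    (mdifferentiableAt_extChartAt_symm rayOne
      (coe_mem_extChartAt_ray_target rayOne rayOne)).hasMFDerivAt

theorem hasDerivAt_comp_radialCurve {f : M × Ray → ℝ} (x₀ : M) {c : M × Ray}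
    (hc : radialCurve x₀ 1 = c) (hf : MDifferentiableAt (𝓘(ℝ, E).prod 𝓘(ℝ, ℝ)) 𝓘(ℝ, ℝ) f c) :
    HasDerivAt (f ∘ radialCurve x₀)
      (mfderiv (𝓘(ℝ, E).prod 𝓘(ℝ, ℝ)) 𝓘(ℝ, ℝ) f c ((0, 1) : E × ℝ) : ℝ) 1 := by
  subst hc
  have hcomp := HasMFDerivAt.comp (1 : ℝ) hf.hasMFDerivAt (hasMFDerivAt_radialCurve x₀)
  have hfd : HasFDerivAt (f ∘ radialCurve x₀) (_ : ℝ →L[ℝ] ℝ) (1 : ℝ) :=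
    hasMFDerivAt_iff_hasFDerivAt.1 hcomp
  refine hfd.hasDerivAt.congr_deriv ?_
  have h01 : ((0, mfderiv 𝓘(ℝ, ℝ) 𝓘(ℝ, ℝ) (extChartAt 𝓘(ℝ, ℝ) rayOne).symm (1 : ℝ) (1 : ℝ)) :
      E × ℝ) = (0, 1) := Prod.ext rfl (mfderiv_extChartAt_ray_symm rayOne rayOne 1)
  exact congrArg (fun w : E × ℝ ↦
    (mfderiv (𝓘(ℝ, E).prod 𝓘(ℝ, ℝ)) 𝓘(ℝ, ℝ) f (radialCurve x₀ 1) w : ℝ)) h01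

/-- `∇_u ∂_r = u / r` for `u` tangent to `M`; here at `r = 1`. -/
theorem IsLeviCivita.covCoord_radial (hD : IsLeviCivita g D) (x₀ : M) (u : E) :
    covCoord D (x₀, rayOne) (0, 1) (u, 0) = (u, 0) := by
  set c₀ : M × Ray := (x₀, rayOne) with hc₀
  refine ext_coneForm g c₀ fun W ↦ ?_
  have hconst : ∀ (U V : E × ℝ) (a : ℝ), (∀ᶠ c in 𝓝 c₀, coneInner g c
      (coordField (𝓘(ℝ, E).prod 𝓘(ℝ, ℝ)) c₀ U c)
      (coordField (𝓘(ℝ, E).prod 𝓘(ℝ, ℝ)) c₀ V c) = a) → ∀ Z : E × ℝ,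
      coneForm g c₀ (covCoord D c₀ U Z) V + coneForm g c₀ U (covCoord D c₀ V Z) = 0 := by
    intro U V a h Z
    rw [← hD.metric_coordField c₀ U V Z]
    have h' : HasMFDerivAt (𝓘(ℝ, E).prod 𝓘(ℝ, ℝ)) 𝓘(ℝ, ℝ) (fun c ↦ coneInner g c
      (coordField (𝓘(ℝ, E).prod 𝓘(ℝ, ℝ)) c₀ U c)
      (coordField (𝓘(ℝ, E).prod 𝓘(ℝ, ℝ)) c₀ V c)) c₀ 0 :=
      (hasMFDerivAt_const a c₀).congr_of_eventuallyEq h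
    rw [h'.mfderiv]
    rfl
  -- Koszul's formula by hand: `h1` and `h3` say that `⟨∂_r, W⟩` and `⟨u, ∂_r⟩` are constant, `h2`
  -- that `⟨u, W⟩` grows like `r²`. With the symmetry of the Christoffel symbols they give `⟨∇_u
  -- ∂_r, W⟩ = ⟨u, W⟩`.
  have h1 := hconst (0, 1) W W.2 (by
    filter_upwards [eventually_coneInner_coordField (g := g) c₀ (0, 1) W] with c hc
    rw [hc]
    simp) (u, 0)
  have h3 := hconst (u, 0) (0, 1) 0 (by
    filter_upwards [eventually_coneInner_coordField (g := g) c₀ (u, 0) (0, 1)] with c hc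
    rw [hc]
    simp) W
  have h2 : coneForm g c₀ (covCoord D c₀ (u, 0) (0, 1)) W +
      coneForm g c₀ (u, 0) (covCoord D c₀ W (0, 1)) = 2 * coneForm g c₀ (u, 0) W := by
    rw [← hD.metric_coordField c₀ (u, 0) W (0, 1)]
    have hd := hasDerivAt_comp_radialCurve x₀ (radialCurve_one x₀)
      (mdifferentiableAt_coneInner g (fieldDiffAt_coordField c₀ (u, 0))
        (fieldDiffAt_coordField c₀ W))
    have hm : (fun r : ℝ ↦ r ^ 2 * metricAt g x₀ u W.1) =ᶠ[𝓝 1]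
        (fun c ↦ coneInner g c
          (coordField (𝓘(ℝ, E).prod 𝓘(ℝ, ℝ)) c₀ (u, 0) c)
          (coordField (𝓘(ℝ, E).prod 𝓘(ℝ, ℝ)) c₀ W c)) ∘ radialCurve x₀ := by
      have ht : Filter.Tendsto (radialCurve x₀) (𝓝 1) (𝓝 c₀) := by
        have := (hasMFDerivAt_radialCurve (E := E) x₀).continuousAt
        rwa [ContinuousAt, radialCurve_one] at this
      filter_upwards [ht.eventually (eventually_coneInner_coordField (g := g) c₀ (u, 0) W),
        lt_mem_nhds (zero_lt_one (α := ℝ))] with r hr hr0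
      have hrr : ((extChartAt 𝓘(ℝ, ℝ) rayOne).symm r : ℝ) = r := by
        have h := (extChartAt 𝓘(ℝ, ℝ) rayOne).right_inv
          (coe_mem_extChartAt_ray_target rayOne ⟨r, hr0⟩)
        exact h
      rw [Function.comp_apply, hr, radialCurve, hrr, coordMap_self, coordMap_self, zero_mul, add_zero]
    have hd' : HasDerivAt (fun r : ℝ ↦ r ^ 2 * metricAt g x₀ u W.1)
        (2 * metricAt g x₀ u W.1) 1 := by
      simpa using ((hasDerivAt_id (1 : ℝ)).pow 2).mul_const (metricAt g x₀ u W.1)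
    have := (hd.congr_of_eventuallyEq hm).unique hd'
    rw [coneForm_apply]
    have h1 : ((c₀.2 : Ray) : ℝ) = 1 := rfl
    rw [h1, one_pow, one_mul, zero_mul, add_zero, ← this]
  rw [hD.covCoord_comm c₀ (u, 0) (0, 1), hD.covCoord_comm c₀ W (0, 1)] at h2
  rw [hD.covCoord_comm c₀ (u, 0) W] at h3
  rw [coneForm_symm g c₀ (covCoord D c₀ W (u, 0))] at h3
  linarith

end Cone

/-! ### The associated forms and their exterior derivatives -/

section AssociatedForm

variable {E : Type*} [NormedAddCommGroup E] [InnerProductSpace ℝ E] [FiniteDimensional ℝ E]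
variable {M : Type*} [TopologicalSpace M] [ChartedSpace E M] [IsManifold 𝓘(ℝ, E) ∞ M]
variable {g : RMetric E M} {D : CovariantDerivative (𝓘(ℝ, E).prod 𝓘(ℝ, ℝ)) (E × ℝ)
      (fun c : M × Ray ↦ TangentSpace (𝓘(ℝ, E).prod 𝓘(ℝ, ℝ)) c)} {A : ConeEnd E M}

/-- The chart at `x₀`, as a parametrization of `M × {1}`. -/
def sliceChart (x₀ : M) (y : E) : M × Ray := ((extChartAt 𝓘(ℝ, E) x₀).symm y, rayOne)

theorem sliceChart_base (x₀ : M) : sliceChart x₀ (extChartAt 𝓘(ℝ, E) x₀ x₀) = (x₀, rayOne) :=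
  Prod.ext ((extChartAt 𝓘(ℝ, E) x₀).left_inv (mem_extChartAt_source x₀)) rfl

theorem hasMFDerivAt_sliceChart (x₀ : M) :
    HasMFDerivAt 𝓘(ℝ, E) (𝓘(ℝ, E).prod 𝓘(ℝ, ℝ)) (sliceChart x₀) (extChartAt 𝓘(ℝ, E) x₀ x₀)
      ((mfderiv 𝓘(ℝ, E) 𝓘(ℝ, E) (extChartAt 𝓘(ℝ, E) x₀).symm (extChartAt 𝓘(ℝ, E) x₀ x₀)).prod
        (0 : E →L[ℝ] ℝ)) :=
  (mdifferentiableAt_extChartAt_symm x₀ (mem_extChartAt_target x₀)).hasMFDerivAt.prodMk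
    (hasMFDerivAt_const rayOne _)

theorem hasFDerivAt_comp_sliceChart {f : M × Ray → ℝ} (x₀ : M) {c : M × Ray}
    (hc : sliceChart x₀ (extChartAt 𝓘(ℝ, E) x₀ x₀) = c)
    (hf : MDifferentiableAt (𝓘(ℝ, E).prod 𝓘(ℝ, ℝ)) 𝓘(ℝ, ℝ) f c) :
    ∃ L : E →L[ℝ] ℝ, HasFDerivAt (f ∘ sliceChart x₀) L (extChartAt 𝓘(ℝ, E) x₀ x₀) ∧
      ∀ u : E, L u = (mfderiv (𝓘(ℝ, E).prod 𝓘(ℝ, ℝ)) 𝓘(ℝ, ℝ) f c ((u, 0) : E × ℝ) : ℝ) := by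
  subst hc
  have hcomp := HasMFDerivAt.comp (extChartAt 𝓘(ℝ, E) x₀ x₀) hf.hasMFDerivAt
    (hasMFDerivAt_sliceChart x₀)
  refine ⟨_, hasMFDerivAt_iff_hasFDerivAt.1 hcomp, fun u ↦ ?_⟩
  have h01 : ((mfderiv 𝓘(ℝ, E) 𝓘(ℝ, E) (extChartAt 𝓘(ℝ, E) x₀).symm (extChartAt 𝓘(ℝ, E) x₀ x₀) u,
      0) : E × ℝ) = (u, 0) := Prod.ext (mfderiv_extChartAt_symm_self x₀ u) rfl
  exact congrArg (fun w : E × ℝ ↦ (mfderiv (𝓘(ℝ, E).prod 𝓘(ℝ, ℝ)) 𝓘(ℝ, ℝ) f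
    (sliceChart x₀ (extChartAt 𝓘(ℝ, E) x₀ x₀)) w : ℝ)) h01

theorem IsParallelIsometry.contMDiffAt_apply (hA : IsParallelIsometry g D A)
    {X : ∀ c : M × Ray, TangentSpace (𝓘(ℝ, E).prod 𝓘(ℝ, ℝ)) c} {c₀ : M × Ray}
    (hX : ContMDiffAt (𝓘(ℝ, E).prod 𝓘(ℝ, ℝ)) ((𝓘(ℝ, E).prod 𝓘(ℝ, ℝ)).prod 𝓘(ℝ, E × ℝ)) ∞
      (fun c ↦ Bundle.TotalSpace.mk' (E × ℝ) c (X c)) c₀) :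
    ContMDiffAt (𝓘(ℝ, E).prod 𝓘(ℝ, ℝ)) ((𝓘(ℝ, E).prod 𝓘(ℝ, ℝ)).prod 𝓘(ℝ, E × ℝ)) ∞
      (fun c ↦ Bundle.TotalSpace.mk' (E × ℝ) c (A c (X c))) c₀ :=
  ContMDiffAt.clm_bundle_apply (F₁ := E × ℝ) (F₂ := E × ℝ)
    (E₁ := fun c : M × Ray ↦ TangentSpace (𝓘(ℝ, E).prod 𝓘(ℝ, ℝ)) c)
    (E₂ := fun c : M × Ray ↦ TangentSpace (𝓘(ℝ, E).prod 𝓘(ℝ, ℝ)) c) (b := id) (hA.smooth c₀) hX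

/-- The endomorphism `A` at `(x, 1)`, on the model space. -/
def endAt (A : ConeEnd E M) (x : M) : (E × ℝ) →L[ℝ] (E × ℝ) := A (x, rayOne)

theorem coneForm_slice (x : M) (u v : E × ℝ) :
    coneForm g (x, rayOne) u v = metricAt g x u.1 v.1 + u.2 * v.2 := by
  rw [coneForm_apply]
  have : ((rayOne : Ray) : ℝ) = 1 := rfl
  rw [this, one_pow, one_mul]

theorem OneForm.differentiableAt_inChart (α : OneForm E M) (x₀ : M) :
    DifferentiableAt ℝ (α.inChart x₀) (extChartAt 𝓘(ℝ, E) x₀ x₀) :=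
  ((α.contDiffOn_inChart x₀).contDiffAt ((isOpen_extChartAt_target x₀).mem_nhds
      (mem_extChartAt_target x₀))).differentiableAt (by simp)

/-- Differentiate `ḡ(v, A ∂_r)` along `u`: as `A` is parallel and `∇_u ∂_r = u` at `r = 1`, the
second factor contributes `A u`. -/
theorem IsParallelIsometry.fderiv_inChart (hD : IsLeviCivita g D) (hA : IsParallelIsometry g D A)
    {α : OneForm E M} (hα : IsAssociatedForm g A α) (x₀ : M) (u v : E) :
    fderiv ℝ (α.inChart x₀) (extChartAt 𝓘(ℝ, E) x₀ x₀) u v =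
      coneForm g (x₀, rayOne) (covCoord D (x₀, rayOne) (v, 0) (u, 0)) (endAt A x₀ (0, 1)) +
        coneForm g (x₀, rayOne) (v, 0) (endAt A x₀ (u, 0)) := by
  set c₀ : M × Ray := (x₀, rayOne) with hc₀
  let X := coordField (N := M × Ray) (𝓘(ℝ, E).prod 𝓘(ℝ, ℝ)) c₀ (v, 0)
  let Y := coordField (N := M × Ray) (𝓘(ℝ, E).prod 𝓘(ℝ, ℝ)) c₀ (0, 1)
  have hX : FieldDiffAt X c₀ := fieldDiffAt_coordField c₀ _
  have hY : FieldDiffAt Y c₀ := fieldDiffAt_coordField c₀ _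
  have hAY : FieldDiffAt (fun c ↦ A c (Y c)) c₀ :=
    (hA.contMDiffAt_apply (contMDiffAt_coordField _ c₀ (0, 1))).mdifferentiableAt (by simp)
  have hmet := hD.metric X (fun c ↦ A c (Y c)) c₀ ((u, 0) : E × ℝ) hX hAY
  have hXc : X c₀ = ((v, 0) : E × ℝ) := coordField_self _ c₀ _
  have hYc : Y c₀ = ((0, 1) : E × ℝ) := coordField_self _ c₀ _
  have hcov : D Y c₀ ((u, 0) : E × ℝ) = ((u, 0) : E × ℝ) := hD.covCoord_radial x₀ u
  have hpar : D (fun c ↦ A c (Y c)) c₀ ((u, 0) : E × ℝ) = A c₀ ((u, 0) : E × ℝ) :=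
    (hA.parallel Y c₀ _ hY).trans (congrArg (A c₀) hcov)
  refine Eq.trans ?_ (hmet.trans (congrArg₂ (fun a b : ℝ ↦ a + b)
    (congrArg (fun w : E × ℝ ↦ coneForm g c₀ (covCoord D c₀ (v, 0) (u, 0)) (endAt A x₀ w)) hYc)
    (congrArg₂ (fun a b : E × ℝ ↦ coneForm g c₀ a b) hXc hpar)))
  obtain ⟨L, hL, hLu⟩ := hasFDerivAt_comp_sliceChart x₀ (sliceChart_base x₀)
    (mdifferentiableAt_coneInner g hX hAY)
  have hαd : DifferentiableAt ℝ (α.inChart x₀) (extChartAt 𝓘(ℝ, E) x₀ x₀) :=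
    α.differentiableAt_inChart x₀
  -- Along the slice `r = 1` the function differentiated on the cone is the chart expression of `α`,
  -- because the coordinate field `Y` is `∂_r` near `c₀`.
  have hev : (fun y ↦ α.inChart x₀ y v) =ᶠ[𝓝 (extChartAt 𝓘(ℝ, E) x₀ x₀)]
      (fun c ↦ coneInner g c (X c) (A c (Y c))) ∘ sliceChart x₀ := by
    have ht : Filter.Tendsto (sliceChart x₀) (𝓝 (extChartAt 𝓘(ℝ, E) x₀ x₀)) (𝓝 c₀) := by
      have := (hasMFDerivAt_sliceChart (E := E) x₀).continuousAt
      rwa [ContinuousAt, sliceChart_base] at this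
    filter_upwards [ht.eventually (coordField_radial_eventuallyEq (E := E) c₀),
      (isOpen_extChartAt_target x₀).mem_nhds (mem_extChartAt_target x₀)] with y hy hyt
    have hs : (extChartAt 𝓘(ℝ, E) x₀).symm y ∈ (chartAt E x₀).source := by
      rw [← extChartAt_source 𝓘(ℝ, E)]
      exact (extChartAt 𝓘(ℝ, E) x₀).map_target hyt
    rw [Function.comp_apply]
    have h1 : Y (sliceChart x₀ y) = ((0, 1) : E × ℝ) := hy
    have h2 : X (sliceChart x₀ y) =
        ((mfderiv 𝓘(ℝ, E) 𝓘(ℝ, E) (extChartAt 𝓘(ℝ, E) x₀).symm y v, 0) : E × ℝ) := by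
      refine (coordField_cone c₀ (sliceChart x₀ y) (v, 0) hs).trans ?_
      refine Prod.ext ?_ rfl
      refine (coordField_eq_mfderiv 𝓘(ℝ, E) x₀ v hs).trans ?_
      rw [(extChartAt 𝓘(ℝ, E) x₀).right_inv hyt]
    rw [h1, h2]
    exact hα _ _
  have h3 := hL.congr_of_eventuallyEq hev
  have h4 : HasFDerivAt (fun y ↦ α.inChart x₀ y v) _ (extChartAt 𝓘(ℝ, E) x₀ x₀) :=
    hαd.hasFDerivAt.clm_apply (hasFDerivAt_const v _)
  have h5 := congrArg (fun L : E →L[ℝ] ℝ ↦ L u) (h4.unique h3)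
  simp only [hLu] at h5
  rw [← h5]
  simp

/-- An orthogonal operator with square `-1` is skew. -/
theorem IsParallelIsometry.endAt_skew (hA : IsParallelIsometry g D A)
    (hA2 : ∀ c u, A c (A c u) = -u) (x : M) (u v : E × ℝ) :
    coneForm g (x, rayOne) (endAt A x u) v = -coneForm g (x, rayOne) u (endAt A x v) := by
  have h1 : coneForm g (x, rayOne) (endAt A x u) (endAt A x (endAt A x v)) =
      coneForm g (x, rayOne) u (endAt A x v) := hA.orthogonal (x, rayOne) u (A (x, rayOne) v)
  have h2 : endAt A x (endAt A x v) = -v := hA2 (x, rayOne) v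
  rw [h2, map_neg] at h1
  linarith

/-- `dα_A (u, v) = 2 ḡ(A u, v)`. -/
theorem IsParallelIsometry.d_eq (hD : IsLeviCivita g D) (hA : IsParallelIsometry g D A)
    (hA2 : ∀ c u, A c (A c u) = -u) {α : OneForm E M} (hα : IsAssociatedForm g A α) (x : M)
    (u v : E) : α.d x u v = 2 * coneForm g (x, rayOne) (endAt A x (u, 0)) (v, 0) := by
  have h1 := hA.fderiv_inChart hD hα x u v
  have h2 := hA.fderiv_inChart hD hα x v u
  -- The Christoffel terms are symmetric in `u` and `v` and cancel in the exterior derivative.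
  rw [hD.covCoord_comm (x, rayOne) (v, 0) (u, 0)] at h1
  have h3 := hA.endAt_skew hA2 x (u, 0) (v, 0)
  have h4 := coneForm_symm g (x, rayOne) (v, 0) (endAt A x (u, 0))
  have h5 : α.d x u v = fderiv ℝ (α.inChart x) (extChartAt 𝓘(ℝ, E) x x) u v -
    fderiv ℝ (α.inChart x) (extChartAt 𝓘(ℝ, E) x x) v u := rfl
  rw [h5, h1, h2]
  linarith

theorem contMDiff_slice :
    ContMDiff 𝓘(ℝ, E) (𝓘(ℝ, E).prod 𝓘(ℝ, ℝ)) ∞ (fun x : M ↦ (x, rayOne)) :=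
  contMDiff_id.prodMk contMDiff_const

/-- The vector field `A ∂_r` on `M = M × {1}`. -/
def reebField (A : ConeEnd E M) (x : M) : TangentSpace 𝓘(ℝ, E) x := (endAt A x (0, 1)).1

theorem IsParallelIsometry.contMDiff_reebField (hA : IsParallelIsometry g D A) :
    ContMDiff 𝓘(ℝ, E) (𝓘(ℝ, E).prod 𝓘(ℝ, E)) ∞
      (fun x ↦ Bundle.TotalSpace.mk' E x (reebField A x)) := by
  have h1 : ContMDiff (𝓘(ℝ, E).prod 𝓘(ℝ, ℝ)) ((𝓘(ℝ, E).prod 𝓘(ℝ, ℝ)).prod 𝓘(ℝ, E × ℝ)) ∞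
      (fun c ↦ (⟨c, A c (radial c)⟩ : TangentBundle (𝓘(ℝ, E).prod 𝓘(ℝ, ℝ)) (M × Ray))) :=
    fun c ↦ hA.contMDiffAt_apply (contMDiff_radial c)
  exact contMDiff_tangent_fst.comp (h1.comp contMDiff_slice)

/-- The form `α_A`. -/
def assocForm (hA : IsParallelIsometry g D A) : OneForm E M :=
  ⟨fun x ↦ g.inner x (reebField A x),
    ContMDiff.clm_bundle_apply (F₁ := E) (F₂ := E →L[ℝ] ℝ)
      (E₁ := fun x : M ↦ TangentSpace 𝓘(ℝ, E) x)
      (E₂ := fun x : M ↦ TangentSpace 𝓘(ℝ, E) x →L[ℝ] ℝ) (b := id) g.contMDiff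
      hA.contMDiff_reebField⟩

theorem assocForm_apply (hA : IsParallelIsometry g D A) (x : M) (v : E) :
    (assocForm hA).1 x v = coneForm g (x, rayOne) (endAt A x (0, 1)) (v, 0) := by
  rw [coneForm_slice, mul_zero, add_zero]
  rfl

theorem isAssociatedForm_assocForm (hA : IsParallelIsometry g D A) :
    IsAssociatedForm g A (assocForm hA) := fun x v ↦
  (assocForm_apply hA x v).trans (coneForm_symm g (x, rayOne) _ _)

/-- The part of `A` tangent to `M = M × {1}`. -/
def sliceEnd (A : ConeEnd E M) (x : M) : E →L[ℝ] E :=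
  (ContinuousLinearMap.fst ℝ E ℝ).comp ((endAt A x).comp (ContinuousLinearMap.inl ℝ E ℝ))

/-- The endomorphism field `sliceEnd A` of `TM`. -/
def sliceEndField (A : ConeEnd E M) (x : M) :
    TangentSpace 𝓘(ℝ, E) x →L[ℝ] TangentSpace 𝓘(ℝ, E) x := sliceEnd (E := E) A x

theorem IsParallelIsometry.contMDiff_sliceEndField (hA : IsParallelIsometry g D A) :
    ContMDiff 𝓘(ℝ, E) (𝓘(ℝ, E).prod 𝓘(ℝ, E →L[ℝ] E)) ∞
      (fun x ↦ Bundle.TotalSpace.mk' (E →L[ℝ] E) x (sliceEndField A x)) := by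
  intro x₀
  refine contMDiffAt_endField 𝓘(ℝ, E) (sliceEndField A) x₀ fun U ↦ ?_
  have h1 := hA.contMDiffAt_apply
    (contMDiffAt_coordField (𝓘(ℝ, E).prod 𝓘(ℝ, ℝ)) ((x₀, rayOne) : M × Ray) (U, 0))
  have h2 := contMDiff_tangent_fst.contMDiffAt.comp x₀ (ContMDiffAt.comp x₀ h1
    (contMDiff_slice (E := E) x₀))
  refine h2.congr_of_eventuallyEq ?_
  filter_upwards [(chartAt E x₀).open_source.mem_nhds (mem_chart_source E x₀)] with x hx
  have h3 := coordField_cone (x₀, rayOne) (x, rayOne) (U, 0) hx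
  exact congrArg (fun w : E × ℝ ↦ (⟨x, (endAt A x w).1⟩ : TangentBundle 𝓘(ℝ, E) M)) h3.symm

/-- The endomorphism field `sliceEnd A`, as a smooth field. -/
def assocEnd (hA : IsParallelIsometry g D A) : EndField E M :=
  ⟨sliceEndField A, hA.contMDiff_sliceEndField⟩

end AssociatedForm

/-! ### Linear combinations of forms and of endomorphism fields -/

section LinComb

variable {E : Type*} [NormedAddCommGroup E] [InnerProductSpace ℝ E] [FiniteDimensional ℝ E]
variable {M : Type*} [TopologicalSpace M] [ChartedSpace E M] [IsManifold 𝓘(ℝ, E) ∞ M]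

/-- The form `z₀ α₀ + z₁ α₁ + z₂ α₂`. -/
def OneForm.linComb (z : EuclideanSpace ℝ (Fin 3)) (α₀ α₁ α₂ : OneForm E M) : OneForm E M :=
  ⟨fun x ↦ z 0 • α₀.1 x + z 1 • α₁.1 x + z 2 • α₂.1 x, fun x ↦
    ((ContMDiffAt.const_smul_section (a := z 0) (α₀.2 x)).add_section
      (ContMDiffAt.const_smul_section (a := z 1) (α₁.2 x))).add_section
      (ContMDiffAt.const_smul_section (a := z 2) (α₂.2 x))⟩

/-- The endomorphism field `z₀ A₀ + z₁ A₁ + z₂ A₂`. -/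
def EndField.linComb (z : EuclideanSpace ℝ (Fin 3)) (A₀ A₁ A₂ : EndField E M) : EndField E M :=
  ⟨fun x ↦ z 0 • A₀.1 x + z 1 • A₁.1 x + z 2 • A₂.1 x, fun x ↦
    ((ContMDiffAt.const_smul_section (a := z 0) (A₀.2 x)).add_section
      (ContMDiffAt.const_smul_section (a := z 1) (A₁.2 x))).add_section
      (ContMDiffAt.const_smul_section (a := z 2) (A₂.2 x))⟩

theorem OneForm.inChart_linComb (z : EuclideanSpace ℝ (Fin 3)) (α₀ α₁ α₂ : OneForm E M) (x₀ : M) :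
    (OneForm.linComb z α₀ α₁ α₂).inChart x₀ =
      z 0 • α₀.inChart x₀ + z 1 • α₁.inChart x₀ + z 2 • α₂.inChart x₀ := by
  funext y
  refine ContinuousLinearMap.ext fun u ↦ ?_
  rfl

theorem EndField.inChart_linComb (z : EuclideanSpace ℝ (Fin 3)) (A₀ A₁ A₂ : EndField E M)
    (x₀ : M) : (EndField.linComb z A₀ A₁ A₂).inChart x₀ =
      z 0 • A₀.inChart x₀ + z 1 • A₁.inChart x₀ + z 2 • A₂.inChart x₀ := by
  funext y
  refine ContinuousLinearMap.ext fun u ↦ ?_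
  have key : ∀ (L : E →L[ℝ] E) (a b c : E), L (z 0 • a + z 1 • b + z 2 • c) =
      z 0 • L a + z 1 • L b + z 2 • L c := fun L a b c ↦ by simp
  exact key _ _ _ _

theorem OneForm.d_linComb (z : EuclideanSpace ℝ (Fin 3)) (α₀ α₁ α₂ : OneForm E M) (x : M)
    (u v : E) : (OneForm.linComb z α₀ α₁ α₂).d x u v =
      z 0 * α₀.d x u v + z 1 * α₁.d x u v + z 2 * α₂.d x u v := by
  have h : fderiv ℝ ((OneForm.linComb z α₀ α₁ α₂).inChart x) (extChartAt 𝓘(ℝ, E) x x) =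
      z 0 • fderiv ℝ (α₀.inChart x) (extChartAt 𝓘(ℝ, E) x x) +
      z 1 • fderiv ℝ (α₁.inChart x) (extChartAt 𝓘(ℝ, E) x x) +
      z 2 • fderiv ℝ (α₂.inChart x) (extChartAt 𝓘(ℝ, E) x x) := by
    rw [OneForm.inChart_linComb]
    exact ((((α₀.differentiableAt_inChart x).hasFDerivAt.const_smul (z 0)).add
      ((α₁.differentiableAt_inChart x).hasFDerivAt.const_smul (z 1))).add
      ((α₂.differentiableAt_inChart x).hasFDerivAt.const_smul (z 2))).fderiv
  simp only [OneForm.d]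
  rw [h]
  simp only [add_apply, smul_apply, smul_eq_mul]
  ring

end LinComb

/-! ### The sphere of contact forms and its almost complex structures -/

section Sphere

variable {E : Type*} [NormedAddCommGroup E] [InnerProductSpace ℝ E] [FiniteDimensional ℝ E]
variable {M : Type*} [TopologicalSpace M] [ChartedSpace E M] [IsManifold 𝓘(ℝ, E) ∞ M]
variable {g : RMetric E M} {D : CovariantDerivative (𝓘(ℝ, E).prod 𝓘(ℝ, ℝ)) (E × ℝ)
      (fun c : M × Ray ↦ TangentSpace (𝓘(ℝ, E).prod 𝓘(ℝ, ℝ)) c)} {S : ThreeSasakian g}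

/-- The complex structure `z₀ I + z₁ J + z₂ K` of the cone at `(x, 1)`. -/
def ThreeSasakian.quatAt (S : ThreeSasakian g) (x : M) (z : EuclideanSpace ℝ (Fin 3)) :
    (E × ℝ) →L[ℝ] (E × ℝ) :=
  quatSphere (endAt S.jI x) (endAt S.jJ x) (endAt S.jK x) z

theorem ThreeSasakian.isQuaternionic (S : ThreeSasakian g) (x : M) :
    IsQuaternionic (endAt S.jI x) (endAt S.jJ x) (endAt S.jK x) where
  jI_sq := ContinuousLinearMap.ext fun u ↦ S.jI_sq (x, rayOne) u
  jJ_sq := ContinuousLinearMap.ext fun u ↦ S.jJ_sq (x, rayOne) u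
  jK_sq := ContinuousLinearMap.ext fun u ↦ S.jK_sq (x, rayOne) u
  jI_jJ := ContinuousLinearMap.ext fun u ↦ S.jI_jJ (x, rayOne) u

theorem ThreeSasakian.quatAt_sq (S : ThreeSasakian g) (x : M) (z : S2) (u : E × ℝ) :
    S.quatAt x z (S.quatAt x z u) = -u :=
  DFunLike.congr_fun ((S.isQuaternionic x).quatSphere_mul_self z) u

theorem ThreeSasakian.quatAt_apply (S : ThreeSasakian g) (x : M) (z : EuclideanSpace ℝ (Fin 3))
    (u : E × ℝ) : S.quatAt x z u =
      z 0 • endAt S.jI x u + z 1 • endAt S.jJ x u + z 2 • endAt S.jK x u := rfl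

/-- The complex structures of the cone are parallel isometries for the connection `D`. -/
structure ThreeSasakian.IsHyperkahler (S : ThreeSasakian g)
    (D : CovariantDerivative (𝓘(ℝ, E).prod 𝓘(ℝ, ℝ)) (E × ℝ)
      (fun c : M × Ray ↦ TangentSpace (𝓘(ℝ, E).prod 𝓘(ℝ, ℝ)) c)) : Prop where
  leviCivita : IsLeviCivita g D
  jI : IsParallelIsometry g D S.jI
  jJ : IsParallelIsometry g D S.jJ
  jK : IsParallelIsometry g D S.jK

namespace ThreeSasakian.IsHyperkahler

theorem quatAt_skew (h : S.IsHyperkahler D) (x : M) (z : EuclideanSpace ℝ (Fin 3))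
    (u v : E × ℝ) :
    coneForm g (x, rayOne) (S.quatAt x z u) v = -coneForm g (x, rayOne) u (S.quatAt x z v) := by
  simp only [quatAt_apply, map_add, map_smul, LinearMap.add_apply,
    LinearMap.smul_apply, h.jI.endAt_skew S.jI_sq, h.jJ.endAt_skew S.jJ_sq,
    h.jK.endAt_skew S.jK_sq, smul_eq_mul]
  ring

theorem quatAt_orthogonal (h : S.IsHyperkahler D) (x : M) (z : S2) (u v : E × ℝ) :
    coneForm g (x, rayOne) (S.quatAt x z u) (S.quatAt x z v) = coneForm g (x, rayOne) u v := by
  rw [h.quatAt_skew, quatAt_sq, map_neg, neg_neg]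

/-- The radial component is the pairing with `∂_r`, moved over by skewness. For `u` tangent to `M`
it is `-α_z(u)`, so `ker α_z` consists of the tangent vectors whose image is again tangent. -/
theorem quatAt_snd (h : S.IsHyperkahler D) (x : M) (z : EuclideanSpace ℝ (Fin 3)) (u : E × ℝ) :
    (S.quatAt x z u).2 = -coneForm g (x, rayOne) u (S.quatAt x z (0, 1)) := by
  rw [← h.quatAt_skew, coneForm_slice]
  simp

theorem quatAt_radial_snd (h : S.IsHyperkahler D) (x : M) (z : EuclideanSpace ℝ (Fin 3)) :
    (S.quatAt x z (0, 1)).2 = 0 := by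
  have h1 := h.quatAt_snd x z (0, 1)
  rw [coneForm_slice] at h1
  simp at h1
  linarith

/-- The form `z₀ α_I + z₁ α_J + z₂ α_K`. -/
def form (h : S.IsHyperkahler D) (z : EuclideanSpace ℝ (Fin 3)) : OneForm E M :=
  OneForm.linComb z (assocForm h.jI) (assocForm h.jJ) (assocForm h.jK)

/-- The part of `z₀ I + z₁ J + z₂ K` tangent to `M`. -/
def endField (h : S.IsHyperkahler D) (z : EuclideanSpace ℝ (Fin 3)) : EndField E M :=
  EndField.linComb z (assocEnd h.jI) (assocEnd h.jJ) (assocEnd h.jK)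

theorem form_apply (h : S.IsHyperkahler D) (z : EuclideanSpace ℝ (Fin 3)) (x : M) (v : E) :
    (h.form z).1 x v = coneForm g (x, rayOne) (S.quatAt x z (0, 1)) (v, 0) := by
  have h1 : (h.form z).1 x v = z 0 * (assocForm h.jI).1 x v + z 1 * (assocForm h.jJ).1 x v +
    z 2 * (assocForm h.jK).1 x v := rfl
  rw [h1, assocForm_apply, assocForm_apply, assocForm_apply]
  simp only [quatAt_apply, map_add, map_smul, LinearMap.add_apply, LinearMap.smul_apply,
    smul_eq_mul]

theorem form_d (h : S.IsHyperkahler D) (z : EuclideanSpace ℝ (Fin 3)) (x : M) (u v : E) :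
    (h.form z).d x u v = 2 * coneForm g (x, rayOne) (S.quatAt x z (u, 0)) (v, 0) := by
  rw [form, OneForm.d_linComb,
    h.jI.d_eq h.leviCivita S.jI_sq (isAssociatedForm_assocForm h.jI),
    h.jJ.d_eq h.leviCivita S.jJ_sq (isAssociatedForm_assocForm h.jJ),
    h.jK.d_eq h.leviCivita S.jK_sq (isAssociatedForm_assocForm h.jK)]
  simp only [quatAt_apply, map_add, map_smul, LinearMap.add_apply, LinearMap.smul_apply,
    smul_eq_mul]
  ring

theorem endField_apply (h : S.IsHyperkahler D) (z : EuclideanSpace ℝ (Fin 3)) (x : M) (u : E) :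
    (h.endField z).1 x u = (S.quatAt x z (u, 0)).1 := rfl

theorem quatAt_of_form_eq_zero (h : S.IsHyperkahler D) {z : EuclideanSpace ℝ (Fin 3)} {x : M}
    {u : E} (hu : (h.form z).1 x u = 0) :
    S.quatAt x z (u, 0) = ((h.endField z).1 x u, 0) := by
  refine Prod.ext rfl ?_
  rw [h.quatAt_snd, coneForm_symm]
  exact neg_eq_zero.2 ((h.form_apply z x u).symm.trans hu)

theorem form_map_ker (h : S.IsHyperkahler D) (z : S2) {x : M} {u : E}
    (hu : (h.form z).1 x u = 0) : (h.form z).1 x ((h.endField z).1 x u) = 0 := by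
  refine (h.form_apply z x _).trans ?_
  refine (congrArg (coneForm g (x, rayOne) (S.quatAt x z (0, 1)))
    (h.quatAt_of_form_eq_zero hu).symm).trans ?_
  rw [h.quatAt_orthogonal, coneForm_slice]
  simp

theorem endField_sq (h : S.IsHyperkahler D) (z : S2) {x : M} {u : E}
    (hu : (h.form z).1 x u = 0) : (h.endField z).1 x ((h.endField z).1 x u) = -u := by
  refine (congrArg (fun w ↦ (S.quatAt x z w).1) (h.quatAt_of_form_eq_zero hu).symm).trans ?_
  simp only [quatAt_sq]
  rfl

/-- Orthogonality of `q = q_z` turns `2 ḡ(q v, q u)` into a multiple of the metric. Non-degeneracy,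
positivity and invariance of `dα_z` on the kernel all follow from this identity. -/
theorem form_d_self_endField (h : S.IsHyperkahler D) (z : S2) {x : M} {u : E} (v : E)
    (hu : (h.form z).1 x u = 0) :
    (h.form z).d x v ((h.endField z).1 x u) = 2 * coneForm g (x, rayOne) (v, 0) (u, 0) := by
  refine (h.form_d z x v _).trans ?_
  refine (congrArg (fun w ↦ 2 * coneForm g (x, rayOne) (S.quatAt x z (v, 0)) w)
    (h.quatAt_of_form_eq_zero hu).symm).trans ?_
  rw [h.quatAt_orthogonal]

theorem form_reeb (h : S.IsHyperkahler D) (z w : EuclideanSpace ℝ (Fin 3)) (x : M) :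
    (h.form z).1 x (S.quatAt x w (0, 1)).1 =
      coneForm g (x, rayOne) (S.quatAt x z (0, 1)) (S.quatAt x w (0, 1)) := by
  refine (h.form_apply z x _).trans ?_
  congr 1
  exact Prod.ext rfl (h.quatAt_radial_snd x w).symm

/-- The vector `q_z ∂_r` shows that `α_z` does not vanish, and testing `dα_z(u, ·)` on `q_z u` gives
`2 |u|²`. -/
theorem isContact_form (h : S.IsHyperkahler D) (z : S2) : (h.form z).IsContact := by
  refine fun x ↦ ⟨fun h0 ↦ ?_, fun u hu hd ↦ ?_⟩
  · have h1 := h.form_reeb z z x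
    rw [h.quatAt_orthogonal, coneForm_slice] at h1
    have h2 : (h.form z).1 x (S.quatAt x z (0, 1)).1 = 0 :=
      congrArg (fun a : E →L[ℝ] ℝ ↦ a (S.quatAt x z (0, 1)).1) h0
    rw [h2] at h1
    simp at h1
  · by_contra hne
    have h1 := hd _ (h.form_map_ker z hu)
    have h2 := (h.form_d_self_endField z u hu).symm.trans h1
    have h3 := coneForm_pos g (x, rayOne) (u := ((u, 0) : E × ℝ))
      (fun h0 ↦ hne (congrArg Prod.fst h0))
    linarith

/-- The contact form `z₀ α_I + z₁ α_J + z₂ α_K`. -/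
def contactForm (h : S.IsHyperkahler D) (z : S2) : ContactForm E M := ⟨h.form z, h.isContact_form z⟩

/-- The contact form `contactForm h z` with its standard almost complex structure. -/
def compatiblePair (h : S.IsHyperkahler D) (z : S2) : CompatiblePair E M where
  α := h.contactForm z
  A := h.endField z
  map_ker _ _ hu := h.form_map_ker z hu
  sq _ _ hu := h.endField_sq z hu
  invariant x u v hu hv := by
    refine (h.form_d_self_endField z _ hv).trans ?_
    refine Eq.trans ?_ (h.form_d z x u v).symm
    congr 2
    exact congrArg (coneForm g (x, rayOne)) (h.quatAt_of_form_eq_zero hu).symm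
  pos x u hu hne := by
    refine lt_of_lt_of_eq ?_ (h.form_d_self_endField z u hu).symm
    have := coneForm_pos g (x, rayOne) (u := ((u, 0) : E × ℝ))
      (fun h0 ↦ hne (congrArg Prod.fst h0))
    linarith

end ThreeSasakian.IsHyperkahler

end Sphere

/-! ### Cartan's formula for fields in the kernel of a form -/

section LieDerivative

variable {E : Type*} [NormedAddCommGroup E] [InnerProductSpace ℝ E] [FiniteDimensional ℝ E]
variable {M : Type*} [TopologicalSpace M] [ChartedSpace E M] [IsManifold 𝓘(ℝ, E) ∞ M]

/-- Cartan's formula `L_V a = da(V, ·)` for a form on a vector space that vanishes on `V`, where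
`V` generates `Ψ`. -/
theorem hasDerivAt_pullback_of_contDiffAt {a : E → E →L[ℝ] ℝ} {Ψ : ℝ × E → E} {y₀ : E}
    (ha : DifferentiableAt ℝ a y₀) (hΨ : ContDiffAt ℝ 2 Ψ (0, y₀))
    (h0 : ∀ᶠ y in 𝓝 y₀, Ψ (0, y) = y)
    (hvan : ∀ᶠ y in 𝓝 y₀, a y (fderiv ℝ Ψ (0, y) (1, 0)) = 0) (v : E) :
    HasDerivAt (fun t : ℝ ↦ a (Ψ (t, y₀)) (fderiv ℝ Ψ (t, y₀) (0, v)))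
      (fderiv ℝ a y₀ (fderiv ℝ Ψ (0, y₀) (1, 0)) v -
        fderiv ℝ a y₀ v (fderiv ℝ Ψ (0, y₀) (1, 0))) 0 := by
  have hΨ1 : HasFDerivAt Ψ (fderiv ℝ Ψ (0, y₀)) (0, y₀) :=
    (hΨ.differentiableAt (by simp)).hasFDerivAt
  have hG : HasFDerivAt (fderiv ℝ Ψ) (fderiv ℝ (fderiv ℝ Ψ) (0, y₀)) (0, y₀) :=
    ((hΨ.fderiv_right (m := 1) le_rfl).differentiableAt (by simp)).hasFDerivAt
  have hsymm := hΨ.isSymmSndFDerivAt (by simp) (1, 0) (0, v)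
  have hpt : HasDerivAt (fun t : ℝ ↦ (t, y₀)) (1, 0) 0 :=
    (hasDerivAt_id (0 : ℝ)).prodMk (hasDerivAt_const _ _)
  have hpy : HasFDerivAt (fun y : E ↦ ((0 : ℝ), y)) (ContinuousLinearMap.inr ℝ ℝ E) y₀ :=
    hasFDerivAt_prodMk_right (0 : ℝ) y₀
  have hid : fderiv ℝ Ψ (0, y₀) (0, v) = v := by
    have h1 : HasFDerivAt (fun y ↦ Ψ (0, y)) _ y₀ := hΨ1.comp y₀ hpy
    have h2 := h1.unique ((hasFDerivAt_id y₀).congr_of_eventuallyEq h0)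
    simpa using congrArg (fun L : E →L[ℝ] E ↦ L v) h2
  -- With `V = ∂_t Ψ`, symmetry of the second derivative makes `a(∂_v V)` appear in the derivative
  -- of the pulled-back form. Differentiating `a(V) = 0` along `v` turns this term into `-(∂_v
  -- a)(V)`.
  have hvan' : fderiv ℝ a y₀ v (fderiv ℝ Ψ (0, y₀) (1, 0)) +
      a y₀ (fderiv ℝ (fderiv ℝ Ψ) (0, y₀) (0, v) (1, 0)) = 0 := by
    have h1 : HasFDerivAt (fun y ↦ fderiv ℝ Ψ (0, y)) _ y₀ :=
      HasFDerivAt.comp (g := fderiv ℝ Ψ) y₀ hG hpy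
    have h2 := ha.hasFDerivAt.clm_apply
      (h1.clm_apply (hasFDerivAt_const ((1 : ℝ), (0 : E)) y₀))
    have h3 := h2.unique ((hasFDerivAt_const (0 : ℝ) y₀).congr_of_eventuallyEq hvan)
    have h4 := congrArg (fun L : E →L[ℝ] ℝ ↦ L v) h3
    simp at h4
    linarith
  have hy : Ψ (0, y₀) = y₀ := h0.self_of_nhds
  have hc : HasDerivAt (fun t : ℝ ↦ Ψ (t, y₀)) (fderiv ℝ Ψ (0, y₀) (1, 0)) 0 :=
    hΨ1.comp_hasDerivAt (0 : ℝ) hpt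
  have hG' : HasDerivAt (fun t : ℝ ↦ fderiv ℝ Ψ (t, y₀))
      (fderiv ℝ (fderiv ℝ Ψ) (0, y₀) (1, 0)) 0 :=
    HasFDerivAt.comp_hasDerivAt (l := fderiv ℝ Ψ) (0 : ℝ) hG hpt
  have ha' : HasDerivAt (fun t : ℝ ↦ a (Ψ (t, y₀)))
      (fderiv ℝ a y₀ (fderiv ℝ Ψ (0, y₀) (1, 0))) 0 := by
    have : HasFDerivAt a (fderiv ℝ a y₀) (Ψ (0, y₀)) := by rw [hy]; exact ha.hasFDerivAt
    exact this.comp_hasDerivAt (0 : ℝ) hc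
  have hv : HasDerivAt (fun t : ℝ ↦ fderiv ℝ Ψ (t, y₀) (0, v))
      (fderiv ℝ (fderiv ℝ Ψ) (0, y₀) (1, 0) (0, v)) 0 := by
    have := hG'.clm_apply (hasDerivAt_const (0 : ℝ) ((0 : ℝ), v))
    simpa using this
  refine (ha'.clm_apply hv).congr_deriv ?_
  rw [hid, hsymm, hy]
  linarith

theorem OneForm.inChart_mfderiv (α : OneForm E M) (x₀ : M) {z : M}
    (hz : z ∈ (extChartAt 𝓘(ℝ, E) x₀).source) (w : TangentSpace 𝓘(ℝ, E) z) :
    α.inChart x₀ (extChartAt 𝓘(ℝ, E) x₀ z)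
      (mfderiv 𝓘(ℝ, E) 𝓘(ℝ, E) (extChartAt 𝓘(ℝ, E) x₀) z w) = α.1 z w := by
  obtain ⟨y, hy, rfl⟩ : ∃ y ∈ (extChartAt 𝓘(ℝ, E) x₀).target,
      (extChartAt 𝓘(ℝ, E) x₀).symm y = z :=
    ⟨_, (extChartAt 𝓘(ℝ, E) x₀).map_source hz, (extChartAt 𝓘(ℝ, E) x₀).left_inv hz⟩
  rw [(extChartAt 𝓘(ℝ, E) x₀).right_inv hy]
  exact congrArg (α.1 ((extChartAt 𝓘(ℝ, E) x₀).symm y)) (mfderiv_symm_mfderiv_extChartAt x₀ hy w)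

theorem contDiffAt_flow_inChart {φ : ℝ → M → M}
    (hφ : ContMDiff (𝓘(ℝ, ℝ).prod 𝓘(ℝ, E)) 𝓘(ℝ, E) ∞ (fun p : ℝ × M ↦ φ p.1 p.2))
    (h0 : ∀ x, φ 0 x = x) (x : M) :
    ContDiffAt ℝ ∞ (fun q : ℝ × E ↦ extChartAt 𝓘(ℝ, E) x (φ q.1 ((extChartAt 𝓘(ℝ, E) x).symm q.2)))
      (0, extChartAt 𝓘(ℝ, E) x x) := by
  set y₀ := extChartAt 𝓘(ℝ, E) x x with hy₀
  have ht : IsOpen (extChartAt 𝓘(ℝ, E) x).target := isOpen_extChartAt_target x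
  have hyt : y₀ ∈ (extChartAt 𝓘(ℝ, E) x).target := mem_extChartAt_target x
  have h1 : ContMDiffAt (𝓘(ℝ, ℝ).prod 𝓘(ℝ, E)) (𝓘(ℝ, ℝ).prod 𝓘(ℝ, E)) ∞
      (fun q : ℝ × E ↦ (q.1, (extChartAt 𝓘(ℝ, E) x).symm q.2)) (0, y₀) :=
    contMDiffAt_fst.prodMk (ContMDiffAt.comp (x := ((0 : ℝ), y₀))
      ((contMDiffOn_chart_symm (E := E) x).contMDiffAt (ht.mem_nhds hyt)) contMDiffAt_snd)
  have h2 : ContMDiffAt (𝓘(ℝ, ℝ).prod 𝓘(ℝ, E)) 𝓘(ℝ, E) ∞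
      (fun q : ℝ × E ↦ φ q.1 ((extChartAt 𝓘(ℝ, E) x).symm q.2)) (0, y₀) :=
    ContMDiffAt.comp (x := ((0 : ℝ), y₀)) (hφ _) h1
  have h3 : ContMDiffAt (𝓘(ℝ, ℝ).prod 𝓘(ℝ, E)) 𝓘(ℝ, E) ∞
      (fun q : ℝ × E ↦ extChartAt 𝓘(ℝ, E) x (φ q.1 ((extChartAt 𝓘(ℝ, E) x).symm q.2)))
      (0, y₀) := by
    refine ContMDiffAt.comp (x := ((0 : ℝ), y₀)) ?_ h2
    dsimp only
    rw [h0, hy₀, (extChartAt 𝓘(ℝ, E) x).left_inv (mem_extChartAt_source x)]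
    exact contMDiffAt_extChartAt
  rw [← modelWithCornersSelf_prod, chartedSpaceSelf_prod] at h3
  exact h3.contDiffAt

/-- Cartan's formula `L_V α = dα(V, ·)` for a form `α` that vanishes on the vector field `V`, where
`φ` is the flow of `V`. -/
theorem OneForm.hasDerivAt_pullback_zero (α : OneForm E M) {V : ∀ x : M, TangentSpace 𝓘(ℝ, E) x}
    {φ : ℝ → M → M}
    (hφ : ContMDiff (𝓘(ℝ, ℝ).prod 𝓘(ℝ, E)) 𝓘(ℝ, E) ∞ (fun p : ℝ × M ↦ φ p.1 p.2))
    (h0 : ∀ x, φ 0 x = x) (hV : ∀ x, IsMIntegralCurve (fun t ↦ φ t x) V)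
    (hα : ∀ x, α.1 x (V x) = 0) (x : M) (v : TangentSpace 𝓘(ℝ, E) x) :
    HasDerivAt (fun t ↦ α.1 (φ t x) (mfderiv 𝓘(ℝ, E) 𝓘(ℝ, E) (φ t) x v)) (α.d x (V x) v) 0 := by
  set y₀ := extChartAt 𝓘(ℝ, E) x x with hy₀
  set Ψ : ℝ × E → E :=
    fun q ↦ extChartAt 𝓘(ℝ, E) x (φ q.1 ((extChartAt 𝓘(ℝ, E) x).symm q.2)) with hΨdef
  have ht : IsOpen (extChartAt 𝓘(ℝ, E) x).target := isOpen_extChartAt_target x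
  have hyt : y₀ ∈ (extChartAt 𝓘(ℝ, E) x).target := mem_extChartAt_target x
  have hΨ : ContDiffAt ℝ ∞ Ψ (0, y₀) := contDiffAt_flow_inChart hφ h0 x
  have hΨd : ∀ᶠ q in 𝓝 ((0 : ℝ), y₀), DifferentiableAt ℝ Ψ q := by
    filter_upwards [(hΨ.of_le (m := 1) (by decide)).eventually (by simp)] with q hq
    exact hq.differentiableAt (by simp)
  have hΨ0 : ∀ y ∈ (extChartAt 𝓘(ℝ, E) x).target, Ψ (0, y) = y := fun y hy ↦ by
    simp only [hΨdef, h0]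
    exact (extChartAt 𝓘(ℝ, E) x).right_inv hy
  have hty : ∀ᶠ y in 𝓝 y₀, y ∈ (extChartAt 𝓘(ℝ, E) x).target := ht.mem_nhds hyt
  have hch : ∀ z ∈ (extChartAt 𝓘(ℝ, E) x).source,
      MDifferentiableAt 𝓘(ℝ, E) 𝓘(ℝ, E) (extChartAt 𝓘(ℝ, E) x) z := fun z hz ↦
    ((contMDiffOn_chart (E := E) x).contMDiffAt
      ((isOpen_extChartAt_source x).mem_nhds hz)).mdifferentiableAt (by simp)
  have htime : ∀ y ∈ (extChartAt 𝓘(ℝ, E) x).target, DifferentiableAt ℝ Ψ (0, y) →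
      fderiv ℝ Ψ (0, y) (1, 0) = mfderiv 𝓘(ℝ, E) 𝓘(ℝ, E) (extChartAt 𝓘(ℝ, E) x)
        ((extChartAt 𝓘(ℝ, E) x).symm y) (V ((extChartAt 𝓘(ℝ, E) x).symm y)) := by
    intro y hy hd
    have h1 : HasDerivAt (fun t : ℝ ↦ Ψ (t, y)) (fderiv ℝ Ψ (0, y) (1, 0)) 0 :=
      HasFDerivAt.comp_hasDerivAt (l := Ψ) (f := fun t : ℝ ↦ (t, y)) (0 : ℝ) hd.hasFDerivAt
        ((hasDerivAt_id (0 : ℝ)).prodMk (hasDerivAt_const _ _))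
    have h2 := hV ((extChartAt 𝓘(ℝ, E) x).symm y) 0
    have hs := (extChartAt 𝓘(ℝ, E) x).map_target hy
    have h3 : HasMFDerivAt 𝓘(ℝ, E) 𝓘(ℝ, E) (extChartAt 𝓘(ℝ, E) x)
        (φ 0 ((extChartAt 𝓘(ℝ, E) x).symm y)) (mfderiv 𝓘(ℝ, E) 𝓘(ℝ, E) (extChartAt 𝓘(ℝ, E) x)
        (φ 0 ((extChartAt 𝓘(ℝ, E) x).symm y))) :=
      (hch _ (by rw [h0]; exact hs)).hasMFDerivAt
    have h4 := hasMFDerivAt_iff_hasFDerivAt.1 (h3.comp (0 : ℝ) h2)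
    have h5 := congrArg (fun L : ℝ →L[ℝ] E ↦ L 1) (h1.hasFDerivAt.unique h4)
    have h6 : fderiv ℝ Ψ (0, y) (1, 0) = mfderiv 𝓘(ℝ, E) 𝓘(ℝ, E) (extChartAt 𝓘(ℝ, E) x)
        (φ 0 ((extChartAt 𝓘(ℝ, E) x).symm y)) (V (φ 0 ((extChartAt 𝓘(ℝ, E) x).symm y))) := by
      refine (one_smul ℝ _).symm.trans (h5.trans ?_)
      exact congrArg (fun w : E ↦ (mfderiv 𝓘(ℝ, E) 𝓘(ℝ, E) (extChartAt 𝓘(ℝ, E) x)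
        (φ 0 ((extChartAt 𝓘(ℝ, E) x).symm y)) w : E)) (one_smul ℝ _)
    rw [h0] at h6
    exact h6
  have hpy : Filter.Tendsto (fun y : E ↦ ((0 : ℝ), y)) (𝓝 y₀) (𝓝 (0, y₀)) :=
    (Continuous.prodMk_right (0 : ℝ)).tendsto y₀
  have hpt : Filter.Tendsto (fun t : ℝ ↦ (t, y₀)) (𝓝 0) (𝓝 (0, y₀)) :=
    (Continuous.prodMk_left y₀).tendsto 0
  have hvan : ∀ᶠ y in 𝓝 y₀, α.inChart x y (fderiv ℝ Ψ (0, y) (1, 0)) = 0 := by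
    filter_upwards [hpy.eventually hΨd, hty] with y hd hy
    rw [htime y hy hd]
    refine (congrArg (α.1 ((extChartAt 𝓘(ℝ, E) x).symm y))
      (mfderiv_symm_mfderiv_extChartAt x hy _)).trans (hα _)
  have key := hasDerivAt_pullback_of_contDiffAt (α.differentiableAt_inChart x)
    (hΨ.of_le (by decide)) (hty.mono hΨ0) hvan v
  have hxs : (extChartAt 𝓘(ℝ, E) x).symm y₀ = x :=
    (extChartAt 𝓘(ℝ, E) x).left_inv (mem_extChartAt_source x)
  have hbase : fderiv ℝ Ψ (0, y₀) (1, 0) = V x := by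
    rw [htime y₀ hyt hΨd.self_of_nhds]
    refine ((congrArg (fun w : E ↦ (mfderiv 𝓘(ℝ, E) 𝓘(ℝ, E) (extChartAt 𝓘(ℝ, E) x)
      ((extChartAt 𝓘(ℝ, E) x).symm y₀) w : E)) (mfderiv_extChartAt_symm_self x _).symm).trans
      (mfderiv_extChartAt_mfderiv_symm x hyt (V ((extChartAt 𝓘(ℝ, E) x).symm y₀)))).trans ?_
    exact congrArg (fun z ↦ (V z : E)) hxs
  rw [hbase] at key
  refine key.congr_of_eventuallyEq ?_
  have hcont : Filter.Tendsto (fun t : ℝ ↦ φ t x) (𝓝 0) (𝓝 x) := by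
    have h1 : Continuous (fun t : ℝ ↦ φ t x) :=
      hφ.continuous.comp (Continuous.prodMk_left x)
    have := h1.tendsto 0
    rwa [h0] at this
  have hsrc : (extChartAt 𝓘(ℝ, E) x).source ∈ 𝓝 x :=
    (isOpen_extChartAt_source x).mem_nhds (mem_extChartAt_source x)
  filter_upwards [hpt.eventually hΨd, hcont.eventually hsrc] with t hd hs
  obtain ⟨L₁, hL₁, hL₁v⟩ : ∃ L : E →L[ℝ] E,
      HasMFDerivAt 𝓘(ℝ, E) 𝓘(ℝ, E) (φ t) ((extChartAt 𝓘(ℝ, E) x).symm y₀) L ∧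
      ∀ u : E, L u = mfderiv 𝓘(ℝ, E) 𝓘(ℝ, E) (φ t) x u := by
    rw [hxs]
    have h1 : ContMDiffAt 𝓘(ℝ, E) 𝓘(ℝ, E) ∞ (φ t) x :=
      ContMDiffAt.comp (x := x) (f := fun y ↦ (t, y)) (hφ (t, x))
        (contMDiffAt_const.prodMk contMDiffAt_id)
    exact ⟨_, (h1.mdifferentiableAt (by simp)).hasMFDerivAt, fun _ ↦ rfl⟩
  obtain ⟨L₂, hL₂, hL₂v⟩ : ∃ L : E →L[ℝ] E,
      HasMFDerivAt 𝓘(ℝ, E) 𝓘(ℝ, E) (extChartAt 𝓘(ℝ, E) x)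
        (φ t ((extChartAt 𝓘(ℝ, E) x).symm y₀)) L ∧
      ∀ u : E, L u = mfderiv 𝓘(ℝ, E) 𝓘(ℝ, E) (extChartAt 𝓘(ℝ, E) x) (φ t x) u := by
    rw [hxs]
    exact ⟨_, (hch _ hs).hasMFDerivAt, fun _ ↦ rfl⟩
  have h1 : HasFDerivAt (fun y ↦ Ψ (t, y)) _ y₀ :=
    HasFDerivAt.comp (g := Ψ) y₀ hd.hasFDerivAt (hasFDerivAt_prodMk_right t y₀)
  have h2 := hasMFDerivAt_iff_hasFDerivAt.1 (hL₂.comp y₀ (hL₁.comp y₀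
    (mdifferentiableAt_extChartAt_symm x hyt).hasMFDerivAt))
  have h3 : fderiv ℝ Ψ (t, y₀) ((0, v) : ℝ × E) = L₂ (L₁ v) :=
    (congrArg (fun L : E →L[ℝ] E ↦ L (v : E)) (HasFDerivAt.unique (E := E) (F := E) h1 h2)).trans
      (congrArg (fun w : E ↦ L₂ (L₁ w)) (mfderiv_extChartAt_symm_self (E := E) x v))
  have h4 : Ψ (t, y₀) = extChartAt 𝓘(ℝ, E) x (φ t x) :=
    congrArg (fun z ↦ extChartAt 𝓘(ℝ, E) x (φ t z)) hxs
  refine (α.inChart_mfderiv x hs _).symm.trans ?_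
  refine congrArg₂ (fun (a b : E) ↦ α.inChart x a b) h4.symm ?_
  exact ((hL₂v _).symm.trans (congrArg L₂ (hL₁v v).symm)).trans h3.symm

/-- The group law reduces the derivative at time `t` to the one at time `0` at the point `φ t x`. -/
theorem OneForm.hasDerivAt_pullback (α : OneForm E M) {V : ∀ x : M, TangentSpace 𝓘(ℝ, E) x}
    {φ : ℝ → M → M}
    (hφ : ContMDiff (𝓘(ℝ, ℝ).prod 𝓘(ℝ, E)) 𝓘(ℝ, E) ∞ (fun p : ℝ × M ↦ φ p.1 p.2))
    (h0 : ∀ x, φ 0 x = x) (hadd : ∀ s t x, φ (s + t) x = φ s (φ t x))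
    (hV : ∀ x, IsMIntegralCurve (fun t ↦ φ t x) V)
    (hα : ∀ x, α.1 x (V x) = 0) (x : M) (v : TangentSpace 𝓘(ℝ, E) x) (t : ℝ) :
    HasDerivAt (fun t ↦ α.1 (φ t x) (mfderiv 𝓘(ℝ, E) 𝓘(ℝ, E) (φ t) x v))
      (α.d (φ t x) (V (φ t x)) (mfderiv 𝓘(ℝ, E) 𝓘(ℝ, E) (φ t) x v)) t := by
  have hd : ∀ t x, MDifferentiableAt 𝓘(ℝ, E) 𝓘(ℝ, E) (φ t) x := fun t x ↦ by
    have h1 : ContMDiffAt 𝓘(ℝ, E) 𝓘(ℝ, E) ∞ (φ t) x :=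
      ContMDiffAt.comp (x := x) (f := fun y ↦ (t, y)) (hφ (t, x))
        (contMDiffAt_const.prodMk contMDiffAt_id)
    exact h1.mdifferentiableAt (by simp)
  have key := α.hasDerivAt_pullback_zero hφ h0 hV hα (φ t x)
    (mfderiv 𝓘(ℝ, E) 𝓘(ℝ, E) (φ t) x v)
  rw [← sub_self t] at key
  have h2 := key.comp_sub_const t t
  refine h2.congr_of_eventuallyEq (Filter.Eventually.of_forall fun s ↦ ?_)
  have hcomp : φ s = φ (s - t) ∘ φ t := by
    funext y
    rw [Function.comp_apply, ← hadd, sub_add_cancel]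
  have h3 := congrArg (fun f : M → M ↦ α.1 (f x) (mfderiv 𝓘(ℝ, E) 𝓘(ℝ, E) f x v)) hcomp
  refine h3.trans ?_
  exact congrArg (fun L : E →L[ℝ] E ↦ α.1 (φ (s - t) (φ t x)) (L v))
    (mfderiv_comp x (hd (s - t) (φ t x)) (hd t x))

end LieDerivative

/-! ### The isotopies between the contact structures of the sphere -/

section Isotopy

variable {E : Type*} [NormedAddCommGroup E] [InnerProductSpace ℝ E] [FiniteDimensional ℝ E]
variable {M : Type*} [TopologicalSpace M] [ChartedSpace E M] [IsManifold 𝓘(ℝ, E) ∞ M]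
variable {g : RMetric E M} {D : CovariantDerivative (𝓘(ℝ, E).prod 𝓘(ℝ, ℝ)) (E × ℝ)
      (fun c : M × Ray ↦ TangentSpace (𝓘(ℝ, E).prod 𝓘(ℝ, ℝ)) c)} {S : ThreeSasakian g}

theorem exists_spherical_coordinates (z : S2) : ∃ θ a b : ℝ, a ^ 2 + b ^ 2 = 1 ∧
    z.1 0 = Real.cos θ ∧ z.1 1 = Real.sin θ * a ∧ z.1 2 = Real.sin θ * b := by
  have hz : z.1 0 ^ 2 + z.1 1 ^ 2 + z.1 2 ^ 2 = 1 := by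
    have h1 : ‖z.1‖ = 1 := by simp
    have h2 := EuclideanSpace.real_norm_sq_eq z.1
    rw [h1, Fin.sum_univ_three] at h2
    linarith
  have h0 : -1 ≤ z.1 0 ∧ z.1 0 ≤ 1 := abs_le.1 ((sq_le_one_iff_abs_le_one _).1 (by nlinarith))
  have hs := Real.sin_sq_add_cos_sq (Real.arccos (z.1 0))
  rw [Real.cos_arccos h0.1 h0.2] at hs
  refine ⟨Real.arccos (z.1 0), ?_⟩
  rw [Real.cos_arccos h0.1 h0.2]
  set q := Real.sin (Real.arccos (z.1 0)) with hq
  by_cases h : q = 0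
  · rw [h] at hs ⊢
    -- At the two poles the direction `(a, b)` is arbitrary; `(1, 0)` is taken.
    exact ⟨1, 0, by norm_num, rfl, by rw [zero_mul]; nlinarith, by rw [zero_mul]; nlinarith⟩
  · refine ⟨z.1 1 / q, z.1 2 / q, ?_, rfl, ?_, ?_⟩
    · field_simp
      linarith
    · field_simp
    · field_simp

/-- The vector `(0, -b, a)` is orthogonal to both `(1, 0, 0)` and `(0, a, b)`. Together with
`quatAt_perp_perp` this says that the field belonging to it rotates the two forms of that plane
infinitesimally into each other. -/
theorem ThreeSasakian.quatAt_base_perp (S : ThreeSasakian g) (x : M) (a b : ℝ) (u : E × ℝ) :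
    S.quatAt x basePoint (S.quatAt x !₂[0, -b, a] u) = -S.quatAt x !₂[0, a, b] u := by
  have h1 := DFunLike.congr_fun (S.isQuaternionic x).jI_jJ u
  have h2 := DFunLike.congr_fun (S.isQuaternionic x).jI_jK u
  simp only [mul_apply_eq_comp, neg_apply] at h1 h2
  simp [quatAt_apply, basePoint, h1, h2]

theorem ThreeSasakian.quatAt_perp_perp (S : ThreeSasakian g) (x : M) {a b : ℝ}
    (hab : a ^ 2 + b ^ 2 = 1) (u : E × ℝ) :
    S.quatAt x !₂[0, a, b] (S.quatAt x !₂[0, -b, a] u) = S.quatAt x basePoint u := by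
  have h1 := DFunLike.congr_fun (S.isQuaternionic x).jJ_jK u
  have h2 := DFunLike.congr_fun (S.isQuaternionic x).jK_jJ u
  have h3 := DFunLike.congr_fun (S.isQuaternionic x).jJ_sq u
  have h4 := DFunLike.congr_fun (S.isQuaternionic x).jK_sq u
  simp only [mul_apply_eq_comp, neg_apply] at h1 h2 h3 h4
  simp [quatAt_apply, basePoint, h1, h2, h3, h4, -smul_neg]
  refine Eq.trans ?_ ((congrArg (fun r : ℝ ↦ r • endAt S.jI x u) hab).trans (one_smul _ _))
  module

/-- The vector field `r (w₀ I + w₁ J + w₂ K) ∂_r` on `M`. -/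
def ThreeSasakian.rotationField (S : ThreeSasakian g) (w : EuclideanSpace ℝ (Fin 3)) (r : ℝ)
    (x : M) : TangentSpace 𝓘(ℝ, E) x := r • (S.quatAt x w (0, 1)).1

namespace ThreeSasakian.IsHyperkahler

theorem form_reeb_eq_zero (h : S.IsHyperkahler D) {z w u : EuclideanSpace ℝ (Fin 3)} {x : M}
    {c : ℝ} (hq : S.quatAt x z (S.quatAt x w (0, 1)) = c • S.quatAt x u (0, 1)) :
    (h.form z).1 x (S.quatAt x w (0, 1)).1 = 0 := by
  rw [h.form_reeb, h.quatAt_skew, hq, coneForm_slice]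
  simp [h.quatAt_radial_snd]

/-- Since the form vanishes on the field (`form_reeb_eq_zero`), this is its Lie derivative: a
multiple of another form of the linear family. -/
theorem form_d_reeb (h : S.IsHyperkahler D) {z w u : EuclideanSpace ℝ (Fin 3)} {x : M}
    {c : ℝ} (hq : S.quatAt x z (S.quatAt x w (0, 1)) = c • S.quatAt x u (0, 1)) (r : ℝ) (v : E) :
    (h.form z).d x (r • (S.quatAt x w (0, 1)).1) v = 2 * (r * c) * (h.form u).1 x v := by
  have h1 : ((r • (S.quatAt x w (0, 1)).1, 0) : E × ℝ) = r • S.quatAt x w (0, 1) :=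
    Prod.ext rfl (by rw [Prod.smul_snd, h.quatAt_radial_snd, smul_zero])
  refine (h.form_d z x _ v).trans ?_
  refine Eq.trans ?_ (congrArg (fun s ↦ 2 * (r * c) * s) (h.form_apply u x v).symm)
  rw [h1, map_smul, hq, map_smul, map_smul, LinearMap.smul_apply, LinearMap.smul_apply]
  simp only [smul_eq_mul]
  ring

theorem contMDiff_rotationField (h : S.IsHyperkahler D) (w : EuclideanSpace ℝ (Fin 3)) (r : ℝ) :
    ContMDiff 𝓘(ℝ, E) (𝓘(ℝ, E).prod 𝓘(ℝ, E)) ∞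
      (fun x ↦ Bundle.TotalSpace.mk' E x (S.rotationField w r x)) :=
  fun x ↦ ContMDiffAt.const_smul_section (a := r)
    (((ContMDiffAt.const_smul_section (a := w 0) (h.jI.contMDiff_reebField x)).add_section
      (ContMDiffAt.const_smul_section (a := w 1) (h.jJ.contMDiff_reebField x))).add_section
      (ContMDiffAt.const_smul_section (a := w 2) (h.jK.contMDiff_reebField x)))

/-- The contact structures of the sphere are isotopic. -/
theorem isotopic [T2Space M] [CompactSpace M] (h : S.IsHyperkahler D) (z : S2) :
    Isotopic (h.contactForm basePoint).ker (h.contactForm z).ker := by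
  obtain ⟨θ, a, b, hab, hz0, hz1, hz2⟩ := exists_spherical_coordinates z
  -- The speed `θ / 2` absorbs the factor `2` in `dα_z = 2 ḡ(q_z ·, ·)`, so that the time-one map
  -- rotates by the angle `θ`.
  obtain ⟨φ, hφ, hφ0, hadd, hV⟩ := exists_flow (h.contMDiff_rotationField !₂[0, -b, a] (θ / 2))
  refine ⟨h.contactForm basePoint, h.contactForm z, φ, fun _ ↦ 1, rfl, rfl, hφ, hφ0,
    fun x ↦ ⟨one_pos, fun v ↦ ?_⟩⟩
  have hq₁ : ∀ x, S.quatAt x basePoint (S.quatAt x !₂[0, -b, a] (0, 1)) =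
      (-1 : ℝ) • S.quatAt x !₂[0, a, b] (0, 1) := fun x ↦ by
    rw [S.quatAt_base_perp, neg_one_smul]
  have hq₂ : ∀ x, S.quatAt x !₂[0, a, b] (S.quatAt x !₂[0, -b, a] (0, 1)) =
      (1 : ℝ) • S.quatAt x basePoint (0, 1) := fun x ↦ by
    rw [S.quatAt_perp_perp x hab, one_smul]
  have hv : ∀ (y : EuclideanSpace ℝ (Fin 3)) (x : M),
      (h.form y).1 x (S.quatAt x !₂[0, -b, a] (0, 1)).1 = 0 →
      (h.form y).1 x ((θ / 2) • (S.quatAt x !₂[0, -b, a] (0, 1)).1 : E) = 0 := fun y x hx ↦ by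
    refine (map_smul ((h.form y).1 x) _ _).trans ?_
    rw [hx, smul_zero]
  have d₁ := fun t ↦ ((h.form basePoint).hasDerivAt_pullback hφ hφ0 hadd hV
    (fun x ↦ hv _ x (h.form_reeb_eq_zero (hq₁ x))) x v t).congr_deriv
    (h.form_d_reeb (hq₁ _) (θ / 2) _)
  have d₂ := fun t ↦ ((h.form !₂[0, a, b]).hasDerivAt_pullback hφ hφ0 hadd hV
    (fun x ↦ hv _ x (h.form_reeb_eq_zero (hq₂ x))) x v t).congr_deriv
    (h.form_d_reeb (hq₂ _) (θ / 2) _)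
  set p : ℝ → ℝ := fun t ↦ (h.form basePoint).1 (φ t x) (mfderiv 𝓘(ℝ, E) 𝓘(ℝ, E) (φ t) x v)
  set q : ℝ → ℝ := fun t ↦ (h.form !₂[0, a, b]).1 (φ t x) (mfderiv 𝓘(ℝ, E) 𝓘(ℝ, E) (φ t) x v)
  have d₁' : ∀ t, HasDerivAt p (-θ * q t) t := fun t ↦ (d₁ t).congr_deriv (by simp only [q]; ring)
  have d₂' : ∀ t, HasDerivAt q (θ * p t) t := fun t ↦ (d₂ t).congr_deriv (by simp only [p]; ring)
  -- The pullbacks `p` and `q` solve `p' = -θ q`, `q' = θ p`, so this combination is constant. At `t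
  -- = 1` it is the pullback of `α_z`, at `t = 0` it is `α_I`.
  have d₃ : ∀ t, HasDerivAt (fun t ↦ Real.cos (t * θ) * p t + Real.sin (t * θ) * q t) 0 t := by
    intro t
    have hm : HasDerivAt (fun t : ℝ ↦ t * θ) θ t := hasDerivAt_mul_const θ
    refine ((hm.cos.mul (d₁' t)).add (hm.sin.mul (d₂' t))).congr_deriv ?_
    ring
  have hconst := is_const_of_deriv_eq_zero (fun t ↦ (d₃ t).differentiableAt)
    (fun t ↦ (d₃ t).deriv) 1 0
  simp only [one_mul, zero_mul, Real.cos_zero, Real.sin_zero, add_zero] at hconst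
  have hp0 : p 0 = (h.form basePoint).1 x v := by
    have hid : (φ 0 : M → M) = id := funext hφ0
    refine (congrArg (fun f : M → M ↦ (h.form basePoint).1 (f x)
      (mfderiv 𝓘(ℝ, E) 𝓘(ℝ, E) f x v)) hid).trans ?_
    exact congrArg (fun L : E →L[ℝ] E ↦ (h.form basePoint).1 x (L v)) mfderiv_id
  rw [one_mul]
  refine Eq.trans ?_ (hconst.trans hp0)
  have hlin : ∀ (x : M) (w : E), (h.form z).1 x w = Real.cos θ * (h.form basePoint).1 x w +
      Real.sin θ * (h.form !₂[0, a, b]).1 x w := by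
    intro x w
    rw [h.form_apply, h.form_apply, h.form_apply]
    simp [quatAt_apply, basePoint, hz0, hz1, hz2]
    ring
  exact hlin _ _

end ThreeSasakian.IsHyperkahler

end Isotopy

/-! ### Continuity in the `C^∞` topology -/

section SmoothTopology

variable {E : Type*} [NormedAddCommGroup E] [InnerProductSpace ℝ E] [FiniteDimensional ℝ E]
variable {M : Type*} [TopologicalSpace M] [ChartedSpace E M] [IsManifold 𝓘(ℝ, E) ∞ M]

theorem tendstoUniformlyOn_smul {Z X F : Type*} [TopologicalSpace Z] [TopologicalSpace X]
    [NormedAddCommGroup F] [NormedSpace ℝ F] {c : Z → ℝ} (hc : Continuous c) {A : X → F}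
    {K : Set X} (hK : IsCompact K) (hA : ContinuousOn A K) (z₀ : Z) :
    TendstoUniformlyOn (fun z y ↦ c z • A y) (fun y ↦ c z₀ • A y) (𝓝 z₀) K := by
  obtain ⟨C, hC⟩ := hK.exists_bound_of_continuousOn hA
  rw [Metric.tendstoUniformlyOn_iff]
  intro ε hε
  have h1 : Filter.Tendsto (fun z ↦ |c z₀ - c z| * (|C| + 1)) (𝓝 z₀) (𝓝 0) := by
    have : Continuous fun z ↦ |c z₀ - c z| * (|C| + 1) := by fun_prop
    simpa using this.tendsto z₀
  filter_upwards [h1.eventually (gt_mem_nhds hε)] with z hz y hy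
  rw [dist_eq_norm, ← sub_smul, norm_smul, Real.norm_eq_abs]
  refine lt_of_le_of_lt (mul_le_mul_of_nonneg_left ?_ (abs_nonneg _)) hz
  linarith [hC y hy, le_abs_self C]

/-- Only the three coefficients vary, and each derivative of the fixed fields is bounded on compact
subsets of a chart target, so the convergence there is uniform. -/
theorem continuous_smoothTopology_of_linComb {S F Z : Type*} [NormedAddCommGroup F]
    [NormedSpace ℝ F] [TopologicalSpace Z] {rep : S → M → E → F} {s : Z → S} {c₀ c₁ c₂ : Z → ℝ}
    (h₀ : Continuous c₀) (h₁ : Continuous c₁) (h₂ : Continuous c₂) {A₀ A₁ A₂ : M → E → F}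
    (hA₀ : ∀ x, ContDiffOn ℝ ∞ (A₀ x) (extChartAt 𝓘(ℝ, E) x).target)
    (hA₁ : ∀ x, ContDiffOn ℝ ∞ (A₁ x) (extChartAt 𝓘(ℝ, E) x).target)
    (hA₂ : ∀ x, ContDiffOn ℝ ∞ (A₂ x) (extChartAt 𝓘(ℝ, E) x).target)
    (hs : ∀ z x, rep (s z) x = c₀ z • A₀ x + c₁ z • A₁ x + c₂ z • A₂ x) :
    Continuous[_, smoothTopology E M rep] s := by
  refine continuous_iInf_rng.2 fun x ↦ continuous_iInf_rng.2 fun k ↦ continuous_induced_rng.2 ?_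
  refine continuous_iff_continuousAt.2 fun z₀ ↦
    UniformOnFun.tendsto_iff_tendstoUniformlyOn.2 fun K ⟨hK, hKt⟩ ↦ ?_
  have hat : ∀ {A : E → F}, ContDiffOn ℝ ∞ A (extChartAt 𝓘(ℝ, E) x).target →
      ∀ y ∈ K, ContDiffAt ℝ k A y := fun hA y hy ↦
    ((hA.contDiffAt ((isOpen_extChartAt_target x).mem_nhds (hKt hy)))).of_le
      (by exact_mod_cast le_top)
  have hcont : ∀ {A : E → F}, ContDiffOn ℝ ∞ A (extChartAt 𝓘(ℝ, E) x).target →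
      ContinuousOn (iteratedFDeriv ℝ k A) K := fun hA y hy ↦
    ((hat hA y hy).iteratedFDeriv_right (m := 0) (i := k) (by simp)).continuousAt.continuousWithinAt
  have heq : ∀ z, ∀ y ∈ K, iteratedFDeriv ℝ k (rep (s z) x) y =
      c₀ z • iteratedFDeriv ℝ k (A₀ x) y + c₁ z • iteratedFDeriv ℝ k (A₁ x) y +
        c₂ z • iteratedFDeriv ℝ k (A₂ x) y := by
    intro z y hy
    have k₀ := hat (hA₀ x) y hy
    have k₁ := hat (hA₁ x) y hy
    have k₂ := hat (hA₂ x) y hy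
    have k₀' : ContDiffAt ℝ k (c₀ z • A₀ x) y := k₀.const_smul _
    have k₁' : ContDiffAt ℝ k (c₁ z • A₁ x) y := k₁.const_smul _
    have k₂' : ContDiffAt ℝ k (c₂ z • A₂ x) y := k₂.const_smul _
    have k₃ : ContDiffAt ℝ k (c₀ z • A₀ x + c₁ z • A₁ x) y := k₀'.add k₁'
    rw [hs, iteratedFDeriv_add_apply k₃ k₂', iteratedFDeriv_add_apply k₀' k₁',
      iteratedFDeriv_const_smul_apply k₀, iteratedFDeriv_const_smul_apply k₁,
      iteratedFDeriv_const_smul_apply k₂]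
  have hlim := ((tendstoUniformlyOn_smul h₀ hK (hcont (hA₀ x)) z₀).add
    (tendstoUniformlyOn_smul h₁ hK (hcont (hA₁ x)) z₀)).add
    (tendstoUniformlyOn_smul h₂ hK (hcont (hA₂ x)) z₀)
  exact (hlim.congr (Filter.Eventually.of_forall fun z y hy ↦ (heq z y hy).symm)).congr_right
    fun y hy ↦ (heq z₀ y hy).symm

/-- Singletons are among the compact sets that define the topology. -/
theorem continuous_iteratedFDeriv_smoothTopology {S F : Type*} [NormedAddCommGroup F]
    [NormedSpace ℝ F] (rep : S → M → E → F) (x : M) (k : ℕ) {y : E}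
    (hy : y ∈ (extChartAt 𝓘(ℝ, E) x).target) :
    Continuous[smoothTopology E M rep, _] fun s ↦ iteratedFDeriv ℝ k (rep s x) y := by
  refine continuous_iInf_dom (i := x) (continuous_iInf_dom (i := k) ?_)
  have h1 := (UniformOnFun.uniformContinuous_eval_of_mem
    (ContinuousMultilinearMap ℝ (fun _ : Fin k ↦ E) F) _ (Set.mem_singleton y)
    (show {y} ∈ {K : Set E | IsCompact K ∧ K ⊆ (extChartAt 𝓘(ℝ, E) x).target} from
      ⟨isCompact_singleton, Set.singleton_subset_iff.2 hy⟩)).continuous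
  exact @Continuous.comp _ _ _ (_) (_) (_) _ _ h1 continuous_induced_dom

theorem continuous_apply_smoothTopology {S F : Type*} [NormedAddCommGroup F]
    [NormedSpace ℝ F] (rep : S → M → E → F) (x : M) {y : E}
    (hy : y ∈ (extChartAt 𝓘(ℝ, E) x).target) :
    Continuous[smoothTopology E M rep, _] fun s ↦ rep s x y := by
  let _ := smoothTopology E M rep
  have h1 := (ContinuousMultilinearMap.apply ℝ (fun _ : Fin 0 ↦ E) F 0).continuous.comp
    (continuous_iteratedFDeriv_smoothTopology rep x 0 hy)
  refine h1.congr fun s ↦ ?_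
  exact iteratedFDeriv_zero_apply (𝕜 := ℝ) (f := rep s x) 0

theorem continuous_fderiv_smoothTopology {S F : Type*} [NormedAddCommGroup F]
    [NormedSpace ℝ F] (rep : S → M → E → F) (x : M) {y : E}
    (hy : y ∈ (extChartAt 𝓘(ℝ, E) x).target) :
    Continuous[smoothTopology E M rep, _] fun s ↦ fderiv ℝ (rep s x) y := by
  let _ := smoothTopology E M rep
  refine continuous_clm_apply.2 fun u ↦ ?_
  have h1 := (ContinuousMultilinearMap.apply ℝ (fun _ : Fin 1 ↦ E) F (fun _ ↦ u)).continuous.comp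
    (continuous_iteratedFDeriv_smoothTopology rep x 1 hy)
  refine h1.congr fun s ↦ ?_
  exact iteratedFDeriv_one_apply (𝕜 := ℝ) (f := rep s x) (x := y) (fun _ ↦ u)

/-- The covector `α_p`, on the model space. -/
def OneForm.valueAt (p : M) (α : OneForm E M) : E →L[ℝ] ℝ := α.1 p

/-- The endomorphism `A_p`, on the model space. -/
def EndField.valueAt (p : M) (A : EndField E M) : E →L[ℝ] E := A.1 p

/-- The bilinear form `dα_p`, on the model space. -/
def OneForm.dAt (p : M) (α : OneForm E M) : E →L[ℝ] E →L[ℝ] ℝ :=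
  fderiv ℝ (α.inChart p) (extChartAt 𝓘(ℝ, E) p p) -
    (fderiv ℝ (α.inChart p) (extChartAt 𝓘(ℝ, E) p p)).flip

theorem OneForm.inChart_self (α : OneForm E M) (p : M) :
    α.inChart p (extChartAt 𝓘(ℝ, E) p p) = α.valueAt p := by
  have hp : (extChartAt 𝓘(ℝ, E) p).symm (extChartAt 𝓘(ℝ, E) p p) = p :=
    (extChartAt 𝓘(ℝ, E) p).left_inv (mem_extChartAt_source p)
  refine ContinuousLinearMap.ext fun u ↦ ?_
  exact (congrArg (α.valueAt _) (mfderiv_extChartAt_symm_self p u)).trans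
    (congrArg (fun x ↦ α.valueAt x u) hp)

theorem EndField.inChart_self (A : EndField E M) (p : M) :
    A.inChart p (extChartAt 𝓘(ℝ, E) p p) = A.valueAt p := by
  have hp : (extChartAt 𝓘(ℝ, E) p).symm (extChartAt 𝓘(ℝ, E) p p) = p :=
    (extChartAt 𝓘(ℝ, E) p).left_inv (mem_extChartAt_source p)
  refine ContinuousLinearMap.ext fun u ↦ ?_
  have h1 : ∀ w : E, mfderiv 𝓘(ℝ, E) 𝓘(ℝ, E) (extChartAt 𝓘(ℝ, E) p)
      ((extChartAt 𝓘(ℝ, E) p).symm (extChartAt 𝓘(ℝ, E) p p)) w = w := fun w ↦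
    (congrArg (fun w : E ↦ (mfderiv 𝓘(ℝ, E) 𝓘(ℝ, E) (extChartAt 𝓘(ℝ, E) p)
      ((extChartAt 𝓘(ℝ, E) p).symm (extChartAt 𝓘(ℝ, E) p p)) w : E))
      (mfderiv_extChartAt_symm_self p w).symm).trans
      (mfderiv_extChartAt_mfderiv_symm p (mem_extChartAt_target p) w)
  exact ((h1 _).trans (congrArg (A.valueAt _) (mfderiv_extChartAt_symm_self p u))).trans
    (congrArg (fun x ↦ A.valueAt x u) hp)

theorem OneForm.continuous_valueAt (p : M) : Continuous (OneForm.valueAt (E := E) p) :=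
  (continuous_apply_smoothTopology OneForm.inChart p (mem_extChartAt_target p)).congr
    fun α ↦ α.inChart_self p

theorem EndField.continuous_valueAt (p : M) : Continuous (EndField.valueAt (E := E) p) :=
  (continuous_apply_smoothTopology EndField.inChart p (mem_extChartAt_target p)).congr
    fun A ↦ A.inChart_self p

theorem OneForm.continuous_dAt (p : M) : Continuous (OneForm.dAt (E := E) p) := by
  have h : Continuous fun α : OneForm E M ↦ fderiv ℝ (α.inChart p) (extChartAt 𝓘(ℝ, E) p p) :=
    continuous_fderiv_smoothTopology OneForm.inChart p (mem_extChartAt_target p)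
  have h' : ∀ u v : E, Continuous fun α : OneForm E M ↦
      fderiv ℝ (α.inChart p) (extChartAt 𝓘(ℝ, E) p p) u v := fun u v ↦
    continuous_clm_apply.1 (continuous_clm_apply.1 h u) v
  exact continuous_clm_apply.2 fun u ↦ continuous_clm_apply.2 fun v ↦ (h' u v).sub (h' v u)

theorem OneForm.continuous_linComb (α₀ α₁ α₂ : OneForm E M) :
    Continuous fun z ↦ OneForm.linComb z α₀ α₁ α₂ :=
  continuous_smoothTopology_of_linComb (rep := OneForm.inChart)
    (c₀ := fun z : EuclideanSpace ℝ (Fin 3) ↦ z 0) (c₁ := fun z ↦ z 1) (c₂ := fun z ↦ z 2)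
    (by fun_prop) (by fun_prop) (by fun_prop)
    α₀.contDiffOn_inChart α₁.contDiffOn_inChart α₂.contDiffOn_inChart
    fun z x ↦ OneForm.inChart_linComb z α₀ α₁ α₂ x

theorem EndField.continuous_linComb (A₀ A₁ A₂ : EndField E M) :
    Continuous fun z ↦ EndField.linComb z A₀ A₁ A₂ :=
  continuous_smoothTopology_of_linComb (rep := EndField.inChart)
    (c₀ := fun z : EuclideanSpace ℝ (Fin 3) ↦ z 0) (c₁ := fun z ↦ z 1) (c₂ := fun z ↦ z 2)
    (by fun_prop) (by fun_prop) (by fun_prop)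
    A₀.contDiffOn_inChart A₁.contDiffOn_inChart A₂.contDiffOn_inChart
    fun z x ↦ EndField.inChart_linComb z A₀ A₁ A₂ x

/-- If `β = f α`, then `dβ = f dα` on `ker α`. -/
theorem OneForm.d_eq_of_smul {α β : OneForm E M} {f : M → ℝ}
    (h : ∀ x, β.1 x = f x • α.1 x) {p : M} (hp : α.1 p ≠ 0) {u v : E} (hu : α.1 p u = 0)
    (hv : α.1 p v = 0) : β.d p u v = f p * α.d p u v := by
  set y₀ := extChartAt 𝓘(ℝ, E) p p with hy₀
  set a := α.inChart p with ha
  set b := β.inChart p with hb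
  set F : E → ℝ := fun y ↦ f ((extChartAt 𝓘(ℝ, E) p).symm y) with hF
  have hbF : ∀ y, b y = F y • a y := fun y ↦ ContinuousLinearMap.ext fun w ↦
    congrArg (fun L : E →L[ℝ] ℝ ↦ L (mfderiv 𝓘(ℝ, E) 𝓘(ℝ, E) (extChartAt 𝓘(ℝ, E) p).symm y w))
      (h ((extChartAt 𝓘(ℝ, E) p).symm y))
  have hF0 : F y₀ = f p :=
    congrArg f ((extChartAt 𝓘(ℝ, E) p).left_inv (mem_extChartAt_source p))
  have had : DifferentiableAt ℝ a y₀ := α.differentiableAt_inChart p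
  have hbd : DifferentiableAt ℝ b y₀ := β.differentiableAt_inChart p
  have ha0 : a y₀ = α.valueAt p := α.inChart_self p
  obtain ⟨R, hR⟩ : ∃ R : E, a y₀ R ≠ 0 := by
    by_contra! hc
    refine hp (ContinuousLinearMap.ext fun w ↦ ?_)
    have := hc w
    rw [ha0] at this
    exact this
  have haR : DifferentiableAt ℝ (fun y ↦ a y R) y₀ := had.clm_apply (differentiableAt_const R)
  have hbR : DifferentiableAt ℝ (fun y ↦ b y R) y₀ := hbd.clm_apply (differentiableAt_const R)
  -- The factor `f` is not assumed to be smooth. Near `p` it is the quotient of the values of `β`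
  -- and `α` on a fixed vector `R` with `α(R) ≠ 0`.
  have hFd : DifferentiableAt ℝ F y₀ := by
    have hq : DifferentiableAt ℝ (fun y ↦ b y R * (a y R)⁻¹) y₀ :=
      hbR.fun_mul (haR.fun_inv hR)
    refine hq.congr_of_eventuallyEq ?_
    filter_upwards [haR.continuousAt.eventually_ne hR] with y hy
    simp only [hbF, smul_apply, smul_eq_mul]
    field_simp
  have hD : fderiv ℝ b y₀ = F y₀ • fderiv ℝ a y₀ + (fderiv ℝ F y₀).smulRight (a y₀) := by
    have : b = fun y ↦ F y • a y := funext hbF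
    rw [this]
    exact fderiv_fun_smul hFd had
  have hu' : a y₀ u = 0 := (congrArg (fun L : E →L[ℝ] ℝ ↦ L u) ha0).trans hu
  have hv' : a y₀ v = 0 := (congrArg (fun L : E →L[ℝ] ℝ ↦ L v) ha0).trans hv
  have h1 : β.d p u v = fderiv ℝ b y₀ u v - fderiv ℝ b y₀ v u := rfl
  have h2 : α.d p u v = fderiv ℝ a y₀ u v - fderiv ℝ a y₀ v u := rfl
  rw [h1, h2, hD, ← hF0]
  simp only [add_apply, smul_apply, ContinuousLinearMap.smulRight_apply, hu', hv', smul_eq_mul,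
    mul_zero, add_zero]
  ring

end SmoothTopology

/-! ### The linear contact sphere and its lift -/

section Sphere

variable {E : Type*} [NormedAddCommGroup E] [InnerProductSpace ℝ E] [FiniteDimensional ℝ E]
variable {M : Type*} [TopologicalSpace M] [ChartedSpace E M] [IsManifold 𝓘(ℝ, E) ∞ M]
variable {g : RMetric E M} {D : CovariantDerivative (𝓘(ℝ, E).prod 𝓘(ℝ, ℝ)) (E × ℝ)
      (fun c : M × Ray ↦ TangentSpace (𝓘(ℝ, E).prod 𝓘(ℝ, ℝ)) c)} {S : ThreeSasakian g}

namespace ThreeSasakian.IsHyperkahler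

theorem continuous_contactForm (h : S.IsHyperkahler D) : Continuous h.contactForm :=
  ((OneForm.continuous_linComb _ _ _).comp continuous_subtype_val).subtype_mk _

theorem continuous_compatiblePair (h : S.IsHyperkahler D) : Continuous h.compatiblePair :=
  continuous_induced_rng.2 (h.continuous_contactForm.prodMk
    ((EndField.continuous_linComb _ _ _).comp continuous_subtype_val))

variable [T2Space M] [CompactSpace M]

/-- The linear contact sphere of a 3-Sasakian structure. -/
def sphere (h : S.IsHyperkahler D) : C(S2, IsotopyClass (h.contactForm basePoint).ker) where
  toFun z := ⟨(h.contactForm z).ker, h.isotopic z⟩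
  continuous_toFun := (continuous_quotient_mk'.comp h.continuous_contactForm).subtype_mk _

/-- The standard lift of the linear contact sphere. -/
def lift (h : S.IsHyperkahler D) : C(S2, CompatibleOver (h.contactForm basePoint).ker) where
  toFun z := ⟨Quotient.mk _ (h.compatiblePair z), h.isotopic z⟩
  continuous_toFun := (continuous_quotient_mk'.comp h.continuous_compatiblePair).subtype_mk _

theorem forget_comp_lift (h : S.IsHyperkahler D) :
    (forget (h.contactForm basePoint).ker).comp h.lift = h.sphere := rfl

theorem isLinearContactSphere (h : S.IsHyperkahler D) {αI αJ αK : ContactForm E M}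
    (hI : αI.1 = assocForm h.jI) (hJ : αJ.1 = assocForm h.jJ) (hK : αK.1 = assocForm h.jK) :
    IsLinearContactSphere h.sphere αI αJ αK := fun z ↦ by
  refine ⟨h.contactForm z, rfl, fun x ↦ ?_⟩
  rw [hI, hJ, hK]
  rfl

end ThreeSasakian.IsHyperkahler
end Sphere

/-! ### Linear algebra of stabilized hyperplanes -/

section LinearAlgebra

variable {E : Type*} [NormedAddCommGroup E] [InnerProductSpace ℝ E] [FiniteDimensional ℝ E]

/-- The Euclidean inner product on `E ⊕ ℝ`. -/
def prodForm (E : Type*) [NormedAddCommGroup E] [InnerProductSpace ℝ E] :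
    LinearMap.BilinForm ℝ (E × ℝ) :=
  LinearMap.mk₂ ℝ (fun x y ↦ ⟪x.1, y.1⟫ + x.2 * y.2)
    (fun x y z ↦ by simp [inner_add_left]; ring) (fun c x y ↦ by simp [real_inner_smul_left]; ring)
    (fun x y z ↦ by simp [inner_add_right]; ring)
    (fun c x y ↦ by simp [real_inner_smul_right]; ring)

theorem prodForm_apply (x y : E × ℝ) : prodForm E x y = ⟪x.1, y.1⟫ + x.2 * y.2 := rfl

theorem prodForm_symm (x y : E × ℝ) : prodForm E x y = prodForm E y x := by
  rw [prodForm_apply, prodForm_apply, real_inner_comm, mul_comm]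

theorem prodForm_pos (x : E × ℝ) (hx : x ≠ 0) : 0 < prodForm E x x := by
  rw [prodForm_apply]
  by_cases h : x.1 = 0
  · have h2 : x.2 ≠ 0 := fun h2 ↦ hx (Prod.ext h h2)
    rw [h, inner_zero_left, zero_add]
    exact mul_self_pos.2 h2
  · have := real_inner_self_pos.2 h
    linarith [mul_self_nonneg x.2]

/-- The endomorphism that equals `B` on the orthogonal space of `v`, and maps `v` to `∂_t` and
`∂_t` to `-v`. -/
def stabilizeEnd (v : E) (B : E →L[ℝ] E) : (E × ℝ) →L[ℝ] (E × ℝ) :=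
  (B.comp (ContinuousLinearMap.fst ℝ E ℝ) - (ContinuousLinearMap.snd ℝ E ℝ).smulRight v).prod
    ((innerSL ℝ v).comp (ContinuousLinearMap.fst ℝ E ℝ))

theorem stabilizeEnd_apply (v : E) (B : E →L[ℝ] E) (x : E × ℝ) :
    stabilizeEnd v B x = (B x.1 - x.2 • v, ⟪v, x.1⟫) := rfl

theorem stabilize_val (c : LinearAlmostContact E) : (stabilize c).1 = stabilizeEnd c.1.1 c.1.2 :=
  rfl

theorem continuous_stabilizeEnd {X : Type*} [TopologicalSpace X] {v : X → E} {B : X → E →L[ℝ] E}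
    (hv : Continuous v) (hB : Continuous B) : Continuous fun x ↦ stabilizeEnd (v x) (B x) := by
  refine continuous_clm_apply.2 fun y ↦ ?_
  simp only [stabilizeEnd_apply]
  have := continuous_clm_apply.1 hB y.1
  fun_prop

/-- The endomorphism of the orthogonal space of `v` that represents the bilinear form `β`,
extended by `0`. -/
def perpEnd (v : E) (β : E →L[ℝ] E →L[ℝ] ℝ) : E →L[ℝ] E :=
  ∑ i, ((β.flip (projPerp v (stdOrthonormalBasis ℝ E i))).comp (projPerp v)).smulRight
    (stdOrthonormalBasis ℝ E i)

theorem inner_perpEnd (v : E) (β : E →L[ℝ] E →L[ℝ] ℝ) (w w' : E) :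
    ⟪perpEnd v β w, w'⟫ = β (projPerp v w) (projPerp v w') := by
  conv_rhs => rw [← (stdOrthonormalBasis ℝ E).sum_repr w']
  simp only [perpEnd, sum_apply, ContinuousLinearMap.smulRight_apply, sum_inner,
    real_inner_smul_left, ContinuousLinearMap.comp_apply, ContinuousLinearMap.flip_apply, map_sum,
    map_smul, smul_eq_mul, OrthonormalBasis.repr_apply_apply]
  exact Finset.sum_congr rfl fun i _ ↦ mul_comm _ _

theorem continuous_projPerp_apply {X : Type*} [TopologicalSpace X] {v w : X → E}
    (hv : Continuous v) (hw : Continuous w) : Continuous fun x ↦ projPerp (v x) (w x) := by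
  simp only [projPerp_apply]
  fun_prop

theorem continuous_perpEnd {X : Type*} [TopologicalSpace X] {v : X → E}
    {β : X → E →L[ℝ] E →L[ℝ] ℝ} (hv : Continuous v) (hβ : Continuous β) :
    Continuous fun x ↦ perpEnd (v x) (β x) := by
  refine continuous_clm_apply.2 fun w ↦ ?_
  simp only [perpEnd, sum_apply, ContinuousLinearMap.smulRight_apply,
    ContinuousLinearMap.comp_apply, ContinuousLinearMap.flip_apply]
  refine continuous_finsetSum _ fun i _ ↦ Continuous.smul ?_ continuous_const
  exact (hβ.clm_apply (continuous_projPerp_apply hv continuous_const)).clm_apply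
    (continuous_projPerp_apply hv continuous_const)

/-- The endomorphism of `E ⊕ ℝ` associated with a cooriented hyperplane `ker a` and a bilinear form
on it, which is normalized by `a`. -/
def hyperplaneEnd (a : E →L[ℝ] ℝ) (β : E →L[ℝ] E →L[ℝ] ℝ) : (E × ℝ) →L[ℝ] (E × ℝ) :=
  stabilizeEnd (unitNormal a) (‖a‖⁻¹ • perpEnd (unitNormal a) β)

theorem continuous_unitNormal {X : Type*} [TopologicalSpace X] {a : X → E →L[ℝ] ℝ}
    (ha : Continuous a) (h : ∀ x, a x ≠ 0) : Continuous fun x ↦ unitNormal (a x) := by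
  have h1 : Continuous fun x ↦ (InnerProductSpace.toDual ℝ E).symm (a x) :=
    (InnerProductSpace.toDual ℝ E).symm.continuous.comp ha
  exact (h1.norm.inv₀ fun x ↦ by simpa using h x).smul h1

theorem continuous_hyperplaneEnd {X : Type*} [TopologicalSpace X] {a : X → E →L[ℝ] ℝ}
    {β : X → E →L[ℝ] E →L[ℝ] ℝ} (ha : Continuous a) (h : ∀ x, a x ≠ 0) (hβ : Continuous β) :
    Continuous fun x ↦ hyperplaneEnd (a x) (β x) :=
  continuous_stabilizeEnd (continuous_unitNormal ha h)
    ((ha.norm.inv₀ fun x ↦ norm_ne_zero_iff.2 (h x)).smul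
      (continuous_perpEnd (continuous_unitNormal ha h) hβ))

/-- Rescaling by `r` multiplies both `‖a‖` and the form on the kernel by `r`. The normalization by
`‖a‖` is there so that the operator depends on the contact structure only. -/
theorem hyperplaneEnd_smul {a : E →L[ℝ] ℝ} (ha : a ≠ 0) {r : ℝ} (hr : 0 < r)
    {β β' : E →L[ℝ] E →L[ℝ] ℝ} (h : ∀ w w', a w = 0 → a w' = 0 → β' w w' = r * β w w') :
    hyperplaneEnd (r • a) β' = hyperplaneEnd a β := by
  have h1 : perpEnd (unitNormal a) β' = r • perpEnd (unitNormal a) β := by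
    refine ContinuousLinearMap.ext fun w ↦ ext_inner_right ℝ fun w' ↦ ?_
    rw [smul_apply, real_inner_smul_left, inner_perpEnd, inner_perpEnd,
      h _ _ (apply_projPerp_unitNormal ha w) (apply_projPerp_unitNormal ha w')]
  rw [hyperplaneEnd, hyperplaneEnd, unitNormal_smul hr, h1, norm_smul, Real.norm_of_nonneg hr.le,
    smul_smul]
  congr 2
  field_simp

theorem prodForm_hyperplaneEnd (a : E →L[ℝ] ℝ) (β : E →L[ℝ] E →L[ℝ] ℝ) (x y : E × ℝ) :
    prodForm E (hyperplaneEnd a β x) y =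
      ‖a‖⁻¹ * β (projPerp (unitNormal a) x.1) (projPerp (unitNormal a) y.1) -
        x.2 * ⟪unitNormal a, y.1⟫ + ⟪unitNormal a, x.1⟫ * y.2 := by
  rw [prodForm_apply, hyperplaneEnd, stabilizeEnd_apply]
  simp only [inner_sub_left, real_inner_smul_left, smul_apply, inner_perpEnd]

theorem hyperplaneEnd_skew {a : E →L[ℝ] ℝ} {β : E →L[ℝ] E →L[ℝ] ℝ}
    (hβ : ∀ w w', β w w' = -β w' w) (x y : E × ℝ) :
    prodForm E (hyperplaneEnd a β x) y = -prodForm E x (hyperplaneEnd a β y) := by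
  rw [prodForm_symm x, prodForm_hyperplaneEnd, prodForm_hyperplaneEnd, hβ]
  ring

theorem projPerp_of_inner_eq_zero {v w : E} (h : ⟪v, w⟫ = 0) : projPerp v w = w := by
  rw [projPerp_apply, h, zero_smul, sub_zero]

theorem projPerp_self {v : E} (h : ‖v‖ = 1) : projPerp v v = 0 := by
  rw [projPerp_apply, real_inner_self_eq_norm_sq, h]
  simp

/-- The operator is the orthogonal sum of a rotation of the plane of the unit normal and `∂_t`, and
of the skew operator of `β` on the hyperplane. -/
theorem isSkewable_hyperplaneEnd {a : E →L[ℝ] ℝ} (ha : a ≠ 0) {β : E →L[ℝ] E →L[ℝ] ℝ}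
    (hβ : ∀ w w', β w w' = -β w' w)
    (hnd : ∀ w, a w = 0 → (∀ w', a w' = 0 → β w w' = 0) → w = 0) :
    IsSkewable (hyperplaneEnd a β) := by
  refine ⟨prodForm E, prodForm_symm, prodForm_pos, hyperplaneEnd_skew hβ, fun x hx ↦ ?_⟩
  have h1 := fun y ↦ prodForm_hyperplaneEnd a β x y
  simp only [hx, map_zero, LinearMap.zero_apply] at h1
  have hn := norm_unitNormal ha
  have hvv : ⟪unitNormal a, unitNormal a⟫ = 1 := by
    rw [real_inner_self_eq_norm_sq, hn]
    norm_num
  have h2 : x.2 = 0 := by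
    have := h1 (unitNormal a, 0)
    simp only [projPerp_self hn, map_zero, hvv] at this
    linarith
  have h3 : ⟪unitNormal a, x.1⟫ = 0 := by
    have := h1 (0, 1)
    simpa using this.symm
  refine Prod.ext (hnd x.1 ((inner_unitNormal_eq_zero ha).1 h3) fun w' hw' ↦ ?_) h2
  have h4 := h1 (w', 0)
  have h5 := (inner_unitNormal_eq_zero ha).2 hw'
  simp only [projPerp_of_inner_eq_zero h3, projPerp_of_inner_eq_zero h5, h2, h3] at h4
  have h6 : ‖a‖⁻¹ ≠ 0 := inv_ne_zero (norm_ne_zero_iff.2 ha)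
  have h7 : ‖a‖⁻¹ * β x.1 w' = 0 := by linarith
  exact (mul_eq_zero.1 h7).resolve_left h6

/-- Both operators respect the splitting of `E ⊕ ℝ` into the hyperplane and the plane of `v` and
`∂_t`. On the hyperplane the claim is compatibility of `j` with `β`; on the plane the two are the
same rotation. -/
theorem isCompatible_hyperplaneEnd {a : E →L[ℝ] ℝ} (ha : a ≠ 0) {β : E →L[ℝ] E →L[ℝ] ℝ}
    (hβ : ∀ w w', β w w' = -β w' w) {c : LinearAlmostContact E} (hc : c.1.1 = unitNormal a)
    (hinv : ∀ w w', a w = 0 → a w' = 0 → β (c.1.2 w) (c.1.2 w') = β w w')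
    (hpos : ∀ w, a w = 0 → w ≠ 0 → 0 < β w (c.1.2 w)) :
    IsCompatible (prodForm E) (hyperplaneEnd a β) (stabilize c).1 := by
  set v := unitNormal a with hv
  have hn : ‖v‖ = 1 := norm_unitNormal ha
  have hvv : ⟪v, v⟫ = 1 := by
    rw [real_inner_self_eq_norm_sq, hn]
    norm_num
  have hjv : c.1.2 v = 0 := hc ▸ c.2.2.1
  have hvj : ∀ w, ⟪v, c.1.2 w⟫ = 0 := hc ▸ c.2.2.2.1
  have hjj : ∀ w, ⟪v, w⟫ = 0 → c.1.2 (c.1.2 w) = -w := hc ▸ c.2.2.2.2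
  have hP : ∀ w, a (projPerp v w) = 0 := apply_projPerp_unitNormal ha
  have hjP : ∀ w, c.1.2 w = c.1.2 (projPerp v w) := fun w ↦ by
    rw [projPerp_apply, map_sub, map_smul, hjv, smul_zero, sub_zero]
  have ha' : 0 < ‖a‖⁻¹ := inv_pos.2 (norm_pos_iff.2 ha)
  have key : ∀ x y : E × ℝ, prodForm E (hyperplaneEnd a β x) ((stabilize c).1 y) =
      ‖a‖⁻¹ * β (projPerp v x.1) (c.1.2 (projPerp v y.1)) + x.2 * y.2 +
        ⟪v, x.1⟫ * ⟪v, y.1⟫ := by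
    intro x y
    have h1 : projPerp v (c.1.2 y.1 - y.2 • v) = c.1.2 (projPerp v y.1) := by
      rw [map_sub, map_smul, projPerp_self hn, smul_zero, sub_zero,
        projPerp_of_inner_eq_zero (hvj _), hjP]
    rw [prodForm_hyperplaneEnd, stabilize_val, stabilizeEnd_apply, hc]
    dsimp only
    rw [← hv, h1, inner_sub_right, real_inner_smul_right, hvj, hvv]
    ring
  have hsymm : ∀ w w', a w = 0 → a w' = 0 → β w (c.1.2 w') = β w' (c.1.2 w) := by
    intro w w' hw hw'
    have hj : ∀ u, a (c.1.2 u) = 0 := fun u ↦ (inner_unitNormal_eq_zero ha).1 (hvj u)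
    rw [← hinv w _ hw (hj w'), hjj w' ((inner_unitNormal_eq_zero ha).2 hw'), map_neg, hβ, neg_neg]
  refine ⟨hyperplaneEnd_skew hβ, sq_eq_neg_one_iff.2 (stabilize c).2, fun x y ↦ ?_, fun x hx ↦ ?_⟩
  · rw [key, key, hsymm _ _ (hP _) (hP _)]
    ring
  · rw [key]
    by_cases h0 : projPerp v x.1 = 0
    · rw [h0, map_zero, zero_apply, mul_zero, zero_add]
      by_cases h2 : x.2 = 0
      · have h3 : ⟪v, x.1⟫ ≠ 0 := by
          intro h3
          rw [projPerp_of_inner_eq_zero h3] at h0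
          exact hx (Prod.ext h0 h2)
        linarith [mul_self_nonneg x.2, mul_self_pos.2 h3]
      · linarith [mul_self_nonneg ⟪v, x.1⟫, mul_self_pos.2 h2]
    · have := mul_pos ha' (hpos _ (hP _) h0)
      linarith [mul_self_nonneg x.2, mul_self_nonneg ⟪v, x.1⟫]

/-- The endomorphism that equals `j` on the orthogonal space of `v`, and maps `ρ` to `∂_t` and
`∂_t` to `-ρ`. -/
def transverseEnd (v : E) (j : E →L[ℝ] E) (ρ : E) : (E × ℝ) →L[ℝ] (E × ℝ) :=
  ((j.comp (ContinuousLinearMap.id ℝ E - (⟪v, ρ⟫⁻¹ • innerSL ℝ v).smulRight ρ)).comp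
      (ContinuousLinearMap.fst ℝ E ℝ) - (ContinuousLinearMap.snd ℝ E ℝ).smulRight ρ).prod
    ((⟪v, ρ⟫⁻¹ • innerSL ℝ v).comp (ContinuousLinearMap.fst ℝ E ℝ))

theorem transverseEnd_apply (v : E) (j : E →L[ℝ] E) (ρ : E) (x : E × ℝ) :
    transverseEnd v j ρ x =
      (j (x.1 - (⟪v, ρ⟫⁻¹ * ⟪v, x.1⟫) • ρ) - x.2 • ρ, ⟪v, ρ⟫⁻¹ * ⟪v, x.1⟫) := rfl

theorem transverseEnd_mul_self (c : LinearAlmostContact E) {ρ : E} (hρ : 0 < ⟪c.1.1, ρ⟫) :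
    transverseEnd c.1.1 c.1.2 ρ * transverseEnd c.1.1 c.1.2 ρ = -1 := by
  rw [sq_eq_neg_one_iff]
  intro x
  obtain ⟨⟨v, j⟩, hn, hjv, hvj, hjj⟩ := c
  dsimp only at *
  have h1 : ⟪v, ρ⟫⁻¹ * ⟪v, ρ⟫ = 1 := inv_mul_cancel₀ hρ.ne'
  have h2 : ∀ w s, ⟪v, ρ⟫⁻¹ * ⟪v, j w - s • ρ⟫ = -s := fun w s ↦ by
    rw [inner_sub_right, hvj, real_inner_smul_right]
    linear_combination -s * h1
  have h3 : ⟪v, x.1 - (⟪v, ρ⟫⁻¹ * ⟪v, x.1⟫) • ρ⟫ = 0 := by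
    rw [inner_sub_right, real_inner_smul_right]
    linear_combination -⟪v, x.1⟫ * h1
  rw [transverseEnd_apply, transverseEnd_apply]
  dsimp only
  rw [h2]
  refine Prod.ext ?_ rfl
  dsimp only
  rw [neg_smul, sub_neg_eq_add, sub_add_cancel, hjj _ h3]
  simp

theorem transverseEnd_self (c : LinearAlmostContact E) :
    transverseEnd c.1.1 c.1.2 c.1.1 = (stabilize c).1 := by
  refine ContinuousLinearMap.ext fun x ↦ ?_
  have hvv : ⟪c.1.1, c.1.1⟫ = 1 := by
    rw [real_inner_self_eq_norm_sq, c.2.1]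
    norm_num
  rw [transverseEnd_apply, stabilize_val, stabilizeEnd_apply, hvv, map_sub, map_smul, c.2.2.1]
  simp

/-- Vectors on the positive side of a hyperplane form a convex set, so `ρ` can be moved to the unit
normal along a segment. This serves for the Reeb vector, which is transverse to the contact
hyperplane but need not be orthogonal to it in the framing. -/
theorem HasDegree.of_transverseEnd {c : S2 → LinearAlmostContact E} {ρ : S2 → E} {k : ℕ} {d : ℤ}
    (hc : Continuous fun z ↦ (c z).1) (hρ : Continuous ρ) (hpos : ∀ z, 0 < ⟪(c z).1.1, ρ z⟫)
    {f : S2 → ComplexStr (E × ℝ)} (hf : ∀ z, (f z).1 = transverseEnd (c z).1.1 (c z).1.2 (ρ z))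
    (h : HasDegree k f d) : HasDegree k (fun z ↦ stabilize (c z)) d := by
  let R : S2 × I → E := fun p ↦ (1 - (p.2 : ℝ)) • ρ p.1 + (p.2 : ℝ) • (c p.1).1.1
  have hR : ∀ p, 0 < ⟪(c p.1).1.1, R p⟫ := fun p ↦ by
    have hvv : ⟪(c p.1).1.1, (c p.1).1.1⟫ = 1 := by
      rw [real_inner_self_eq_norm_sq, (c p.1).2.1]
      norm_num
    simp only [R, inner_add_right, real_inner_smul_right, hvv, mul_one]
    have h1 := hpos p.1
    have h2 := p.2.2.1
    have h3 := p.2.2.2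
    rcases h2.eq_or_lt with h4 | h4
    · rw [← h4]
      linarith
    · have := mul_nonneg (sub_nonneg.2 h3) h1.le
      linarith
  have hRc : Continuous R := by
    have h1 : Continuous fun p : S2 × I ↦ (c p.1).1.1 := (continuous_fst.comp hc).comp continuous_fst
    fun_prop
  have hcont : Continuous fun p : S2 × I ↦ transverseEnd (c p.1).1.1 (c p.1).1.2 (R p) := by
    refine continuous_clm_apply.2 fun y ↦ ?_
    simp only [transverseEnd_apply]
    have h1 : Continuous fun p : S2 × I ↦ (c p.1).1.1 := (continuous_fst.comp hc).comp continuous_fst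
    have h2 : Continuous fun p : S2 × I ↦ (c p.1).1.2 := (continuous_snd.comp hc).comp continuous_fst
    have h3 : Continuous fun p : S2 × I ↦ ⟪(c p.1).1.1, R p⟫⁻¹ * ⟪(c p.1).1.1, y.1⟫ :=
      ((h1.inner hRc).inv₀ fun p ↦ (hR p).ne').mul (h1.inner continuous_const)
    exact ((h2.clm_apply (continuous_const.sub (h3.smul hRc))).sub
      (continuous_const.smul hRc)).prodMk h3
  refine HasDegree.of_homotopy ⟨_, hcont⟩ (fun p ↦ transverseEnd_mul_self _ (hR p)) (fun z ↦ ?_)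
    (fun z ↦ ?_) h
  · rw [hf]
    simp [R]
  · refine Eq.trans ?_ (transverseEnd_self (c z))
    simp [R]

/-- Conjugation by a linear isomorphism. -/
def conjEnd {V W : Type*} [NormedAddCommGroup V] [NormedSpace ℝ V] [NormedAddCommGroup W]
    [NormedSpace ℝ W] (T : V ≃L[ℝ] W) (A : V →L[ℝ] V) : W →L[ℝ] W :=
  (T : V →L[ℝ] W).comp (A.comp (T.symm : W →L[ℝ] V))

theorem conjEnd_apply {V W : Type*} [NormedAddCommGroup V] [NormedSpace ℝ V]
    [NormedAddCommGroup W] [NormedSpace ℝ W] (T : V ≃L[ℝ] W) (A : V →L[ℝ] V) (w : W) :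
    conjEnd T A w = T (A (T.symm w)) := rfl

theorem IsQuaternionic.conj {V W : Type*} [NormedAddCommGroup V] [NormedSpace ℝ V]
    [NormedAddCommGroup W] [NormedSpace ℝ W] (T : V ≃L[ℝ] W) {jI jJ jK : V →L[ℝ] V}
    (h : IsQuaternionic jI jJ jK) :
    IsQuaternionic (conjEnd T jI) (conjEnd T jJ) (conjEnd T jK) := by
  have hm : ∀ A B : V →L[ℝ] V, conjEnd T A * conjEnd T B = conjEnd T (A * B) := fun A B ↦ by
    refine ContinuousLinearMap.ext fun w ↦ ?_
    simp [conjEnd_apply]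
  have h1 : conjEnd T (-1) = -1 := by
    refine ContinuousLinearMap.ext fun w ↦ ?_
    simp [conjEnd_apply]
  exact ⟨by rw [hm, h.jI_sq, h1], by rw [hm, h.jJ_sq, h1], by rw [hm, h.jK_sq, h1],
    by rw [hm, h.jI_jJ]⟩

theorem quatSphere_conjEnd {V W : Type*} [NormedAddCommGroup V] [NormedSpace ℝ V]
    [NormedAddCommGroup W] [NormedSpace ℝ W] (T : V ≃L[ℝ] W) (jI jJ jK : V →L[ℝ] V)
    (z : EuclideanSpace ℝ (Fin 3)) :
    quatSphere (conjEnd T jI) (conjEnd T jJ) (conjEnd T jK) z =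
      conjEnd T (quatSphere jI jJ jK z) := by
  refine ContinuousLinearMap.ext fun w ↦ ?_
  simp [quatSphere, conjEnd_apply]

end LinearAlgebra

/-! ### Evaluation of contact structures at a point -/

section PointEvaluation

variable {E : Type*} [NormedAddCommGroup E] [InnerProductSpace ℝ E] [FiniteDimensional ℝ E]
variable {M : Type*} [TopologicalSpace M] [ChartedSpace E M] [IsManifold 𝓘(ℝ, E) ∞ M]
variable {p : M}

/-- A framing of the tangent space, on the model space. -/
def framing (τ : TangentSpace 𝓘(ℝ, E) p ≃L[ℝ] E) : E ≃L[ℝ] E := τ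

/-- The bilinear form `τ_* dα_p`. -/
def pushForm (τ : TangentSpace 𝓘(ℝ, E) p ≃L[ℝ] E) (α : ContactForm E M) : E →L[ℝ] E →L[ℝ] ℝ :=
  (α.1.dAt p).bilinearComp ((framing τ).symm : E →L[ℝ] E) ((framing τ).symm : E →L[ℝ] E)

theorem pushForm_apply (τ : TangentSpace 𝓘(ℝ, E) p ≃L[ℝ] E) (α : ContactForm E M) (w w' : E) :
    pushForm τ α w w' = α.1.d p (τ.symm w) (τ.symm w') := rfl

theorem pushForm_skew (τ : TangentSpace 𝓘(ℝ, E) p ≃L[ℝ] E) (α : ContactForm E M) (w w' : E) :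
    pushForm τ α w w' = -pushForm τ α w' w := by
  rw [pushForm_apply, pushForm_apply]
  exact (neg_sub _ _).symm

theorem pushCovector_apply (τ : TangentSpace 𝓘(ℝ, E) p ≃L[ℝ] E) (α : ContactForm E M) (w : E) :
    pushCovector τ α w = α.1.1 p (τ.symm w) := rfl

theorem continuous_pushCovector (τ : TangentSpace 𝓘(ℝ, E) p ≃L[ℝ] E) :
    Continuous (pushCovector (M := M) τ) :=
  continuous_clm_apply.2 fun w ↦ continuous_clm_apply.1
    ((OneForm.continuous_valueAt p).comp continuous_subtype_val) ((framing τ).symm w)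

theorem continuous_pushForm (τ : TangentSpace 𝓘(ℝ, E) p ≃L[ℝ] E) :
    Continuous (pushForm (M := M) τ) :=
  continuous_clm_apply.2 fun w ↦ continuous_clm_apply.2 fun w' ↦ continuous_clm_apply.1
    (continuous_clm_apply.1 ((OneForm.continuous_dAt p).comp continuous_subtype_val)
      ((framing τ).symm w)) ((framing τ).symm w')

/-- The endomorphism of `E ⊕ ℝ` associated with the contact structure `ker α` at `p`. -/
def contactEnd (τ : TangentSpace 𝓘(ℝ, E) p ≃L[ℝ] E) (α : ContactForm E M) :
    (E × ℝ) →L[ℝ] (E × ℝ) := hyperplaneEnd (pushCovector τ α) (pushForm τ α)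

theorem continuous_contactEnd (τ : TangentSpace 𝓘(ℝ, E) p ≃L[ℝ] E) :
    Continuous (contactEnd (M := M) τ) :=
  continuous_hyperplaneEnd (continuous_pushCovector τ) (pushCovector_ne_zero τ)
    (continuous_pushForm τ)

theorem isSkewable_contactEnd (τ : TangentSpace 𝓘(ℝ, E) p ≃L[ℝ] E) (α : ContactForm E M) :
    IsSkewable (contactEnd τ α) := by
  refine isSkewable_hyperplaneEnd (pushCovector_ne_zero τ α) (pushForm_skew τ α)
    fun w hw hw' ↦ ?_
  have h1 := (α.2 p).2 (τ.symm w) hw fun v hv ↦ by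
    have h2 := hw' (τ v) (by rw [pushCovector_apply, τ.symm_apply_apply]; exact hv)
    rw [pushForm_apply, τ.symm_apply_apply] at h2
    exact h2
  simpa using h1

theorem SameKernel.contactEnd_eq (τ : TangentSpace 𝓘(ℝ, E) p ≃L[ℝ] E) {α β : ContactForm E M}
    (h : SameKernel α β) : contactEnd τ α = contactEnd τ β := by
  obtain ⟨f, hf⟩ := h
  have h1 : pushCovector τ β = f p • pushCovector τ α := by
    refine ContinuousLinearMap.ext fun w ↦ ?_
    exact congrArg (fun L : E →L[ℝ] ℝ ↦ L ((framing τ).symm w)) (hf p).2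
  rw [contactEnd, contactEnd, h1]
  refine (hyperplaneEnd_smul (pushCovector_ne_zero τ α) (hf p).1 fun w w' hw hw' ↦ ?_).symm
  exact OneForm.d_eq_of_smul (fun x ↦ (hf x).2) (α.2 p).1 hw hw'

/-- The endomorphism of `E ⊕ ℝ` associated with a contact structure at `p`. -/
def ContactStructure.endAt (τ : TangentSpace 𝓘(ℝ, E) p ≃L[ℝ] E) :
    ContactStructure E M → (E × ℝ) →L[ℝ] (E × ℝ) :=
  Quotient.lift (contactEnd τ) fun _ _ h ↦ SameKernel.contactEnd_eq τ h

theorem ContactStructure.continuous_endAt (τ : TangentSpace 𝓘(ℝ, E) p ≃L[ℝ] E) :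
    Continuous (ContactStructure.endAt (M := M) τ) :=
  (continuous_contactEnd τ).quotient_lift _

theorem ContactStructure.isSkewable_endAt (τ : TangentSpace 𝓘(ℝ, E) p ≃L[ℝ] E)
    (η : ContactStructure E M) : IsSkewable (η.endAt τ) := by
  induction η using Quotient.inductionOn with
  | h α => exact isSkewable_contactEnd τ α

/-- The complex structure on `E ⊕ ℝ` in the polar decomposition of `ContactStructure.endAt`. -/
def polarAt (ξ : ContactStructure E M) (τ : TangentSpace 𝓘(ℝ, E) p ≃L[ℝ] E) :
    C(IsotopyClass ξ, (E × ℝ) →L[ℝ] (E × ℝ)) where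
  toFun η := polar (η.1.endAt τ)
  continuous_toFun := continuous_polar
    ((ContactStructure.continuous_endAt τ).comp continuous_subtype_val)
    fun η ↦ η.1.isSkewable_endAt τ

/-- Thus `polarAt` yields complex structures from contact structures alone, with no almost complex
structure chosen; it is the map that carries the degree over to `C(M, ξ)`. -/
theorem polarAt_mul_self (ξ : ContactStructure E M) (τ : TangentSpace 𝓘(ℝ, E) p ≃L[ℝ] E)
    (η : IsotopyClass ξ) : polarAt ξ τ η * polarAt ξ τ η = -1 :=
  (η.1.isSkewable_endAt τ).polar_mul_self

theorem evalPair_apply (τ : TangentSpace 𝓘(ℝ, E) p ≃L[ℝ] E) (c : CompatiblePair E M) (w : E) :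
    (evalPair p τ c).1.2 w =
      framing τ (c.A.valueAt p ((framing τ).symm
        (projPerp (unitNormal (pushCovector τ c.α)) w))) := rfl

theorem evalPair_apply_of_mem (τ : TangentSpace 𝓘(ℝ, E) p ≃L[ℝ] E) (c : CompatiblePair E M) {w : E}
    (hw : pushCovector τ c.α w = 0) :
    (evalPair p τ c).1.2 w = framing τ (c.A.valueAt p ((framing τ).symm w)) := by
  rw [evalPair_apply, projPerp_of_inner_eq_zero
    ((inner_unitNormal_eq_zero (pushCovector_ne_zero τ c.α)).2 hw)]

theorem isCompatible_evalPair (τ : TangentSpace 𝓘(ℝ, E) p ≃L[ℝ] E) (c : CompatiblePair E M) :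
    IsCompatible (prodForm E) (contactEnd τ c.α) (stabilize (evalPair p τ c)).1 := by
  have hs : ∀ w, pushCovector τ c.α w = 0 → (framing τ).symm ((evalPair p τ c).1.2 w) =
      c.A.valueAt p ((framing τ).symm w) := fun w hw ↦ by
    rw [evalPair_apply_of_mem τ c hw, ContinuousLinearEquiv.symm_apply_apply]
  refine isCompatible_hyperplaneEnd (pushCovector_ne_zero τ c.α) (pushForm_skew τ c.α) rfl
    (fun w w' hw hw' ↦ ?_) fun w hw hne ↦ ?_
  · refine (congrArg₂ (fun u u' : E ↦ c.α.1.d p u u') (hs w hw) (hs w' hw')).trans ?_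
    exact c.invariant p (τ.symm w) (τ.symm w') hw hw'
  · refine lt_of_lt_of_eq ?_ (congrArg (fun u : E ↦ c.α.1.d p ((framing τ).symm w) u) (hs w hw)).symm
    exact c.pos p (τ.symm w) hw fun h0 ↦ hne (by simpa using h0)

theorem isCompatible_evalAt (τ : TangentSpace 𝓘(ℝ, E) p ≃L[ℝ] E) (c : CompatibleStructure E M) :
    IsCompatible (prodForm E) (c.forget.endAt τ) (stabilize (evalAt p τ c)).1 := by
  induction c using Quotient.inductionOn with
  | h c => exact isCompatible_evalPair τ c

theorem continuous_evalPair (τ : TangentSpace 𝓘(ℝ, E) p ≃L[ℝ] E) :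
    Continuous fun c : CompatiblePair E M ↦ (evalPair p τ c).1 := by
  have h0 : Continuous fun c : CompatiblePair E M ↦ (c.α, c.A) := continuous_induced_dom
  have hα : Continuous fun c : CompatiblePair E M ↦ c.α := continuous_fst.comp h0
  have hA : Continuous fun c : CompatiblePair E M ↦ c.A := continuous_snd.comp h0
  have hv : Continuous fun c : CompatiblePair E M ↦ unitNormal (pushCovector τ c.α) :=
    continuous_unitNormal ((continuous_pushCovector τ).comp hα) fun c ↦ pushCovector_ne_zero τ c.α
  have hAv : Continuous fun c : CompatiblePair E M ↦ c.A.valueAt p :=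
    (EndField.continuous_valueAt p).comp hA
  refine hv.prodMk (continuous_clm_apply.2 fun w ↦ ?_)
  exact (framing τ).continuous.comp (hAv.clm_apply ((framing τ).symm.continuous.comp
    (continuous_projPerp_apply hv continuous_const)))

theorem continuous_evalAt (τ : TangentSpace 𝓘(ℝ, E) p ≃L[ℝ] E) :
    Continuous fun c : CompatibleStructure E M ↦ (evalAt p τ c).1 :=
  continuous_coinduced_dom.2 (continuous_evalPair τ)

/-- The polar part and the stabilized `j` are compatible with the same skew operator, and the
homotopy between them is continuous in the parameter of the sphere. This replaces a homotopy inverse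
of the forgetful map. -/
theorem exists_homotopy_polarAt {ξ : ContactStructure E M} (τ : TangentSpace 𝓘(ℝ, E) p ≃L[ℝ] E)
    (F : C(S2, CompatibleOver ξ)) : ∃ H : C(S2 × I, (E × ℝ) →L[ℝ] (E × ℝ)),
      (∀ q, H q * H q = -1) ∧ (∀ z, H (z, 0) = polarAt ξ τ (forget ξ (F z))) ∧
      ∀ z, H (z, 1) = (stabilize (evalAt p τ (F z).1)).1 := by
  have hF : Continuous fun z ↦ (F z).1 := continuous_subtype_val.comp F.continuous
  have hc : Continuous fun z ↦ (evalAt p τ (F z).1).1 := (continuous_evalAt τ).comp hF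
  exact exists_polar_homotopy prodForm_symm prodForm_pos
    ((ContactStructure.continuous_endAt τ).comp
      (CompatibleStructure.continuous_forget.comp hF))
    (continuous_stabilizeEnd (continuous_fst.comp hc) (continuous_snd.comp hc))
    fun z ↦ isCompatible_evalAt τ (F z).1

theorem HasDegree.polarAt {ξ : ContactStructure E M} (τ : TangentSpace 𝓘(ℝ, E) p ≃L[ℝ] E)
    (F : C(S2, CompatibleOver ξ)) {k : ℕ} {d : ℤ}
    (h : HasDegree k (fun z ↦ stabilize (evalAt p τ (F z).1)) d) :
    HasDegree k (fun z ↦ ⟨polarAt ξ τ (forget ξ (F z)),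
      sq_eq_neg_one_iff.1 (polarAt_mul_self ξ τ _)⟩) d := by
  obtain ⟨H, hH, h0, h1⟩ := exists_homotopy_polarAt τ F
  refine HasDegree.of_homotopy (H.comp ⟨fun q ↦ (q.1, unitInterval.symm q.2), by fun_prop⟩)
    (fun q ↦ hH _) (fun z ↦ ?_) (fun z ↦ ?_) h
  · simpa using h1 z
  · simpa using h0 z

/-- The degree of the evaluation at `p` depends only on the homotopy class of the sphere of contact
structures. -/
theorem HasDegree.of_homotopic {ξ : ContactStructure E M} (τ : TangentSpace 𝓘(ℝ, E) p ≃L[ℝ] E)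
    {F F' : C(S2, CompatibleOver ξ)}
    (hFF' : ((forget ξ).comp F').Homotopic ((forget ξ).comp F)) {k : ℕ} {d : ℤ}
    (h : HasDegree k (fun z ↦ stabilize (evalAt p τ (F z).1)) d) :
    HasDegree k (fun z ↦ stabilize (evalAt p τ (F' z).1)) d := by
  -- Each evaluation is homotopic to `polarAt` of its sphere of contact structures, and those two
  -- spheres are homotopic through `K`.
  obtain ⟨K⟩ := hFF'.symm
  obtain ⟨H, hH, h0, h1⟩ := exists_homotopy_polarAt τ F'
  have hd := h.polarAt τ F
  have h2 := HasDegree.of_homotopy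
    (f₀ := fun z ↦ ⟨ContactSphere.polarAt ξ τ (forget ξ (F z)),
      sq_eq_neg_one_iff.1 (polarAt_mul_self ξ τ _)⟩)
    (f₁ := fun z ↦ ⟨ContactSphere.polarAt ξ τ (forget ξ (F' z)),
      sq_eq_neg_one_iff.1 (polarAt_mul_self ξ τ _)⟩)
    (((ContactSphere.polarAt ξ τ).comp K.toContinuousMap).comp ⟨Prod.swap, continuous_swap⟩)
    (fun q ↦ polarAt_mul_self ξ τ _)
    (fun z ↦ congrArg (ContactSphere.polarAt ξ τ) (K.apply_zero z))
    (fun z ↦ congrArg (ContactSphere.polarAt ξ τ) (K.apply_one z)) hd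
  exact HasDegree.of_homotopy H hH h0 h1 h2

end PointEvaluation

/-! ### The degree of the linear contact sphere -/

section Degree

variable {E : Type*} [NormedAddCommGroup E] [InnerProductSpace ℝ E] [FiniteDimensional ℝ E]
variable {M : Type*} [TopologicalSpace M] [ChartedSpace E M] [IsManifold 𝓘(ℝ, E) ∞ M]
variable {g : RMetric E M} {D : CovariantDerivative (𝓘(ℝ, E).prod 𝓘(ℝ, ℝ)) (E × ℝ)
      (fun c : M × Ray ↦ TangentSpace (𝓘(ℝ, E).prod 𝓘(ℝ, ℝ)) c)} {S : ThreeSasakian g} {p : M}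

/-- The isomorphism `(u, r ∂_r) ↦ (τ u, -r ∂_t)`. -/
def coneFraming (τ : TangentSpace 𝓘(ℝ, E) p ≃L[ℝ] E) : (E × ℝ) ≃L[ℝ] (E × ℝ) :=
  (framing τ).prodCongr (ContinuousLinearEquiv.neg ℝ)

theorem coneFraming_apply (τ : TangentSpace 𝓘(ℝ, E) p ≃L[ℝ] E) (x : E × ℝ) :
    coneFraming τ x = (framing τ x.1, -x.2) := rfl

theorem coneFraming_symm_apply (τ : TangentSpace 𝓘(ℝ, E) p ≃L[ℝ] E) (x : E × ℝ) :
    (coneFraming τ).symm x = ((framing τ).symm x.1, -x.2) := rfl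

theorem inv_inner_unitNormal_mul {a : E →L[ℝ] ℝ} (ha : a ≠ 0) {ρ : E} (hρ : a ρ = 1) (w : E) :
    ⟪unitNormal a, ρ⟫⁻¹ * ⟪unitNormal a, w⟫ = a w := by
  have h0 : (InnerProductSpace.toDual ℝ E).symm a ≠ 0 := by simpa using ha
  have h1 := norm_ne_zero_iff.2 h0
  rw [unitNormal, real_inner_smul_left, real_inner_smul_left, InnerProductSpace.toDual_symm_apply,
    InnerProductSpace.toDual_symm_apply, hρ]
  field_simp

theorem inner_unitNormal_pos {a : E →L[ℝ] ℝ} (ha : a ≠ 0) {ρ : E} (hρ : a ρ = 1) :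
    0 < ⟪unitNormal a, ρ⟫ := by
  have h0 : (InnerProductSpace.toDual ℝ E).symm a ≠ 0 := by simpa using ha
  rw [unitNormal, real_inner_smul_left, InnerProductSpace.toDual_symm_apply, hρ, mul_one]
  exact inv_pos.2 (norm_pos_iff.2 h0)

namespace ThreeSasakian.IsHyperkahler

theorem form_reeb_self (h : S.IsHyperkahler D) (z : S2) (x : M) :
    (h.form z).1 x (S.quatAt x z (0, 1)).1 = 1 := by
  rw [h.form_reeb, h.quatAt_orthogonal, coneForm_slice]
  simp

/-- The complex structure of the cone sends the Reeb vector `q_z ∂_r` to `-∂_r`, whereas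
stabilization sends the normal to `∂_t`; the sign in `coneFraming` reconciles them. What is left of
the difference is the Reeb vector in place of the unit normal. -/
theorem conjEnd_quatAt (h : S.IsHyperkahler D) (τ : TangentSpace 𝓘(ℝ, E) p ≃L[ℝ] E) (z : S2) :
    conjEnd (coneFraming τ) (S.quatAt p z) =
      transverseEnd (evalPair p τ (h.compatiblePair z)).1.1
        (evalPair p τ (h.compatiblePair z)).1.2 (framing τ (S.quatAt p z (0, 1)).1) := by
  refine ContinuousLinearMap.ext fun x ↦ ?_
  set α := h.contactForm z with hα
  set u : E := (framing τ).symm x.1 with hu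
  set R : E := (S.quatAt p z (0, 1)).1 with hR
  have ha := pushCovector_ne_zero τ α
  have hρ : pushCovector τ α (framing τ R) = 1 := by
    refine Eq.trans ?_ (h.form_reeb_self z p)
    exact congrArg (fun w : E ↦ (h.form z).valueAt p w) ((framing τ).symm_apply_apply R)
  have hax : pushCovector τ α x.1 = (h.form z).valueAt p u := rfl
  have hRq : ((R, 0) : E × ℝ) = S.quatAt p z (0, 1) := Prod.ext rfl (h.quatAt_radial_snd p z).symm
  have hv : (evalPair p τ (h.compatiblePair z)).1.1 = unitNormal (pushCovector τ α) := rfl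
  have hker : pushCovector τ (h.compatiblePair z).α
      (x.1 - (pushCovector τ α x.1) • framing τ R) = 0 := by
    change pushCovector τ α _ = 0
    rw [map_sub, map_smul, hρ]
    simp
  rw [transverseEnd_apply, hv, inv_inner_unitNormal_mul ha hρ, evalPair_apply_of_mem τ _ hker,
    conjEnd_apply, coneFraming_apply, coneFraming_symm_apply, ← hu, map_sub, map_smul,
    ContinuousLinearEquiv.symm_apply_apply, ← hu, hax]
  have hsplit : ((u, -x.2) : E × ℝ) = (u, 0) - x.2 • (0, 1) := by
    ext <;> simp
  have hA : (h.compatiblePair z).A.valueAt p (u - (h.form z).valueAt p u • R) =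
      (S.quatAt p z (u, 0)).1 := by
    refine (h.endField_apply z p _).trans ?_
    have h1 : ((u - (h.form z).valueAt p u • R, 0) : E × ℝ) =
        (u, 0) - (h.form z).valueAt p u • S.quatAt p z (0, 1) := by
      rw [← hRq]
      ext <;> simp
    rw [h1, map_sub, map_smul, quatAt_sq]
    simp
    rfl
  rw [hA, hsplit, map_sub, map_smul]
  refine Prod.ext ?_ ?_
  · simp only [Prod.fst_sub, Prod.smul_fst, map_sub, map_smul, ← hR]
  · simp only [Prod.snd_sub, Prod.smul_snd, h.quatAt_radial_snd, smul_zero, sub_zero]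
    rw [h.quatAt_snd, neg_neg, coneForm_symm]
    exact (h.form_apply z p u).symm

/-- Conjugation preserves the quaternion relations, and the degree of a quaternionic sphere depends
only on the dimension; so neither the framing nor its orientation matters. -/
theorem hasDegree_evalPair (h : S.IsHyperkahler D) (τ : TangentSpace 𝓘(ℝ, E) p ≃L[ℝ] E) {k : ℕ}
    (hk : Module.finrank ℝ E + 1 = 2 * k) :
    HasDegree k (fun z ↦ stabilize (evalPair p τ (h.compatiblePair z))) k := by
  have hq := ((S.isQuaternionic p).conj (coneFraming τ)).hasDegree (k := k)
    (by rw [Module.finrank_prod, Module.finrank_self, hk])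
  have hρ : Continuous fun z : S2 ↦ framing τ (S.quatAt p z (0, 1)).1 := by
    refine (framing τ).continuous.comp (continuous_fst.comp ?_)
    simp only [quatAt_apply]
    fun_prop
  refine HasDegree.of_transverseEnd ((continuous_evalPair τ).comp h.continuous_compatiblePair) hρ
    (fun z ↦ ?_) (fun z ↦ ?_) hq
  · refine inner_unitNormal_pos (pushCovector_ne_zero τ _) (Eq.trans ?_ (h.form_reeb_self z p))
    exact congrArg (fun w : E ↦ (h.form z).valueAt p w) ((framing τ).symm_apply_apply _)
  · rw [← h.conjEnd_quatAt]
    exact quatSphere_conjEnd _ _ _ _ _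

variable [T2Space M] [CompactSpace M]

theorem hasDegree_lift (h : S.IsHyperkahler D) (τ : TangentSpace 𝓘(ℝ, E) p ≃L[ℝ] E) {k : ℕ}
    (hk : Module.finrank ℝ E + 1 = 2 * k) :
    HasDegree k (fun z ↦ stabilize (evalAt p τ (h.lift z).1)) k :=
  h.hasDegree_evalPair τ hk

/-- One point and one framing suffice: `polarAt` there sends the sphere to one of degree `k`, and
`k` is not `0` because `2 k` is the dimension plus one. -/
theorem not_isOfFinOrder_sphere [Nonempty M] (h : S.IsHyperkahler D) {k : ℕ}
    (hk : Module.finrank ℝ E + 1 = 2 * k) : ¬ IsOfFinOrder (sphereClass h.sphere) := by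
  obtain ⟨p⟩ := ‹Nonempty M›
  let τ : TangentSpace 𝓘(ℝ, E) p ≃L[ℝ] E := ContinuousLinearEquiv.refl ℝ E
  have hd := (h.hasDegree_lift τ hk).polarAt τ h.lift
  exact not_isOfFinOrder_sphereClass h.sphere (polarAt _ τ) (polarAt_mul_self _ τ)
    (by omega) hd

end ThreeSasakian.IsHyperkahler

end Degree

end ContactSphere

end

/-! ### The main theorem -/

theorem mainTheorem3 (n : ℕ) {M : Type*} [TopologicalSpace M] [T2Space M] [CompactSpace M]
    [Nonempty M] [ChartedSpace (EuclideanSpace ℝ (Fin (4 * n + 3))) M]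
    [IsManifold 𝓘(ℝ, EuclideanSpace ℝ (Fin (4 * n + 3))) ∞ M]
    (g : RMetric (EuclideanSpace ℝ (Fin (4 * n + 3))) M) (S : ThreeSasakian g) :
    ∃ (αI αJ αK : ContactForm (EuclideanSpace ℝ (Fin (4 * n + 3))) M)
      (f : C(S2, IsotopyClass αI.ker)),
      IsAssociatedForm g S.jI αI.1 ∧ IsAssociatedForm g S.jJ αJ.1 ∧ IsAssociatedForm g S.jK αK.1 ∧
      IsLinearContactSphere f αI αJ αK ∧
      ¬ IsOfFinOrder (sphereClass f) ∧
      (∃ F : C(S2, CompatibleOver αI.ker), (forget αI.ker).comp F = f) ∧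
      ∀ (p : M) (τ : TangentSpace 𝓘(ℝ, EuclideanSpace ℝ (Fin (4 * n + 3))) p ≃L[ℝ]
          EuclideanSpace ℝ (Fin (4 * n + 3)))
        (F : C(S2, CompatibleOver αI.ker)),
        ((forget αI.ker).comp F).Homotopic f →
        HasDegree (2 * n + 2) (fun z ↦ stabilize (evalAt p τ (F z).1)) (2 * (n + 1)) := by
  obtain ⟨D, hD, hI, hJ, hK⟩ := S.hyperkahler
  have h : S.IsHyperkahler D := ⟨hD, hI, hJ, hK⟩
  -- The point to which `collapse` sends the boundary is `(1, 0, 0)`, so the sphere of contact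
  -- structures is based at `ker α_I`. The forms `α_J` and `α_K` are the values at the other two
  -- coordinate vectors.
  have eI : h.form basePoint = assocForm h.jI := Subtype.ext <| funext fun x ↦ by
    change basePoint.1 0 • (assocForm h.jI).1 x + basePoint.1 1 • (assocForm h.jJ).1 x +
      basePoint.1 2 • (assocForm h.jK).1 x = _
    simp [basePoint]
  let e₁ : S2 := ⟨EuclideanSpace.single 1 1, by simp⟩
  let e₂ : S2 := ⟨EuclideanSpace.single 2 1, by simp⟩
  have eJ : h.form e₁ = assocForm h.jJ := Subtype.ext <| funext fun x ↦ by
    change e₁.1 0 • (assocForm h.jI).1 x + e₁.1 1 • (assocForm h.jJ).1 x +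
      e₁.1 2 • (assocForm h.jK).1 x = _
    simp [e₁]
  have eK : h.form e₂ = assocForm h.jK := Subtype.ext <| funext fun x ↦ by
    change e₂.1 0 • (assocForm h.jI).1 x + e₂.1 1 • (assocForm h.jJ).1 x +
      e₂.1 2 • (assocForm h.jK).1 x = _
    simp [e₂]
  -- The cone has real dimension `4n + 4`, hence complex dimension `2n + 2`, which is the degree.
  have hk : Module.finrank ℝ (EuclideanSpace ℝ (Fin (4 * n + 3))) + 1 = 2 * (2 * n + 2) := by
    rw [finrank_euclideanSpace_fin]
    ring
  refine ⟨h.contactForm basePoint, h.contactForm e₁, h.contactForm e₂, h.sphere,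
    (congrArg (IsAssociatedForm g S.jI) eI).mpr (isAssociatedForm_assocForm h.jI),
    (congrArg (IsAssociatedForm g S.jJ) eJ).mpr (isAssociatedForm_assocForm h.jJ),
    (congrArg (IsAssociatedForm g S.jK) eK).mpr (isAssociatedForm_assocForm h.jK),
    h.isLinearContactSphere eI eJ eK,
    h.not_isOfFinOrder_sphere hk, ⟨h.lift, h.forget_comp_lift⟩, fun p τ F hF ↦ ?_⟩
  have hd := HasDegree.of_homotopic τ (F := h.lift) hF (h.hasDegree_lift τ hk)
  convert hd using 1
  push_cast
  ring
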